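/- Work in constructive (Bishop-style) mathematics: intuitionistic logic, without the law of excluded middle, together with countable choice and dependent choice. To be definite, let $T$ be intuitionistic higher-order arithmetic: many-sorted intuitionistic predicate logic with equality over the sorts generated from $\mathbb{N}$ by products, function sorts and power sorts, with the Peano axioms, full induction, extensionality, comprehension for all formulas, unique choice, countable choice and dependent choice. A set is *countable* if it is the image of a detachable subset of $\mathbb{N}$. A set $A\subseteq\mathbb{N}$ is *pseudobounded* if $\lim_{n\to\infty}s_n/n=0$ for every sequence $(s_n)_{n\ge1}$ in $A$. Let **BD-N** be the statement that every inhabited, countable, pseudobounded subset of $\mathbb{N}$ is bounded. Real numbers are Dedekind reals, a metric space is separable if it has a countable dense subset, and $\mathbb{N}^{\mathbb{N}}$ carries the product topology (for which $\beta$ is close to $\alpha$ if the two sequences agree on a long initial segment). Then $T$ proves that each of the following statements is equivalent to **BD-N**. 1. Every sequentially continuous map from a separable metric space to a metric space is pointwise continuous. 2. Every sequentially continuous map $f:\mathbb{N}^{\mathbb{N}}\to\mathbb{N}$ is pointwise continuous. 3. Every sequentially continuous map $f:\mathbb{N}^{\mathbb{N}}\to\mathbb{N}$ is locally bounded, that is,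 for each $\alpha\in\mathbb{N}^{\mathbb{N}}$ there are $k,K\in\mathbb{N}$ such that $f(\beta)\le K$ for all $\beta$ that agree with $\alpha$ on the first $k$ terms. In 1 the spaces are subsets of arbitrary sorts with a metric, so that 1 is a scheme with one instance for each pair of sorts: $T+\textbf{BD-N}$ proves every instance, and $T$ with all the instances proves **BD-N**. -/

import Mathlib

/-!
Over classical logic every statement below is true, so an equivalence between them only has content
when it is read as *derivability in a constructive theory*. The theory is
intuitionistic higher-order arithmetic (many-sorted intuitionistic predicate logic over the sorts
generated from the natural numbers by products, function sorts and power sorts, with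
extensionality, full comprehension and unique choice), together with the two choice principles
used in Bishop-style mathematics: countable choice and dependent choice. There is no excluded middle.
-/

namespace BISH

/-! ### Sorts, terms and formulas (well-sorted, well-scoped, with de Bruijn variables) -/

/-- Sorts: `ℕ`, the functions `σ → τ`, the subsets of `σ`, and the pairs `σ × τ`. -/
inductive Srt : Type
  | nat : Srt
  | fn : Srt → Srt → Srt
  | pow : Srt → Srt
  | prod : Srt → Srt → Srt

/-- A context: the sorts of the free variables, the most recently bound one first. -/
abbrev Ctx : Type := List Srt

/-- `Var Γ σ`: the variables of sort `σ` in the context `Γ`. -/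
inductive Var : Ctx → Srt → Type
  | here {Γ : Ctx} {σ : Srt} : Var (σ :: Γ) σ
  | there {Γ : Ctx} {σ τ : Srt} : Var Γ σ → Var (τ :: Γ) σ

/-- `Tm Γ σ`: the terms of sort `σ` with free variables in `Γ`. -/
inductive Tm (Γ : Ctx) : Srt → Type
  | var {σ : Srt} : Var Γ σ → Tm Γ σ
  | zero : Tm Γ Srt.nat
  | succ : Tm Γ Srt.nat → Tm Γ Srt.nat
  | add : Tm Γ Srt.nat → Tm Γ Srt.nat → Tm Γ Srt.nat
  | mul : Tm Γ Srt.nat → Tm Γ Srt.nat → Tm Γ Srt.nat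
  | app {σ τ : Srt} : Tm Γ (Srt.fn σ τ) → Tm Γ σ → Tm Γ τ
  | pair {σ τ : Srt} : Tm Γ σ → Tm Γ τ → Tm Γ (Srt.prod σ τ)
  | fst {σ τ : Srt} : Tm Γ (Srt.prod σ τ) → Tm Γ σ
  | snd {σ τ : Srt} : Tm Γ (Srt.prod σ τ) → Tm Γ τ

/-- `Fm Γ`: the formulas with free variables in `Γ`. All connectives are primitive, except for
negation and equivalence, which are defined as usual in intuitionistic logic. -/
inductive Fm : Ctx → Type
  | eq {Γ : Ctx} {σ : Srt} : Tm Γ σ → Tm Γ σ → Fm Γ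
  | mem {Γ : Ctx} {σ : Srt} : Tm Γ σ → Tm Γ (Srt.pow σ) → Fm Γ
  | bot {Γ : Ctx} : Fm Γ
  | and {Γ : Ctx} : Fm Γ → Fm Γ → Fm Γ
  | or {Γ : Ctx} : Fm Γ → Fm Γ → Fm Γ
  | imp {Γ : Ctx} : Fm Γ → Fm Γ → Fm Γ
  | all {Γ : Ctx} (σ : Srt) : Fm (σ :: Γ) → Fm Γ
  | ex {Γ : Ctx} (σ : Srt) : Fm (σ :: Γ) → Fm Γ

/-- Sentences are the formulas without free variables. -/
abbrev Sentence : Type := Fm []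

/-! ### Renaming and substitution -/

/-- Renamings of variables. -/
abbrev Ren (Γ Δ : Ctx) : Type := ∀ σ : Srt, Var Γ σ → Var Δ σ

/-- The extension of a renaming under a binder. -/
def Ren.lift {Γ Δ : Ctx} (r : Ren Γ Δ) (τ : Srt) : Ren (τ :: Γ) (τ :: Δ)
  | _, Var.here => Var.here
  | _, Var.there v => Var.there (r _ v)

/-- Renaming in a term. -/
def Tm.ren {Γ Δ : Ctx} (r : Ren Γ Δ) : ∀ {σ : Srt}, Tm Γ σ → Tm Δ σ
  | _, Tm.var v => Tm.var (r _ v)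
  | _, Tm.zero => Tm.zero
  | _, Tm.succ t => Tm.succ (t.ren r)
  | _, Tm.add s t => Tm.add (s.ren r) (t.ren r)
  | _, Tm.mul s t => Tm.mul (s.ren r) (t.ren r)
  | _, Tm.app s t => Tm.app (s.ren r) (t.ren r)
  | _, Tm.pair s t => Tm.pair (s.ren r) (t.ren r)
  | _, Tm.fst t => Tm.fst (t.ren r)
  | _, Tm.snd t => Tm.snd (t.ren r)

/-- Renaming in a formula. -/
def Fm.ren : ∀ {Γ Δ : Ctx}, Ren Γ Δ → Fm Γ → Fm Δ
  | _, _, r, Fm.eq s t => Fm.eq (s.ren r) (t.ren r)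
  | _, _, r, Fm.mem s t => Fm.mem (s.ren r) (t.ren r)
  | _, _, _, Fm.bot => Fm.bot
  | _, _, r, Fm.and φ ψ => Fm.and (φ.ren r) (ψ.ren r)
  | _, _, r, Fm.or φ ψ => Fm.or (φ.ren r) (ψ.ren r)
  | _, _, r, Fm.imp φ ψ => Fm.imp (φ.ren r) (ψ.ren r)
  | _, _, r, Fm.all σ φ => Fm.all σ (φ.ren (r.lift σ))
  | _, _, r, Fm.ex σ φ => Fm.ex σ (φ.ren (r.lift σ))

/-- Weakening: regard a term as a term in a context with one more variable. -/
def Tm.wk {Γ : Ctx} {σ : Srt} (τ : Srt) (t : Tm Γ σ) : Tm (τ :: Γ) σ :=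
  t.ren fun _ v => Var.there v

/-- Weakening of formulas. -/
def Fm.wk {Γ : Ctx} (τ : Srt) (φ : Fm Γ) : Fm (τ :: Γ) :=
  φ.ren fun _ v => Var.there v

/-- Substitutions of terms for variables. -/
abbrev Sub (Γ Δ : Ctx) : Type := ∀ σ : Srt, Var Γ σ → Tm Δ σ

/-- The extension of a substitution under a binder. -/
def Sub.lift {Γ Δ : Ctx} (s : Sub Γ Δ) (τ : Srt) : Sub (τ :: Γ) (τ :: Δ)
  | _, Var.here => Tm.var Var.here
  | _, Var.there v => (s _ v).wk τ

/-- Substitution in a term. -/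
def Tm.sub {Γ Δ : Ctx} (s : Sub Γ Δ) : ∀ {σ : Srt}, Tm Γ σ → Tm Δ σ
  | _, Tm.var v => s _ v
  | _, Tm.zero => Tm.zero
  | _, Tm.succ t => Tm.succ (t.sub s)
  | _, Tm.add t u => Tm.add (t.sub s) (u.sub s)
  | _, Tm.mul t u => Tm.mul (t.sub s) (u.sub s)
  | _, Tm.app t u => Tm.app (t.sub s) (u.sub s)
  | _, Tm.pair t u => Tm.pair (t.sub s) (u.sub s)
  | _, Tm.fst t => Tm.fst (t.sub s)
  | _, Tm.snd t => Tm.snd (t.sub s)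

/-- Substitution in a formula (capture is impossible by construction). -/
def Fm.sub : ∀ {Γ Δ : Ctx}, Sub Γ Δ → Fm Γ → Fm Δ
  | _, _, s, Fm.eq t u => Fm.eq (t.sub s) (u.sub s)
  | _, _, s, Fm.mem t u => Fm.mem (t.sub s) (u.sub s)
  | _, _, _, Fm.bot => Fm.bot
  | _, _, s, Fm.and φ ψ => Fm.and (φ.sub s) (ψ.sub s)
  | _, _, s, Fm.or φ ψ => Fm.or (φ.sub s) (ψ.sub s)
  | _, _, s, Fm.imp φ ψ => Fm.imp (φ.sub s) (ψ.sub s)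
  | _, _, s, Fm.all σ φ => Fm.all σ (φ.sub (s.lift σ))
  | _, _, s, Fm.ex σ φ => Fm.ex σ (φ.sub (s.lift σ))

/-- The substitution that replaces the most recently bound variable by `t`. -/
def Sub.single {Γ : Ctx} {τ : Srt} (t : Tm Γ τ) : Sub (τ :: Γ) Γ
  | _, Var.here => t
  | _, Var.there v => Tm.var v

/-- `φ.inst t` is `φ` with `t` in place of its most recently bound variable. -/
def Fm.inst {Γ : Ctx} {τ : Srt} (φ : Fm (τ :: Γ)) (t : Tm Γ τ) : Fm Γ :=
  φ.sub (Sub.single t)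

/-! ### Notation

`All σ fun x => φ` and `Ex σ fun x => φ` are the quantifiers with a named variable. The variable
`x` can be used in `φ` at any depth below further quantifiers: the de Bruijn index is found by
instance search, from the context in which `x` is used. In the same way `↟t` is the term `t`, used
below further quantifiers. -/

/-- `Γ` is a tail of `Δ`: `Δ` arises from `Γ` by binding further variables. -/
class Ext (Γ Δ : Ctx) where
  /-- The inclusion of the variables of `Γ` into those of `Δ`. -/
  incl : Ren Γ Δ

instance extRefl (Γ : Ctx) : Ext Γ Γ := ⟨fun _ v => v⟩

instance extStep (Γ Δ : Ctx) (τ : Srt) [e : Ext Γ Δ] : Ext Γ (τ :: Δ) :=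
  ⟨fun _ v => Var.there (e.incl _ v)⟩

/-- The term `t`, used below further quantifiers. -/
def Tm.up {Γ Δ : Ctx} [e : Ext Γ Δ] {σ : Srt} (t : Tm Γ σ) : Tm Δ σ := t.ren e.incl

prefix:max "↟" => Tm.up

/-- Universal quantification over the sort `σ`. -/
def All {Γ : Ctx} (σ : Srt) (f : (∀ {Δ : Ctx} [Ext (σ :: Γ) Δ], Tm Δ σ) → Fm (σ :: Γ)) : Fm Γ :=
  Fm.all σ (f fun {Δ} [e : Ext (σ :: Γ) Δ] => Tm.var (e.incl _ Var.here))

/-- Existential quantification over the sort `σ`. -/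
def Ex {Γ : Ctx} (σ : Srt) (f : (∀ {Δ : Ctx} [Ext (σ :: Γ) Δ], Tm Δ σ) → Fm (σ :: Γ)) : Fm Γ :=
  Fm.ex σ (f fun {Δ} [e : Ext (σ :: Γ) Δ] => Tm.var (e.incl _ Var.here))

infix:50 " ≐ " => Fm.eq
infix:50 " ∊ " => Fm.mem
infixr:35 " ⩓ " => Fm.and
infixr:30 " ⩔ " => Fm.or
infixr:25 " ⇾ " => Fm.imp

/-- Negation. -/
def Fm.neg {Γ : Ctx} (φ : Fm Γ) : Fm Γ := φ ⇾ Fm.bot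

/-- Equivalence. -/
def Fm.iff {Γ : Ctx} (φ ψ : Fm Γ) : Fm Γ := (φ ⇾ ψ) ⩓ (ψ ⇾ φ)

infix:20 " ⟺ " => Fm.iff

/-! ### The non-logical axioms -/

open Srt Tm

/-- The axioms of intuitionistic higher-order arithmetic with countable and dependent choice, in
an arbitrary context. -/
inductive Ax : ∀ {Γ : Ctx}, Fm Γ → Prop
  /-- Zero is not a successor. -/
  | succ_ne_zero {Γ : Ctx} : Ax (Γ := Γ) <|
      All nat fun x => Fm.neg (succ x ≐ zero)
  /-- The successor is injective. -/
  | succ_inj {Γ : Ctx} : Ax (Γ := Γ) <|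
      All nat fun x => All nat fun y => (succ x ≐ succ y) ⇾ (x ≐ y)
  | add_zero {Γ : Ctx} : Ax (Γ := Γ) <|
      All nat fun x => add x zero ≐ x
  | add_succ {Γ : Ctx} : Ax (Γ := Γ) <|
      All nat fun x => All nat fun y => add x (succ y) ≐ succ (add x y)
  | mul_zero {Γ : Ctx} : Ax (Γ := Γ) <|
      All nat fun x => mul x zero ≐ zero
  | mul_succ {Γ : Ctx} : Ax (Γ := Γ) <|
      All nat fun x => All nat fun y => mul x (succ y) ≐ add (mul x y) x
  /-- Induction (for all formulas, in view of comprehension). -/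
  | induction {Γ : Ctx} : Ax (Γ := Γ) <|
      All (pow nat) fun A =>
        (zero ∊ A) ⩓ (All nat fun x => (x ∊ A) ⇾ (succ x ∊ A)) ⇾ All nat fun x => x ∊ A
  | fst_pair {Γ : Ctx} (σ τ : Srt) : Ax (Γ := Γ) <|
      All σ fun x => All τ fun y => fst (pair x y) ≐ x
  | snd_pair {Γ : Ctx} (σ τ : Srt) : Ax (Γ := Γ) <|
      All σ fun x => All τ fun y => snd (pair x y) ≐ y
  | pair_eta {Γ : Ctx} (σ τ : Srt) : Ax (Γ := Γ) <|
      All (prod σ τ) fun p => pair (fst p) (snd p) ≐ p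
  /-- Extensionality of functions. -/
  | fn_ext {Γ : Ctx} (σ τ : Srt) : Ax (Γ := Γ) <|
      All (fn σ τ) fun f => All (fn σ τ) fun g =>
        (All σ fun x => app f x ≐ app g x) ⇾ (f ≐ g)
  /-- Extensionality of sets. -/
  | pow_ext {Γ : Ctx} (σ : Srt) : Ax (Γ := Γ) <|
      All (pow σ) fun A => All (pow σ) fun B =>
        (All σ fun x => (x ∊ A) ⟺ (x ∊ B)) ⇾ (A ≐ B)
  /-- Comprehension: `{x : σ | φ x}` is a set, for every formula `φ`, with parameters. -/
  | comprehension {Γ : Ctx} (σ : Srt) (φ : Fm (σ :: Γ)) : Ax (Γ := Γ) <|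
      Ex (pow σ) fun A => All σ fun x =>
        (x ∊ A) ⟺ φ.ren (Ren.lift (fun _ v => Var.there v) σ)
  /-- Unique choice: a total single-valued relation is the graph of a function. -/
  | unique_choice {Γ : Ctx} (σ τ : Srt) : Ax (Γ := Γ) <|
      All (pow (prod σ τ)) fun S =>
        (All σ fun x => Ex τ fun y => pair x y ∊ S) ⩓
        (All σ fun x => All τ fun y => All τ fun z =>
          (pair x y ∊ S) ⩓ (pair x z ∊ S) ⇾ (y ≐ z)) ⇾
        Ex (fn σ τ) fun f => All σ fun x => pair x (app f x) ∊ S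
  /-- Countable choice. -/
  | countable_choice {Γ : Ctx} (σ : Srt) : Ax (Γ := Γ) <|
      All (pow (prod nat σ)) fun S =>
        (All nat fun n => Ex σ fun b => pair n b ∊ S) ⇾
        Ex (fn nat σ) fun f => All nat fun n => pair n (app f n) ∊ S
  /-- Dependent choice. -/
  | dependent_choice {Γ : Ctx} (σ : Srt) : Ax (Γ := Γ) <|
      All (pow σ) fun A => All (pow (prod σ σ)) fun S => All σ fun a =>
        (a ∊ A) ⩓ (All σ fun x => (x ∊ A) ⇾ Ex σ fun y => (y ∊ A) ⩓ (pair x y ∊ S)) ⇾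
        Ex (fn nat σ) fun f =>
          (app f zero ≐ a) ⩓
          All nat fun n => (app f n ∊ A) ⩓ (pair (app f n) (app f (succ n)) ∊ S)

/-! ### Derivability -/

/-- `Prf H φ`: the formula `φ` is derivable from the hypotheses `H` and the axioms above in
intuitionistic natural deduction with equality. -/
inductive Prf : ∀ {Γ : Ctx}, Set (Fm Γ) → Fm Γ → Prop
  | hyp {Γ : Ctx} {H : Set (Fm Γ)} {φ : Fm Γ} : φ ∈ H → Prf H φ
  | ax {Γ : Ctx} {H : Set (Fm Γ)} {φ : Fm Γ} : Ax φ → Prf H φ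
  | botE {Γ : Ctx} {H : Set (Fm Γ)} {φ : Fm Γ} : Prf H Fm.bot → Prf H φ
  | andI {Γ : Ctx} {H : Set (Fm Γ)} {φ ψ : Fm Γ} : Prf H φ → Prf H ψ → Prf H (φ ⩓ ψ)
  | andE₁ {Γ : Ctx} {H : Set (Fm Γ)} {φ ψ : Fm Γ} : Prf H (φ ⩓ ψ) → Prf H φ
  | andE₂ {Γ : Ctx} {H : Set (Fm Γ)} {φ ψ : Fm Γ} : Prf H (φ ⩓ ψ) → Prf H ψ
  | orI₁ {Γ : Ctx} {H : Set (Fm Γ)} {φ ψ : Fm Γ} : Prf H φ → Prf H (φ ⩔ ψ)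
  | orI₂ {Γ : Ctx} {H : Set (Fm Γ)} {φ ψ : Fm Γ} : Prf H ψ → Prf H (φ ⩔ ψ)
  | orE {Γ : Ctx} {H : Set (Fm Γ)} {φ ψ χ : Fm Γ} :
      Prf H (φ ⩔ ψ) → Prf (insert φ H) χ → Prf (insert ψ H) χ → Prf H χ
  | impI {Γ : Ctx} {H : Set (Fm Γ)} {φ ψ : Fm Γ} : Prf (insert φ H) ψ → Prf H (φ ⇾ ψ)
  | impE {Γ : Ctx} {H : Set (Fm Γ)} {φ ψ : Fm Γ} : Prf H (φ ⇾ ψ) → Prf H φ → Prf H ψ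
  | allI {Γ : Ctx} {H : Set (Fm Γ)} {σ : Srt} {φ : Fm (σ :: Γ)} :
      Prf (Fm.wk σ '' H) φ → Prf H (Fm.all σ φ)
  | allE {Γ : Ctx} {H : Set (Fm Γ)} {σ : Srt} {φ : Fm (σ :: Γ)} (t : Tm Γ σ) :
      Prf H (Fm.all σ φ) → Prf H (φ.inst t)
  | exI {Γ : Ctx} {H : Set (Fm Γ)} {σ : Srt} {φ : Fm (σ :: Γ)} (t : Tm Γ σ) :
      Prf H (φ.inst t) → Prf H (Fm.ex σ φ)
  | exE {Γ : Ctx} {H : Set (Fm Γ)} {σ : Srt} {φ : Fm (σ :: Γ)} {χ : Fm Γ} :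
      Prf H (Fm.ex σ φ) → Prf (insert φ (Fm.wk σ '' H)) (χ.wk σ) → Prf H χ
  | eqI {Γ : Ctx} {H : Set (Fm Γ)} {σ : Srt} (t : Tm Γ σ) : Prf H (t ≐ t)
  | eqE {Γ : Ctx} {H : Set (Fm Γ)} {σ : Srt} {s t : Tm Γ σ} (φ : Fm (σ :: Γ)) :
      Prf H (s ≐ t) → Prf H (φ.inst s) → Prf H (φ.inst t)

/-- Derivability of a sentence from the axioms alone. -/
def Provable (φ : Sentence) : Prop := Prf ∅ φ

/-! ### Natural numbers, and the principle BD-N -/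

section Mathematics

variable {Γ : Ctx}

/-- `s ≤ t` for natural numbers. -/
def leN (s t : Tm Γ nat) : Fm Γ := Ex nat fun z => add ↟s z ≐ ↟t

/-- `s < t` for natural numbers. -/
def ltN (s t : Tm Γ nat) : Fm Γ := leN (succ s) t

/-- `A` is inhabited. -/
def Inhab {σ : Srt} (A : Tm Γ (pow σ)) : Fm Γ := Ex σ fun x => x ∊ ↟A

/-- `A` is countable: it is the image `{a n | n ∈ D}` of a detachable set `D = {n | e n = 0}` of
natural numbers. -/
def Countbl {σ : Srt} (A : Tm Γ (pow σ)) : Fm Γ :=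
  Ex (fn nat nat) fun e => Ex (fn nat σ) fun a =>
    All σ fun x => (x ∊ ↟A) ⟺ Ex nat fun n => (app e n ≐ zero) ⩓ (app a n ≐ x)

/-- `A ⊆ ℕ` is pseudobounded: `s n / n → 0` for each sequence `s` in `A`, that is, for each `k`
eventually `s n / n < 1 / (k + 1)`. -/
def Pseudobounded (A : Tm Γ (pow nat)) : Fm Γ :=
  All (fn nat nat) fun s => (All nat fun n => app s n ∊ ↟A) ⇾
    All nat fun k => Ex nat fun N => All nat fun n =>
      leN N n ⇾ ltN (mul (succ k) (app s n)) n

/-- `A ⊆ ℕ` is bounded. -/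
def Bounded (A : Tm Γ (pow nat)) : Fm Γ :=
  Ex nat fun N => All nat fun m => (m ∊ ↟A) ⇾ leN m N

/-- **BD-N**: every inhabited, countable, pseudobounded set of natural numbers is bounded. -/
def BDN : Sentence :=
  All (pow nat) fun A => Inhab A ⩓ Countbl A ⩓ Pseudobounded A ⇾ Bounded A

/-! ### Baire space -/

/-- The sort of the points of Baire space `ℕ → ℕ`. -/
abbrev baire : Srt := fn nat nat

/-- `α` and `β` agree on their first `k` terms. -/
def Agree (k : Tm Γ nat) (α β : Tm Γ baire) : Fm Γ :=
  All nat fun i => ltN i ↟k ⇾ (app ↟α i ≐ app ↟β i)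

/-- The sequence `a` converges to `α` in Baire space. -/
def BaireConv (a : Tm Γ (fn nat baire)) (α : Tm Γ baire) : Fm Γ :=
  All nat fun k => Ex nat fun N => All nat fun n => leN N n ⇾ Agree k (app ↟a n) ↟α

/-- `f : (ℕ → ℕ) → ℕ` is sequentially continuous. -/
def BaireSeqCont (f : Tm Γ (fn baire nat)) : Fm Γ :=
  All (fn nat baire) fun a => All baire fun α => BaireConv a α ⇾
    Ex nat fun N => All nat fun n => leN N n ⇾ (app ↟f (app a n) ≐ app ↟f α)

/-- `f : (ℕ → ℕ) → ℕ` is pointwise continuous. -/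
def BaireCont (f : Tm Γ (fn baire nat)) : Fm Γ :=
  All baire fun α => Ex nat fun k => All baire fun β =>
    Agree k α β ⇾ (app ↟f β ≐ app ↟f α)

/-- `f : (ℕ → ℕ) → ℕ` is locally bounded. -/
def BaireLocBdd (f : Tm Γ (fn baire nat)) : Fm Γ :=
  All baire fun α => Ex nat fun k => Ex nat fun K => All baire fun β =>
    Agree k α β ⇾ leN (app ↟f β) K

/-- Every sequentially continuous map from Baire space to `ℕ` is pointwise continuous. -/
def SeqContBaire : Sentence :=
  All (fn baire nat) fun f => BaireSeqCont f ⇾ BaireCont f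

/-- Every sequentially continuous map from Baire space to `ℕ` is locally bounded. -/
def SeqContLocBdd : Sentence :=
  All (fn baire nat) fun f => BaireSeqCont f ⇾ BaireLocBdd f

/-! ### Rational and real numbers -/

/-- Rational numbers: `((a, b), c)` stands for the fraction `(a - b) / (c + 1)`. -/
abbrev rat : Srt := prod (prod nat nat) nat

/-- `p < q` for rationals: `(a - b) / (c + 1) < (a' - b') / (c' + 1)` means
`a (c' + 1) + b' (c + 1) < a' (c + 1) + b (c' + 1)`. -/
def ltQ (p q : Tm Γ rat) : Fm Γ :=
  ltN
    (add (mul (fst (fst p)) (succ (snd q))) (mul (snd (fst q)) (succ (snd p))))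
    (add (mul (fst (fst q)) (succ (snd p))) (mul (snd (fst p)) (succ (snd q))))

/-- The rational `0`. -/
def zeroQ : Tm Γ rat := pair (pair zero zero) zero

/-- The sum of two rationals; `(c + 1) (c' + 1) = (c c' + c + c') + 1`. -/
def addQ (p q : Tm Γ rat) : Tm Γ rat :=
  pair
    (pair
      (add (mul (fst (fst p)) (succ (snd q))) (mul (fst (fst q)) (succ (snd p))))
      (add (mul (snd (fst p)) (succ (snd q))) (mul (snd (fst q)) (succ (snd p)))))
    (add (mul (snd p) (snd q)) (add (snd p) (snd q)))

/-- The sort of two-sided cuts `(L, U)` of rationals; real numbers are the cuts with `IsReal`. -/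
abbrev cut : Srt := prod (pow rat) (pow rat)

/-- `q < r` for a rational `q` and a real `r`. -/
def below (q : Tm Γ rat) (r : Tm Γ cut) : Fm Γ := q ∊ fst r

/-- `r < q` for a rational `q` and a real `r`. -/
def above (r : Tm Γ cut) (q : Tm Γ rat) : Fm Γ := q ∊ snd r

/-- `r` is a Dedekind real: both sides are inhabited and rounded, and the cut is disjoint and
located. -/
def IsReal (r : Tm Γ cut) : Fm Γ :=
  (Ex rat fun q => below q ↟r) ⩓
  (Ex rat fun q => above ↟r q) ⩓
  (All rat fun p => below p ↟r ⟺ Ex rat fun q => ltQ p q ⩓ below q ↟r) ⩓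
  (All rat fun q => above ↟r q ⟺ Ex rat fun p => ltQ p q ⩓ above ↟r p) ⩓
  (All rat fun q => Fm.neg (below q ↟r ⩓ above ↟r q)) ⩓
  (All rat fun p => All rat fun q => ltQ p q ⇾ below p ↟r ⩔ above ↟r q)

/-- `0 ≤ r`. -/
def NonnegR (r : Tm Γ cut) : Fm Γ := All rat fun q => ltQ q zeroQ ⇾ below q ↟r

/-- `r = 0`. -/
def IsZeroR (r : Tm Γ cut) : Fm Γ :=
  All rat fun q => (below q ↟r ⟺ ltQ q zeroQ) ⩓ (above ↟r q ⟺ ltQ zeroQ q)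

/-- `t ≤ r + s`: every sum of rational upper bounds of `r` and of `s` lies above `t`. -/
def LeAddR (t r s : Tm Γ cut) : Fm Γ :=
  All rat fun p => All rat fun q => above ↟r p ⩓ above ↟s q ⇾ above ↟t (addQ p q)

/-! ### Metric spaces -/

/-- The sort of the metrics on sets of objects of sort `σ`. -/
abbrev metric (σ : Srt) : Srt := fn σ (fn σ cut)

/-- The distance `d x y`. -/
def dist {σ : Srt} (d : Tm Γ (metric σ)) (x y : Tm Γ σ) : Tm Γ cut := app (app d x) y

/-- `(X, d)` is a metric space. Outside of `X` nothing is asked of `d`. -/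
def IsMetric {σ : Srt} (X : Tm Γ (pow σ)) (d : Tm Γ (metric σ)) : Fm Γ :=
  (All σ fun x => All σ fun y => (x ∊ ↟X) ⩓ (y ∊ ↟X) ⇾
    IsReal (dist ↟d x y) ⩓ NonnegR (dist ↟d x y) ⩓
    (IsZeroR (dist ↟d x y) ⟺ (x ≐ y)) ⩓
    (dist ↟d x y ≐ dist ↟d y x)) ⩓
  (All σ fun x => All σ fun y => All σ fun z => (x ∊ ↟X) ⩓ (y ∊ ↟X) ⩓ (z ∊ ↟X) ⇾
    LeAddR (dist ↟d x z) (dist ↟d x y) (dist ↟d y z))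

/-- `(X, d)` is separable: it has a countable dense subset. -/
def Separable {σ : Srt} (X : Tm Γ (pow σ)) (d : Tm Γ (metric σ)) : Fm Γ :=
  Ex (pow σ) fun D => Countbl D ⩓
    (All σ fun x => (x ∊ D) ⇾ (x ∊ ↟X)) ⩓
    (All σ fun x => (x ∊ ↟X) ⇾ All rat fun ε => ltQ zeroQ ε ⇾
      Ex σ fun y => (y ∊ D) ⩓ above (dist ↟d x y) ε)

/-- The sequence `s` converges to `x` with respect to `d`. -/
def Conv {σ : Srt} (d : Tm Γ (metric σ)) (s : Tm Γ (fn nat σ)) (x : Tm Γ σ) : Fm Γ :=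
  All rat fun ε => ltQ zeroQ ε ⇾
    Ex nat fun N => All nat fun n => leN N n ⇾ above (dist ↟d (app ↟s n) ↟x) ε

/-- `F` is (the graph of) a function from `X` to `Y`. -/
def IsMap {σ τ : Srt} (X : Tm Γ (pow σ)) (Y : Tm Γ (pow τ)) (F : Tm Γ (pow (prod σ τ))) : Fm Γ :=
  (All σ fun x => All τ fun y => (pair x y ∊ ↟F) ⇾ (x ∊ ↟X) ⩓ (y ∊ ↟Y)) ⩓
  (All σ fun x => (x ∊ ↟X) ⇾ Ex τ fun y => pair x y ∊ ↟F) ⩓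
  (All σ fun x => All τ fun y => All τ fun z => 
    (pair x y ∊ ↟F) ⩓ (pair x z ∊ ↟F) ⇾ (y ≐ z))

/-- The map with graph `F` is sequentially continuous. Here `t n` is the image of `s n`, and `y`
is the image of `x`. -/
def SeqCont {σ τ : Srt} (d : Tm Γ (metric σ)) (ρ : Tm Γ (metric τ))
    (F : Tm Γ (pow (prod σ τ))) : Fm Γ :=
  All (fn nat σ) fun s => All σ fun x => All (fn nat τ) fun t => All τ fun y =>
    (All nat fun n => pair (app s n) (app t n) ∊ ↟F) ⩓ (pair x y ∊ ↟F) ⩓ Conv ↟d s x ⇾ Conv ↟ρ t y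

/-- The map with graph `F` is pointwise continuous. -/
def PtCont {σ τ : Srt} (d : Tm Γ (metric σ)) (ρ : Tm Γ (metric τ))
    (F : Tm Γ (pow (prod σ τ))) : Fm Γ :=
  All σ fun x => All τ fun y => (pair x y ∊ ↟F) ⇾ All rat fun ε => ltQ zeroQ ε ⇾
    Ex rat fun δ => ltQ zeroQ δ ⩓ All σ fun x' => All τ fun y' =>
      (pair x' y' ∊ ↟F) ⩓ above (dist ↟d x x') δ ⇾ above (dist ↟ρ y y') ε

/-- Every sequentially continuous map from a separable metric space to a metric space is pointwise
continuous; here the points of the two spaces are objects of the sorts `σ` and `τ`. -/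
def SeqContMetric (σ τ : Srt) : Sentence :=
  All (pow σ) fun X => All (metric σ) fun d => All (pow τ) fun Y => All (metric τ) fun ρ =>
    All (pow (prod σ τ)) fun F =>
      IsMetric X d ⩓ Separable X d ⩓ IsMetric Y ρ ⩓ IsMap X Y F ⩓ SeqCont d ρ F ⇾ PtCont d ρ F

end Mathematics

end BISH

/-! ### Natural deduction for closed formulas with parameters -/

namespace BISH

open Srt Tm

/-! ### Substitution lemmas -/

/-! The mathematical argument is a cycle of implications.

From BD-N to continuity. Let `f` be sequentially continuous on a separable space, `x` a point and `ε
> 0`. Consider the numbers `k` for which some point of the dense sequence lies within `1/(k+1)` of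
`x` although its image is well away from `f x`. Reals are located, so a slightly blurred version of
this set can be enumerated. A sequence in it with `s n ≥ n/(K+1)` at certain places `n` gives points
that converge to `x` (take `x` itself at the other places), and sequential continuity confines those
places to an initial segment. So the set is pseudobounded, and by BD-N it is bounded. The bound
yields a `δ` that is good for the dense points (`exists_modulus`). An arbitrary `x'` is approximated
by dense points, and sequential continuity at `x'` transfers the estimate (`ptCont_of_bdn`).

From metric spaces to Baire space. The distance `1/(m+1)`, where `m` is the length of the longest
common initial segment, makes Baire space a separable metric space, and `ℕ` becomes discrete through
the constant sequences (`seqContBaire_of_metric`). Pointwise continuity clearly gives local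
boundedness.

From local boundedness to BD-N. Let `b` enumerate a pseudobounded set `A`, and let `f α` be the
least `N` such that `b (α n) < n` for all `n ≥ N`. This exists by pseudoboundedness. If `f β > f α`
although `α` and `β` agree on `m` terms, then `A` has an element `≥ m`; hence pseudoboundedness also
makes `f` sequentially continuous (`baireSeqCont_of_leastSmall`). If `f ≤ K` on the sequences that
begin with a given segment of length `k`, then continuing that segment with a constant `m` shows `b
m < k + K`, so `A` is bounded (`bounded_of_locBdd`).

These arguments have to become derivations in a formal theory. A world is a finite list of
hypotheses with parameters, and a truth value is a suitably closed set of worlds. Forcing a formula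
then coincides with deriving it (`Fm.forces_ev`), so an intuitionistic argument can be written as a
Lean proof about forcing, with Lean variables in place of object variables. Elementary arithmetic is
settled classically: what holds at all prime ideals of truth values that avoid those forced in `p`
is forced in `p` (`forces_of_prime`), and at a prime ideal the numbers embed into an ordered field,
where `linarith` applies (`exists_model`). This remains sound for derivability because only
conjunctions, disjunctions and atomic statements of arithmetic are evaluated there. -/

theorem Tm.sub_ren {Γ Δ Θ : Ctx} (r : Ren Γ Δ) (s : Sub Δ Θ) {σ : Srt} (t : Tm Γ σ) :
    (t.ren r).sub s = t.sub fun τ v => s τ (r τ v) := by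
  induction t <;> simp_all [Tm.ren, Tm.sub]

theorem Tm.ren_sub {Γ Δ Θ : Ctx} (s : Sub Γ Δ) (r : Ren Δ Θ) {σ : Srt} (t : Tm Γ σ) :
    (t.sub s).ren r = t.sub fun τ v => (s τ v).ren r := by
  induction t <;> simp_all [Tm.ren, Tm.sub]

theorem Tm.sub_sub {Γ Δ Θ : Ctx} (s : Sub Γ Δ) (u : Sub Δ Θ) {σ : Srt} (t : Tm Γ σ) :
    (t.sub s).sub u = t.sub fun τ v => (s τ v).sub u := by
  induction t <;> simp_all [Tm.sub]

theorem Tm.sub_var {Γ : Ctx} {σ : Srt} (t : Tm Γ σ) : (t.sub fun _ v => Tm.var v) = t := by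
  induction t <;> simp_all [Tm.sub]

theorem Tm.ren_eq_sub {Γ Δ : Ctx} (r : Ren Γ Δ) {σ : Srt} (t : Tm Γ σ) :
    t.ren r = t.sub fun τ v => Tm.var (r τ v) := by
  induction t <;> simp_all [Tm.ren, Tm.sub]

theorem Sub.lift_ren {Γ Δ Θ : Ctx} (r : Ren Γ Δ) (s : Sub Δ Θ) (τ : Srt) :
    (fun σ v => s.lift τ σ (r.lift τ σ v)) = Sub.lift (fun σ v => s σ (r σ v)) τ := by
  funext σ v
  cases v <;> rfl

theorem Sub.ren_lift {Γ Δ Θ : Ctx} (s : Sub Γ Δ) (r : Ren Δ Θ) (τ : Srt) :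
    (fun σ v => (s.lift τ σ v).ren (r.lift τ)) = Sub.lift (fun σ v => (s σ v).ren r) τ := by
  funext σ v
  cases v
  · rfl
  · simp [Sub.lift, Tm.wk, Tm.ren_eq_sub, Tm.sub_sub, Tm.sub, Ren.lift]

theorem Sub.lift_sub {Γ Δ Θ : Ctx} (s : Sub Γ Δ) (u : Sub Δ Θ) (τ : Srt) :
    (fun σ v => (s.lift τ σ v).sub (u.lift τ)) = Sub.lift (fun σ v => (s σ v).sub u) τ := by
  funext σ v
  cases v
  · rfl
  · simp [Sub.lift, Tm.wk, Tm.sub_ren, Tm.ren_sub]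

theorem Sub.lift_var (Γ : Ctx) (τ : Srt) :
    Sub.lift (fun σ (v : Var Γ σ) => Tm.var v) τ = fun _ v => Tm.var v := by
  funext σ v
  cases v <;> rfl

theorem Fm.sub_ren {Γ : Ctx} (φ : Fm Γ) : ∀ {Δ Θ : Ctx} (r : Ren Γ Δ) (s : Sub Δ Θ),
    (φ.ren r).sub s = φ.sub fun τ v => s τ (r τ v) := by
  induction φ <;> intros <;> simp only [Fm.ren, Fm.sub, Tm.sub_ren, Sub.lift_ren, *]

theorem Fm.ren_sub {Γ : Ctx} (φ : Fm Γ) : ∀ {Δ Θ : Ctx} (s : Sub Γ Δ) (r : Ren Δ Θ),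
    (φ.sub s).ren r = φ.sub fun τ v => (s τ v).ren r := by
  induction φ <;> intros <;> simp only [Fm.ren, Fm.sub, Tm.ren_sub, Sub.ren_lift, *]

theorem Fm.sub_sub {Γ : Ctx} (φ : Fm Γ) : ∀ {Δ Θ : Ctx} (s : Sub Γ Δ) (u : Sub Δ Θ),
    (φ.sub s).sub u = φ.sub fun τ v => (s τ v).sub u := by
  induction φ <;> intros <;> simp only [Fm.sub, Tm.sub_sub, Sub.lift_sub, *]

theorem Fm.sub_var {Γ : Ctx} (φ : Fm Γ) : (φ.sub fun _ v => Tm.var v) = φ := by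
  induction φ <;> simp only [Fm.sub, Tm.sub_var, Sub.lift_var, *]

/-- A substitution, extended by the value `t` of the most recently bound variable. -/
def Sub.cons {Γ Δ : Ctx} {τ : Srt} (t : Tm Δ τ) (s : Sub Γ Δ) : Sub (τ :: Γ) Δ
  | _, Var.here => t
  | _, Var.there v => s _ v

theorem Fm.inst_sub_lift {Γ Δ : Ctx} {τ : Srt} (φ : Fm (τ :: Γ)) (s : Sub Γ Δ) (t : Tm Δ τ) :
    (φ.sub (s.lift τ)).inst t = φ.sub (Sub.cons t s) := by
  rw [Fm.inst, Fm.sub_sub]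
  congr 1
  funext σ v
  cases v
  · rfl
  · simp [Sub.lift, Tm.wk, Tm.sub_ren, Sub.single, Sub.cons, Tm.sub_var]

theorem Fm.sub_wk {Γ Δ : Ctx} (φ : Fm Γ) (s : Sub Γ Δ) (τ : Srt) :
    (φ.sub s).wk τ = φ.sub fun σ v => (s σ v).wk τ :=
  Fm.ren_sub φ s _

/-! ### Closed terms with parameters -/

/-- Closed terms over an infinite supply of parameters of each sort. -/
inductive PTm : Srt → Type
  | par (σ : Srt) : ℕ → PTm σ
  | zero : PTm nat
  | succ : PTm nat → PTm nat
  | add : PTm nat → PTm nat → PTm nat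
  | mul : PTm nat → PTm nat → PTm nat
  | app {σ τ : Srt} : PTm (fn σ τ) → PTm σ → PTm τ
  | pair {σ τ : Srt} : PTm σ → PTm τ → PTm (prod σ τ)
  | fst {σ τ : Srt} : PTm (prod σ τ) → PTm σ
  | snd {σ τ : Srt} : PTm (prod σ τ) → PTm τ

/-- Values for the variables of a context. -/
abbrev Env (Γ : Ctx) : Type := ∀ σ : Srt, Var Γ σ → PTm σ

/-- The empty environment. -/
def Env.nil : Env [] := fun _ v => nomatch v

/-- The environment with one more value. -/
def Env.cons {Γ : Ctx} {τ : Srt} (t : PTm τ) (ρ : Env Γ) : Env (τ :: Γ)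
  | _, Var.here => t
  | _, Var.there v => ρ _ v

infixr:67 " ;; " => Env.cons

/-- The value of a term in an environment. -/
def Tm.ev {Γ : Ctx} (ρ : Env Γ) : ∀ {σ : Srt}, Tm Γ σ → PTm σ
  | _, Tm.var v => ρ _ v
  | _, Tm.zero => PTm.zero
  | _, Tm.succ t => PTm.succ (t.ev ρ)
  | _, Tm.add s t => PTm.add (s.ev ρ) (t.ev ρ)
  | _, Tm.mul s t => PTm.mul (s.ev ρ) (t.ev ρ)
  | _, Tm.app s t => PTm.app (s.ev ρ) (t.ev ρ)
  | _, Tm.pair s t => PTm.pair (s.ev ρ) (t.ev ρ)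
  | _, Tm.fst t => PTm.fst (t.ev ρ)
  | _, Tm.snd t => PTm.snd (t.ev ρ)

/-- A partial assignment of terms to parameters. -/
abbrev PEnv (Δ : Ctx) : Type := ∀ σ : Srt, ℕ → Option (Tm Δ σ)

/-- The term that realizes a closed term with parameters. -/
def PTm.real {Δ : Ctx} (e : PEnv Δ) : ∀ {σ : Srt}, PTm σ → Option (Tm Δ σ)
  | _, PTm.par σ n => e σ n
  | _, PTm.zero => some Tm.zero
  | _, PTm.succ t => (t.real e).map Tm.succ
  | _, PTm.add s t => Option.map₂ Tm.add (s.real e) (t.real e)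
  | _, PTm.mul s t => Option.map₂ Tm.mul (s.real e) (t.real e)
  | _, PTm.app s t => Option.map₂ Tm.app (s.real e) (t.real e)
  | _, PTm.pair s t => Option.map₂ Tm.pair (s.real e) (t.real e)
  | _, PTm.fst t => (t.real e).map Tm.fst
  | _, PTm.snd t => (t.real e).map Tm.snd

/-- `e` gives a value to every parameter whose sort is in `S`. -/
def PEnv.Total {Δ : Ctx} (e : PEnv Δ) (S : List Srt) : Prop :=
  ∀ σ ∈ S, ∀ n, (e σ n).isSome

theorem PEnv.Total.mono {Δ : Ctx} {e : PEnv Δ} {S S' : List Srt} (h : e.Total S') (hS : S ⊆ S') :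
    e.Total S :=
  fun σ hσ => h σ (hS hσ)

open Classical in
/-- The assignment in one more variable, which becomes the value of the parameter `m` of sort
`τ`. -/
noncomputable def PEnv.push {Δ : Ctx} (e : PEnv Δ) (τ : Srt) (m : ℕ) : PEnv (τ :: Δ) :=
  fun σ n => if h : n = m ∧ τ = σ then some (h.2 ▸ Tm.var Var.here) else (e σ n).map (Tm.wk τ)

theorem PEnv.push_self {Δ : Ctx} (e : PEnv Δ) (τ : Srt) (m : ℕ) :
    e.push τ m τ m = some (Tm.var Var.here) := by
  simp [PEnv.push]

theorem PEnv.Total.push {Δ : Ctx} {e : PEnv Δ} {S : List Srt} (h : e.Total S) (τ : Srt) (m : ℕ) :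
    (e.push τ m).Total S := by
  intro σ hσ n
  unfold PEnv.push
  split_ifs
  · rfl
  · simpa using h σ hσ n

/-- `ρ` is realized by the substitution `s`. -/
def Env.Real {Γ Δ : Ctx} (ρ : Env Γ) (e : PEnv Δ) (s : Sub Γ Δ) : Prop :=
  ∀ σ v, (ρ σ v).real e = some (s σ v)

theorem Tm.real_ev {Γ Δ : Ctx} {ρ : Env Γ} {e : PEnv Δ} {s : Sub Γ Δ} (h : ρ.Real e s) {σ : Srt}
    (t : Tm Γ σ) : (t.ev ρ).real e = some (t.sub s) := by
  induction t with
  | var v => exact h _ v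
  | _ => simp_all [Tm.ev, Tm.sub, PTm.real]

theorem Env.Real.cons {Γ Δ : Ctx} {ρ : Env Γ} {e : PEnv Δ} {s : Sub Γ Δ} (h : ρ.Real e s)
    {τ : Srt} {t : PTm τ} {t' : Tm Δ τ} (ht : t.real e = some t') :
    (t ;; ρ).Real e (Sub.cons t' s) := by
  intro σ v
  cases v
  · exact ht
  · exact h _ _

theorem Env.Real.tail {Γ Δ : Ctx} {ρ : Env Γ} {e : PEnv Δ} {τ : Srt} {t : PTm τ}
    {s : Sub (τ :: Γ) Δ} (h : (t ;; ρ).Real e s) : ρ.Real e fun σ v => s σ (Var.there v) :=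
  fun σ v => h σ (Var.there v)

theorem Sub.cons_head_tail {Γ Δ : Ctx} {τ : Srt} (s : Sub (τ :: Γ) Δ) :
    Sub.cons (s τ Var.here) (fun σ v => s σ (Var.there v)) = s := by
  funext σ v
  cases v <;> rfl

/-- A context need not supply a term of every sort; power sorts, for example, have no closed terms.
Assignments are therefore partial, and a term needs values only for the finitely many sorts of its
parameters. -/
theorem PTm.exists_total {σ : Srt} (t : PTm σ) :
    ∃ S : List Srt, ∀ {Δ : Ctx} (e : PEnv Δ), e.Total S → ∃ t', t.real e = some t' := by
  induction t with
  | par σ n => exact ⟨[σ], fun e h => Option.isSome_iff_exists.1 (h σ (by simp) n)⟩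
  | zero => exact ⟨[], fun e _ => ⟨_, rfl⟩⟩
  | succ t ih | fst t ih | snd t ih =>
    obtain ⟨S, hS⟩ := ih
    refine ⟨S, fun e h => ?_⟩
    obtain ⟨t', ht⟩ := hS e h
    exact ⟨_, by rw [PTm.real, ht]; rfl⟩
  | add s t ih₁ ih₂ | mul s t ih₁ ih₂ | app s t ih₁ ih₂ | pair s t ih₁ ih₂ =>
    obtain ⟨S, hS⟩ := ih₁
    obtain ⟨S', hS'⟩ := ih₂
    refine ⟨S ++ S', fun e h => ?_⟩
    obtain ⟨s', hs⟩ := hS e (h.mono (by simp))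
    obtain ⟨t', ht⟩ := hS' e (h.mono (by simp))
    exact ⟨_, by rw [PTm.real, hs, ht]; rfl⟩

theorem Env.exists_total {Γ : Ctx} (ρ : Env Γ) :
    ∃ S : List Srt, ∀ {Δ : Ctx} (e : PEnv Δ), e.Total S → ∃ s, ρ.Real e s := by
  induction Γ with
  | nil => exact ⟨[], fun e _ => ⟨fun _ v => (nomatch v), fun _ v => (nomatch v)⟩⟩
  | cons τ Γ ih =>
    obtain ⟨S, hS⟩ := ih fun σ v => ρ σ (Var.there v)
    obtain ⟨S', hS'⟩ := (ρ τ Var.here).exists_total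
    refine ⟨S ++ S', fun e h => ?_⟩
    obtain ⟨s, hs⟩ := hS e (h.mono (by simp))
    obtain ⟨t, ht⟩ := hS' e (h.mono (by simp))
    refine ⟨Sub.cons t s, fun σ v => ?_⟩
    cases v
    · exact ht
    · exact hs _ _

/-- A term contains finitely many parameters, so any index beyond theirs is free to serve as an
eigenvariable, whatever its sort. -/
theorem PTm.exists_fresh {σ : Srt} (t : PTm σ) :
    ∃ N : ℕ, ∀ {Δ : Ctx} (e : PEnv Δ) (τ : Srt) (m : ℕ), N ≤ m →
      t.real (e.push τ m) = (t.real e).map (Tm.wk τ) := by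
  induction t with
  | par σ n =>
    refine ⟨n + 1, fun e τ m h => ?_⟩
    have : ¬(n = m ∧ τ = σ) := by omega
    simp only [PTm.real, PEnv.push, this, dite_false]
  | zero => exact ⟨0, fun e τ m _ => rfl⟩
  | succ t ih | fst t ih | snd t ih =>
    obtain ⟨N, hN⟩ := ih
    refine ⟨N, fun e τ m h => ?_⟩
    rw [PTm.real, PTm.real, hN e τ m h]
    cases t.real e <;> rfl
  | add s t ih₁ ih₂ | mul s t ih₁ ih₂ | app s t ih₁ ih₂ | pair s t ih₁ ih₂ =>
    obtain ⟨N, hN⟩ := ih₁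
    obtain ⟨N', hN'⟩ := ih₂
    refine ⟨max N N', fun e τ m h => ?_⟩
    rw [PTm.real, PTm.real, hN e τ m (by omega), hN' e τ m (by omega)]
    cases s.real e <;> cases t.real e <;> rfl

theorem Env.exists_fresh {Γ : Ctx} (ρ : Env Γ) :
    ∃ N : ℕ, ∀ {Δ : Ctx} (e : PEnv Δ) (τ : Srt) (m : ℕ), N ≤ m → ∀ s, ρ.Real e s →
      ρ.Real (e.push τ m) fun σ v => (s σ v).wk τ := by
  induction Γ with
  | nil => exact ⟨0, fun _ _ _ _ _ _ _ v => nomatch v⟩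
  | cons τ Γ ih =>
    obtain ⟨N, hN⟩ := ih fun σ v => ρ σ (Var.there v)
    obtain ⟨N', hN'⟩ := (ρ τ Var.here).exists_fresh
    refine ⟨max N N', fun e τ m h s hs σ v => ?_⟩
    cases v
    · rw [hN' e τ m (by omega), hs]
      rfl
    · exact hN e τ m (by omega) (fun σ v => s σ (Var.there v)) (fun σ v => hs σ _) _ _

/-! ### Derivability for formulas with parameters -/

/-- A formula with values for its free variables. -/
structure Clo where
  /-- The context of the formula. -/
  ctx : Ctx
  /-- The formula. -/
  fm : Fm ctx
  /-- The values of the free variables. -/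
  env : Env ctx

/-- The formula `φ` realizes `c`. -/
def Clo.Real {Δ : Ctx} (c : Clo) (e : PEnv Δ) (φ : Fm Δ) : Prop :=
  ∃ s, c.env.Real e s ∧ c.fm.sub s = φ

/-- Finite lists of hypotheses. -/
abbrev World : Type := List Clo

/-- The set `H` contains realizations of all hypotheses in `p`. -/
def World.Real {Δ : Ctx} (p : World) (e : PEnv Δ) (H : Set (Fm Δ)) : Prop :=
  ∀ c ∈ p, ∃ φ ∈ H, c.Real e φ

/-- `c` is derivable from the hypotheses in `p`: every realization of `c` is derivable from
realizations of `p`, provided that the parameters of finitely many sorts all have values. -/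
def Der (p : World) (c : Clo) : Prop :=
  ∃ S : List Srt, ∀ {Δ : Ctx} (e : PEnv Δ), e.Total S → ∀ (H : Set (Fm Δ)) (φ : Fm Δ),
    p.Real e H → c.Real e φ → Prf H φ

theorem Clo.Real.insert_cons {Δ : Ctx} {p : World} {e : PEnv Δ} {H : Set (Fm Δ)} {c : Clo}
    {φ : Fm Δ} (hp : p.Real e H) (hc : c.Real e φ) :
    World.Real (c :: p) e (insert φ H) := by
  intro d hd
  rcases List.mem_cons.1 hd with rfl | hd
  · exact ⟨φ, Or.inl rfl, hc⟩
  · obtain ⟨ψ, hψ, h⟩ := hp d hd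
    exact ⟨ψ, Or.inr hψ, h⟩

theorem World.exists_fresh (p : World) :
    ∃ N : ℕ, ∀ {Δ : Ctx} (e : PEnv Δ) (τ : Srt) (m : ℕ), N ≤ m → ∀ H, p.Real e H →
      p.Real (e.push τ m) (Fm.wk τ '' H) := by
  induction p with
  | nil => exact ⟨0, fun _ _ _ _ _ _ c hc => by simp at hc⟩
  | cons c p ih =>
    obtain ⟨N, hN⟩ := ih
    obtain ⟨N', hN'⟩ := c.env.exists_fresh
    refine ⟨max N N', fun e τ m h H hH d hd => ?_⟩
    rcases List.mem_cons.1 hd with rfl | hd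
    · obtain ⟨φ, hφ, s, hs, rfl⟩ := hH d (by simp)
      exact ⟨_, ⟨_, hφ, rfl⟩, _, hN' e τ m (by omega) s hs, (Fm.sub_wk _ _ _).symm⟩
    · exact hN e τ m (by omega) H (fun d hd => hH d (List.mem_cons_of_mem _ hd)) d hd

theorem Der.mono {p q : World} {c : Clo} (hpq : p ⊆ q) (h : Der p c) : Der q c := by
  obtain ⟨S, hS⟩ := h
  exact ⟨S, fun e he H φ hq hc => hS e he H φ (fun d hd => hq d (hpq hd)) hc⟩

section Rules

variable {p : World} {c : Clo} {Γ : Ctx} {ρ : Env Γ}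

/-- An assignment determines at most one realization of a closure, so the formula found in `H` is
the very one to be derived. -/
theorem Der.hyp (h : c ∈ p) : Der p c := by
  refine ⟨[], fun e _ H φ hp hc => ?_⟩
  obtain ⟨ψ, hψ, s, hs, rfl⟩ := hp c h
  obtain ⟨s', hs', rfl⟩ := hc
  have : s = s' := by
    funext σ v
    exact Option.some.inj ((hs σ v).symm.trans (hs' σ v))
  exact Prf.hyp (this ▸ hψ)

theorem Der.of_ax {φ : Fm Γ} (h : ∀ {Δ : Ctx} (s : Sub Γ Δ), Ax (φ.sub s)) : Der p ⟨Γ, φ, ρ⟩ := by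
  refine ⟨[], fun e _ H ψ _ hc => ?_⟩
  obtain ⟨s, -, rfl⟩ := hc
  exact Prf.ax (h s)

theorem Der.botE (h : Der p ⟨Γ, Fm.bot, ρ⟩) : Der p c := by
  obtain ⟨S, hS⟩ := h
  obtain ⟨S', hS'⟩ := ρ.exists_total
  refine ⟨S ++ S', fun e he H φ hp hc => ?_⟩
  obtain ⟨s, hs⟩ := hS' e (he.mono (by simp))
  exact Prf.botE (hS e (he.mono (by simp)) H _ hp ⟨s, hs, rfl⟩)

theorem Der.and_iff {φ ψ : Fm Γ} :
    Der p ⟨Γ, φ ⩓ ψ, ρ⟩ ↔ Der p ⟨Γ, φ, ρ⟩ ∧ Der p ⟨Γ, ψ, ρ⟩ := by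
  constructor
  · rintro ⟨S, hS⟩
    constructor
    · refine ⟨S, fun e he H χ hp hc => ?_⟩
      obtain ⟨s, hs, rfl⟩ := hc
      exact Prf.andE₁ (hS e he H _ hp ⟨s, hs, rfl⟩)
    · refine ⟨S, fun e he H χ hp hc => ?_⟩
      obtain ⟨s, hs, rfl⟩ := hc
      exact Prf.andE₂ (hS e he H _ hp ⟨s, hs, rfl⟩)
  · rintro ⟨⟨S, hS⟩, ⟨S', hS'⟩⟩
    refine ⟨S ++ S', fun e he H χ hp hc => ?_⟩
    obtain ⟨s, hs, rfl⟩ := hc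
    exact Prf.andI (hS e (he.mono (by simp)) H _ hp ⟨s, hs, rfl⟩)
      (hS' e (he.mono (by simp)) H _ hp ⟨s, hs, rfl⟩)

theorem Der.orI₁ {φ ψ : Fm Γ} (h : Der p ⟨Γ, φ, ρ⟩) : Der p ⟨Γ, φ ⩔ ψ, ρ⟩ := by
  obtain ⟨S, hS⟩ := h
  refine ⟨S, fun e he H χ hp hc => ?_⟩
  obtain ⟨s, hs, rfl⟩ := hc
  exact Prf.orI₁ (hS e he H _ hp ⟨s, hs, rfl⟩)

theorem Der.orI₂ {φ ψ : Fm Γ} (h : Der p ⟨Γ, ψ, ρ⟩) : Der p ⟨Γ, φ ⩔ ψ, ρ⟩ := by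
  obtain ⟨S, hS⟩ := h
  refine ⟨S, fun e he H χ hp hc => ?_⟩
  obtain ⟨s, hs, rfl⟩ := hc
  exact Prf.orI₂ (hS e he H _ hp ⟨s, hs, rfl⟩)

theorem Der.orE {φ ψ : Fm Γ} (h : Der p ⟨Γ, φ ⩔ ψ, ρ⟩) (h₁ : Der (⟨Γ, φ, ρ⟩ :: p) c)
    (h₂ : Der (⟨Γ, ψ, ρ⟩ :: p) c) : Der p c := by
  obtain ⟨S, hS⟩ := h
  obtain ⟨S₁, hS₁⟩ := h₁
  obtain ⟨S₂, hS₂⟩ := h₂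
  obtain ⟨S', hS'⟩ := ρ.exists_total
  refine ⟨S ++ S₁ ++ S₂ ++ S', fun e he H χ hp hc => ?_⟩
  obtain ⟨s, hs⟩ := hS' e (he.mono (by grind))
  refine Prf.orE (hS e (he.mono (by grind)) H _ hp ⟨s, hs, rfl⟩)
    (hS₁ e (he.mono (by grind)) _ _ (Clo.Real.insert_cons hp ⟨s, hs, rfl⟩) hc)
    (hS₂ e (he.mono (by grind)) _ _ (Clo.Real.insert_cons hp ⟨s, hs, rfl⟩) hc)

theorem Der.impI {φ ψ : Fm Γ} (h : Der (⟨Γ, φ, ρ⟩ :: p) ⟨Γ, ψ, ρ⟩) : Der p ⟨Γ, φ ⇾ ψ, ρ⟩ := by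
  obtain ⟨S, hS⟩ := h
  refine ⟨S, fun e he H χ hp hc => ?_⟩
  obtain ⟨s, hs, rfl⟩ := hc
  exact Prf.impI (hS e he _ _ (Clo.Real.insert_cons hp ⟨s, hs, rfl⟩) ⟨s, hs, rfl⟩)

theorem Der.impE {φ ψ : Fm Γ} (h : Der p ⟨Γ, φ ⇾ ψ, ρ⟩) (h' : Der p ⟨Γ, φ, ρ⟩) :
    Der p ⟨Γ, ψ, ρ⟩ := by
  obtain ⟨S, hS⟩ := h
  obtain ⟨S', hS'⟩ := h'
  refine ⟨S ++ S', fun e he H χ hp hc => ?_⟩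
  obtain ⟨s, hs, rfl⟩ := hc
  exact Prf.impE (hS e (he.mono (by simp)) H _ hp ⟨s, hs, rfl⟩)
    (hS' e (he.mono (by simp)) H _ hp ⟨s, hs, rfl⟩)

theorem Env.Real.lift {Δ : Ctx} {e : PEnv Δ} {τ : Srt} {m : ℕ} {s : Sub Γ Δ}
    (h : ρ.Real (e.push τ m) fun σ v => (s σ v).wk τ) :
    (PTm.par τ m ;; ρ).Real (e.push τ m) (s.lift τ) := by
  intro σ v
  cases v
  · exact PEnv.push_self e τ m
  · exact h _ _

/-- The direction from right to left is the eigenvariable rule: a parameter that occurs neither in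
the world nor in the environment is reinterpreted by `PEnv.push` as the newly bound variable. -/
theorem Der.all_iff {σ : Srt} {φ : Fm (σ :: Γ)} :
    Der p ⟨Γ, Fm.all σ φ, ρ⟩ ↔ ∀ t : PTm σ, Der p ⟨σ :: Γ, φ, t ;; ρ⟩ := by
  constructor
  · rintro ⟨S, hS⟩ t
    refine ⟨S, fun e he H χ hp hc => ?_⟩
    obtain ⟨s, hs, rfl⟩ := hc
    have := Prf.allE (s σ Var.here) (hS e he H _ hp ⟨_, hs.tail, rfl⟩)
    rwa [Fm.inst_sub_lift, Sub.cons_head_tail] at this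
  · intro h
    obtain ⟨N, hN⟩ := p.exists_fresh
    obtain ⟨N', hN'⟩ := ρ.exists_fresh
    obtain ⟨S, hS⟩ := h (PTm.par σ (max N N'))
    refine ⟨S, fun e he H χ hp hc => ?_⟩
    obtain ⟨s, hs, rfl⟩ := hc
    exact Prf.allI (hS (e.push σ _) (he.push σ _) _ _ (hN e σ _ (by omega) H hp)
      ⟨s.lift σ, (hN' e σ _ (by omega) s hs).lift, rfl⟩)

theorem Der.exI {σ : Srt} {φ : Fm (σ :: Γ)} (t : PTm σ) (h : Der p ⟨σ :: Γ, φ, t ;; ρ⟩) :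
    Der p ⟨Γ, Fm.ex σ φ, ρ⟩ := by
  obtain ⟨S, hS⟩ := h
  obtain ⟨S', hS'⟩ := t.exists_total
  refine ⟨S ++ S', fun e he H χ hp hc => ?_⟩
  obtain ⟨s, hs, rfl⟩ := hc
  obtain ⟨t', ht⟩ := hS' e (he.mono (by simp))
  refine Prf.exI t' ?_
  rw [Fm.inst_sub_lift]
  exact hS e (he.mono (by simp)) H _ hp ⟨_, hs.cons ht, rfl⟩

theorem Der.exE {σ : Srt} {φ : Fm (σ :: Γ)} (h : Der p ⟨Γ, Fm.ex σ φ, ρ⟩)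
    (h' : ∀ t : PTm σ, Der (⟨σ :: Γ, φ, t ;; ρ⟩ :: p) c) : Der p c := by
  obtain ⟨S, hS⟩ := h
  obtain ⟨S', hS'⟩ := ρ.exists_total
  obtain ⟨N, hN⟩ := p.exists_fresh
  obtain ⟨N', hN'⟩ := ρ.exists_fresh
  obtain ⟨N'', hN''⟩ := c.env.exists_fresh
  obtain ⟨S'', hS''⟩ := h' (PTm.par σ (max N (max N' N'')))
  refine ⟨S ++ S' ++ S'', fun e he H χ hp hc => ?_⟩
  obtain ⟨s, hs⟩ := hS' e (he.mono (by simp))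
  obtain ⟨s', hs', rfl⟩ := hc
  refine Prf.exE (hS e (he.mono (by simp)) H _ hp ⟨s, hs, rfl⟩) ?_
  refine hS'' (e.push σ _) ((he.mono (by simp)).push σ _) _ _
    (Clo.Real.insert_cons (hN e σ _ (by omega) H hp)
      ⟨s.lift σ, (hN' e σ _ (by omega) s hs).lift, rfl⟩)
    ⟨_, hN'' e σ _ (by omega) s' hs', (Fm.sub_wk _ _ _).symm⟩

theorem Der.eqI {σ : Srt} (t : Tm Γ σ) : Der p ⟨Γ, t ≐ t, ρ⟩ := by
  refine ⟨[], fun e _ H χ _ hc => ?_⟩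
  obtain ⟨s, -, rfl⟩ := hc
  exact Prf.eqI _

theorem Der.eqE {σ : Srt} {a b : Tm Γ σ} (φ : Fm (σ :: Γ)) (h : Der p ⟨Γ, a ≐ b, ρ⟩)
    (h' : Der p ⟨σ :: Γ, φ, a.ev ρ ;; ρ⟩) : Der p ⟨σ :: Γ, φ, b.ev ρ ;; ρ⟩ := by
  obtain ⟨S, hS⟩ := h
  obtain ⟨S', hS'⟩ := h'
  refine ⟨S ++ S', fun e he H χ hp hc => ?_⟩
  obtain ⟨s, hs, rfl⟩ := hc
  obtain ⟨u, hu⟩ : ∃ u : Sub Γ _, u = fun σ v => s σ (Var.there v) := ⟨_, rfl⟩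
  have hu' : ρ.Real e u := hu ▸ hs.tail
  have hs' : s = Sub.cons (b.sub u) u := by
    rw [← Sub.cons_head_tail s, ← hu]
    congr 1
    exact Option.some.inj ((hs σ Var.here).symm.trans (Tm.real_ev hu' b))
  have := hS' e (he.mono (by simp)) H _ hp ⟨_, hu'.cons (Tm.real_ev hu' a), rfl⟩
  rw [hs', ← Fm.inst_sub_lift]
  refine Prf.eqE _ (hS e (he.mono (by simp)) H _ hp ⟨u, hu', rfl⟩) ?_
  rwa [Fm.inst_sub_lift]

/-- Closures with the same realizations are derivable from each other. -/
theorem Der.congr {Γ' : Ctx} {ρ' : Env Γ'} {φ : Fm Γ} {φ' : Fm Γ'} (h : Der p ⟨Γ, φ, ρ⟩)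
    (hφ : ∀ {Δ : Ctx} (e : PEnv Δ) (s : Sub Γ Δ) (s' : Sub Γ' Δ), ρ.Real e s → ρ'.Real e s' →
      φ.sub s = φ'.sub s') : Der p ⟨Γ', φ', ρ'⟩ := by
  obtain ⟨S, hS⟩ := h
  obtain ⟨S', hS'⟩ := ρ.exists_total
  refine ⟨S ++ S', fun e he H χ hp hc => ?_⟩
  obtain ⟨s', hs', rfl⟩ := hc
  obtain ⟨s, hs⟩ := hS' e (he.mono (by simp))
  exact hS e (he.mono (by simp)) H _ hp ⟨s, hs, hφ e s s' hs hs'⟩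

end Rules

/-! ### From derivability with parameters to derivability -/

theorem Prf.eq_symm {Γ : Ctx} {H : Set (Fm Γ)} {σ : Srt} {a b : Tm Γ σ} (h : Prf H (a ≐ b)) :
    Prf H (b ≐ a) := by
  have := Prf.eqE (Tm.var Var.here ≐ a.wk σ) h
  simp only [Fm.inst, Fm.sub, Tm.sub, Tm.wk, Tm.sub_ren, Sub.single, Tm.sub_var] at this
  exact this (Prf.eqI a)

theorem Prf.eq_trans {Γ : Ctx} {H : Set (Fm Γ)} {σ : Srt} {a b c : Tm Γ σ} (h : Prf H (a ≐ b))
    (h' : Prf H (b ≐ c)) : Prf H (a ≐ c) := by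
  have := Prf.eqE (a.wk σ ≐ Tm.var Var.here) h'
  simp only [Fm.inst, Fm.sub, Tm.sub, Tm.wk, Tm.sub_ren, Sub.single, Tm.sub_var] at this
  exact this h

/-- Every sort is provably inhabited, although not always by a closed term: power sorts by the empty
set, function sorts by a constant function, which unique choice extracts from its graph. This allows
superfluous variables to be discharged. -/
theorem Prf.exists_refl {Γ : Ctx} {H : Set (Fm Γ)} (σ : Srt) :
    Prf H (Fm.ex σ (Tm.var Var.here ≐ Tm.var Var.here)) := by
  induction σ generalizing Γ H with
  | nat => exact Prf.exI Tm.zero (Prf.eqI _)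
  | pow σ _ =>
    refine Prf.exE (Prf.ax (Ax.comprehension σ Fm.bot)) ?_
    exact Prf.exI (Tm.var Var.here) (Prf.eqI _)
  | prod σ τ ihσ ihτ =>
    refine Prf.exE ihσ (Prf.exE ihτ ?_)
    exact Prf.exI (Tm.pair (Tm.var (Var.there Var.here)) (Tm.var Var.here)) (Prf.eqI _)
  | fn σ τ _ ihτ =>
    refine Prf.exE ihτ ?_
    refine Prf.exE (Prf.ax (Ax.comprehension (prod σ τ)
      (Tm.snd (Tm.var Var.here) ≐ Tm.var (Var.there Var.here)))) ?_
    have key : ∀ {Δ : Ctx} {H : Set (Fm Δ)} (A : Tm Δ (pow (prod σ τ))) (b : Tm Δ τ),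
        Prf H (All (prod σ τ) fun x => (x ∊ ↟A) ⟺ (Tm.snd x ≐ ↟b)) →
        ∀ x y, (Prf H (Tm.pair x y ∊ A) → Prf H (y ≐ b)) ∧
          (Prf H (y ≐ b) → Prf H (Tm.pair x y ∊ A)) := by
      intro Δ H A b h x y
      have h₁ := Prf.allE (Tm.pair x y) h
      have h₂ : Prf H (Tm.snd (Tm.pair x y) ≐ y) := by
        have := Prf.allE y (Prf.allE x (Prf.ax (H := H) (Ax.snd_pair σ τ)))
        simpa [Fm.inst, Fm.sub, Tm.sub, Sub.lift, Sub.single, Tm.wk, Tm.sub_ren, Tm.sub_var,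
          Ext.incl] using this
      have h₁' : Prf H ((Tm.pair x y ∊ A) ⟺ (Tm.snd (Tm.pair x y) ≐ b)) := by
        simpa [Fm.inst, Fm.iff, Fm.sub, Tm.sub, Sub.lift, Sub.single, Tm.up, Tm.sub_ren,
          Tm.sub_var, Ext.incl] using h₁
      refine ⟨fun h => ?_, fun h => ?_⟩
      · exact Prf.eq_trans (Prf.eq_symm h₂) (Prf.impE (Prf.andE₁ h₁') h)
      · exact Prf.impE (Prf.andE₂ h₁') (Prf.eq_trans h₂ h)
    have hc := fun H => Prf.allE (H := H) (Tm.var Var.here)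
      (Prf.ax (Ax.unique_choice (Γ := pow (prod σ τ) :: τ :: Γ) σ τ))
    refine Prf.exE (Prf.impE (hc _) (Prf.andI (Prf.allI (Prf.exI
      (Tm.var (Var.there (Var.there Var.here))) ?_))
      (Prf.allI (Prf.allI (Prf.allI (Prf.impI ?_)))))) ?_
    · refine (key _ (Tm.var (Var.there (Var.there Var.here))) (Prf.hyp ?_) _ _).2 (Prf.eqI _)
      exact ⟨_, Or.inl rfl, rfl⟩
    · refine Prf.eq_trans
        ((key (Tm.var (Var.there (Var.there (Var.there Var.here))))
          (Tm.var (Var.there (Var.there (Var.there (Var.there Var.here))))) (Prf.hyp ?_) _ _).1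
          (Prf.andE₁ (Prf.hyp (Or.inl rfl))))
        (Prf.eq_symm ((key (Tm.var (Var.there (Var.there (Var.there Var.here))))
          (Tm.var (Var.there (Var.there (Var.there (Var.there Var.here))))) (Prf.hyp ?_) _ _).1
          (Prf.andE₂ (Prf.hyp (Or.inl rfl)))))
      all_goals exact Or.inr ⟨_, ⟨_, ⟨_, Or.inl rfl, rfl⟩, rfl⟩, rfl⟩
    · exact Prf.exI (Tm.var Var.here) (Prf.eqI _)

/-- A sentence that holds in all large contexts holds in the empty one. -/
theorem Prf.of_large (φ : Sentence) (H : Set Sentence) (S : Ctx)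
    (h : ∀ (s : Sub [] S) (H' : Set (Fm S)), (∀ ψ ∈ H, ψ.sub s ∈ H') → Prf H' (φ.sub s)) :
    Prf H φ := by
  induction S with
  | nil =>
    have hid : ∀ ψ : Sentence, ψ.sub (fun _ v => Tm.var v) = ψ := Fm.sub_var
    have := h (fun _ v => Tm.var v) H (fun ψ hψ => by rwa [hid])
    rwa [hid] at this
  | cons σ S ih =>
    refine ih fun s H' hH' => Prf.exE (Prf.exists_refl σ) ?_
    rw [Fm.sub_wk]
    exact h _ _ fun ψ hψ => Or.inr ⟨_, hH' ψ hψ, Fm.sub_wk _ _ _⟩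

theorem Var.exists_of_mem {Γ : Ctx} {σ : Srt} (h : σ ∈ Γ) : Nonempty (Var Γ σ) := by
  induction Γ with
  | nil => simp at h
  | cons τ Γ ih =>
    rcases List.mem_cons.1 h with rfl | h
    · exact ⟨Var.here⟩
    · exact (ih h).map Var.there

-- In a context with a variable for each of the finitely many sorts required, every parameter of
-- such a sort can be realized by a variable. `Prf.of_large` then removes these variables again.
open Classical in
theorem Der.prf {φ : Sentence} {ρ : Env []} (h : Der [] ⟨[], φ, ρ⟩) (H : Set Sentence) :
    Prf H φ := by
  obtain ⟨S, hS⟩ := h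
  refine Prf.of_large φ H S fun s H' _ => ?_
  refine hS (fun σ _ => if h : σ ∈ S then some (Tm.var (Var.exists_of_mem h).some) else none)
    (fun σ hσ n => by simp [hσ]) H' _ (fun c hc => by simp at hc) ⟨s, fun _ v => (nomatch v), rfl⟩

end BISH

/-! ### Forcing semantics and its agreement with derivability -/

namespace BISH

open Srt Tm

/-! ### Truth values -/

/-- The world `q` has more hypotheses than `p`. -/
class Le (q : World) (p : semiOutParam World) : Prop where
  /-- The hypotheses of `p` are hypotheses of `q`. -/
  sub : p ⊆ q

instance Le.refl (p : World) : Le p p := ⟨List.Subset.refl p⟩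

instance Le.trans (r q p : World) [h : Le r q] [h' : Le q p] : Le r p :=
  ⟨List.Subset.trans h'.sub h.sub⟩

instance Le.cons (c : Clo) (p : World) : Le (c :: p) p := ⟨List.subset_cons_self c p⟩

/-- Truth values: monotone sets of worlds that contain a world as soon as they contain it as far as
derivability is concerned. -/
structure Om where
  /-- The worlds in which the truth value is true. -/
  holds : World → Prop
  mono : ∀ {p q : World} [Le q p], holds p → holds q
  closed : ∀ {p : World}, (∀ (c : Clo) (q : World) [Le q p],
    (∀ (r : World) [Le r q], holds r → Der r c) → Der q c) → holds p

/-- `A` is true in the world `p`. -/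
def Forces (p : World) (A : Om) : Prop := A.holds p

infix:20 " ⊩ " => Forces

theorem Forces.up {p : World} {A : Om} (h : p ⊩ A) {q : World} [Le q p] : q ⊩ A := A.mono h

namespace Om

/-- The truth value of a formula with parameters. -/
def ofClo (c : Clo) : Om where
  holds p := Der p c
  mono := fun {_ _} i h => h.mono i.sub
  closed h := h c _ fun _ _ h => h

/-- Conjunction. -/
def and (A B : Om) : Om where
  holds p := (p ⊩ A) ∧ (p ⊩ B)
  mono h := ⟨h.1.up, h.2.up⟩
  closed h := ⟨A.closed fun c q _ k => h c q fun r _ hr => k r hr.1,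
    B.closed fun c q _ k => h c q fun r _ hr => k r hr.2⟩

/-- Disjunction. -/
def or (A B : Om) : Om where
  holds p := ∀ (c : Clo) (q : World) [Le q p],
    (∀ (r : World) [Le r q], (r ⊩ A) ∨ (r ⊩ B) → Der r c) → Der q c
  mono h c q _ k := h c q k
  closed h c q _ k := h c q fun r _ hr => hr c r fun r' _ h' => k r' h'

/-- Implication. -/
def imp (A B : Om) : Om where
  holds p := ∀ ⦃q : World⦄ [Le q p], (q ⊩ A) → (q ⊩ B)
  mono h _ _ ha := h ha
  closed h _ _ ha := B.closed fun c r _ k => h c r fun r' _ hr => k r' (hr ha.up)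

/-- Universal quantification. -/
def all {σ : Srt} (F : PTm σ → Om) : Om where
  holds p := ∀ t : PTm σ, p ⊩ F t
  mono h t := (h t).up
  closed h t := (F t).closed fun c q _ k => h c q fun r _ hr => k r (hr t)

/-- Existential quantification. -/
def ex {σ : Srt} (F : PTm σ → Om) : Om where
  holds p := ∀ (c : Clo) (q : World) [Le q p],
    (∀ (r : World) [Le r q], (∃ t, r ⊩ F t) → Der r c) → Der q c
  mono h c q _ k := h c q k
  closed h c q _ k := h c q fun r _ hr => hr c r fun r' _ h' => k r' h'

/-- Falsity. -/
def bot : Om := ofClo ⟨[], Fm.bot, Env.nil⟩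

/-- Equality. -/
def eq {σ : Srt} (a b : PTm σ) : Om :=
  ofClo ⟨[σ, σ], Tm.var Var.here ≐ Tm.var (Var.there Var.here), a ;; b ;; Env.nil⟩

/-- Membership. -/
def mem {σ : Srt} (a : PTm σ) (b : PTm (pow σ)) : Om :=
  ofClo ⟨[σ, pow σ], Tm.var Var.here ∊ Tm.var (Var.there Var.here), a ;; b ;; Env.nil⟩

/-- Negation. -/
def neg (A : Om) : Om := imp A bot

/-- Equivalence. -/
def iff (A B : Om) : Om := and (imp A B) (imp B A)

@[ext]
theorem ext {A B : Om} (h : ∀ p, (p ⊩ A) ↔ (p ⊩ B)) : A = B := by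
  cases A
  cases B
  congr
  funext p
  exact propext (h p)

end Om

/-- The truth value of a formula. -/
def Fm.ev : ∀ {Γ : Ctx}, Env Γ → Fm Γ → Om
  | _, ρ, Fm.eq s t => Om.eq (s.ev ρ) (t.ev ρ)
  | _, ρ, Fm.mem s t => Om.mem (s.ev ρ) (t.ev ρ)
  | _, _, Fm.bot => Om.bot
  | _, ρ, Fm.and φ ψ => Om.and (φ.ev ρ) (ψ.ev ρ)
  | _, ρ, Fm.or φ ψ => Om.or (φ.ev ρ) (ψ.ev ρ)
  | _, ρ, Fm.imp φ ψ => Om.imp (φ.ev ρ) (ψ.ev ρ)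
  | _, ρ, Fm.all _ φ => Om.all fun t => φ.ev (t ;; ρ)
  | _, ρ, Fm.ex _ φ => Om.ex fun t => φ.ev (t ;; ρ)

section Rules

variable {p : World} {A B X : Om} {σ τ : Srt}

theorem orI₁ (h : p ⊩ A) : p ⊩ A.or B := fun _ _ _ k => k _ (Or.inl h.up)

theorem orI₂ (h : p ⊩ B) : p ⊩ A.or B := fun _ _ _ k => k _ (Or.inr h.up)

theorem orE (h : p ⊩ A.or B) (h₁ : ∀ (q : World) [Le q p], (q ⊩ A) → (q ⊩ X))
    (h₂ : ∀ (q : World) [Le q p], (q ⊩ B) → (q ⊩ X)) : p ⊩ X :=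
  X.closed fun c q _ k => h c q fun r _ hr => k r (hr.elim (h₁ r) (h₂ r))

theorem exI {F : PTm σ → Om} (t : PTm σ) (h : p ⊩ F t) : p ⊩ Om.ex F :=
  fun _ _ _ k => k _ ⟨t, h.up⟩

theorem exE {F : PTm σ → Om} (h : p ⊩ Om.ex F)
    (h' : ∀ (t : PTm σ) (q : World) [Le q p], (q ⊩ F t) → (q ⊩ X)) : p ⊩ X :=
  X.closed fun c q _ k => h c q fun r _ hr => k r (hr.elim fun t ht => h' t r ht)

theorem botE (h : p ⊩ Om.bot) : p ⊩ X :=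
  X.closed fun _ q _ _ => Der.botE (h.up (q := q))

end Rules

/-! ### Forcing is derivability -/

section Truth

theorem Tm.real_ev_eq {Γ Δ Γ' : Ctx} {ρ : Env Γ} {ρ' : Env Γ'} {e : PEnv Δ} {s : Sub Γ Δ}
    {s' : Sub Γ' Δ} (h : ρ.Real e s) (h' : ρ'.Real e s') {σ : Srt} {t : Tm Γ σ} {t' : Tm Γ' σ}
    (ht : t.ev ρ = t'.ev ρ') : t.sub s = t'.sub s' :=
  Option.some.inj ((Tm.real_ev h t).symm.trans (ht ▸ Tm.real_ev h' t'))

theorem Der.eq_congr {p : World} {Γ Γ' : Ctx} {ρ : Env Γ} {ρ' : Env Γ'} {σ : Srt} {s t : Tm Γ σ}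
    {s' t' : Tm Γ' σ} (hs : s.ev ρ = s'.ev ρ') (ht : t.ev ρ = t'.ev ρ')
    (h : Der p ⟨Γ, s ≐ t, ρ⟩) : Der p ⟨Γ', s' ≐ t', ρ'⟩ :=
  h.congr fun _ _ _ hr hr' => by
    rw [Fm.sub, Fm.sub, Tm.real_ev_eq hr hr' hs, Tm.real_ev_eq hr hr' ht]

theorem Der.mem_congr {p : World} {Γ Γ' : Ctx} {ρ : Env Γ} {ρ' : Env Γ'} {σ : Srt} {s : Tm Γ σ}
    {t : Tm Γ (pow σ)} {s' : Tm Γ' σ} {t' : Tm Γ' (pow σ)} (hs : s.ev ρ = s'.ev ρ')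
    (ht : t.ev ρ = t'.ev ρ') (h : Der p ⟨Γ, s ∊ t, ρ⟩) : Der p ⟨Γ', s' ∊ t', ρ'⟩ :=
  h.congr fun _ _ _ hr hr' => by
    rw [Fm.sub, Fm.sub, Tm.real_ev_eq hr hr' hs, Tm.real_ev_eq hr hr' ht]

/-- Induction on the formula. For implication, and for the eliminations of disjunction and
existence, the world is extended by the formula in question as a new hypothesis, which forces it by
the induction hypothesis. Introductions of the last two use their definition with the formula itself
as the target `c`. -/
theorem Fm.forces_ev {Γ : Ctx} (φ : Fm Γ) :
    ∀ {p : World} {ρ : Env Γ}, (p ⊩ φ.ev ρ) ↔ Der p ⟨Γ, φ, ρ⟩ := by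
  induction φ with
  | eq s t => exact ⟨Der.eq_congr rfl rfl, Der.eq_congr rfl rfl⟩
  | mem s t => exact ⟨Der.mem_congr rfl rfl, Der.mem_congr rfl rfl⟩
  | bot => exact ⟨Der.botE, Der.botE⟩
  | and φ ψ ih₁ ih₂ => exact fun {p ρ} => (and_congr ih₁ ih₂).trans Der.and_iff.symm
  | or φ ψ ih₁ ih₂ =>
    refine fun {p ρ} => ⟨fun h => ?_, fun h => ?_⟩
    · exact h _ p fun r _ hr => hr.elim (fun h => (ih₁.1 h).orI₁) fun h => (ih₂.1 h).orI₂
    · intro c q i k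
      exact (h.mono i.sub).orE (k _ (Or.inl (ih₁.2 (Der.hyp (by simp)))))
        (k _ (Or.inr (ih₂.2 (Der.hyp (by simp)))))
  | imp φ ψ ih₁ ih₂ =>
    refine fun {p ρ} => ⟨fun h => ?_, fun h => ?_⟩
    · exact (ih₂.1 (h (q := ⟨_, φ, ρ⟩ :: p) (ih₁.2 (Der.hyp (by simp))))).impI
    · intro q i hq
      exact ih₂.2 ((h.mono i.sub).impE (ih₁.1 hq))
  | all σ φ ih => exact fun {p ρ} => (forall_congr' fun t => ih).trans Der.all_iff.symm
  | ex σ φ ih =>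
    refine fun {p ρ} => ⟨fun h => ?_, fun h => ?_⟩
    · exact h _ p fun r _ hr => hr.elim fun t ht => (ih.1 ht).exI t
    · intro c q i k
      exact (h.mono i.sub).exE fun t => k _ ⟨t, ih.2 (Der.hyp (by simp))⟩

theorem Prf.of_forces {φ : Sentence} (h : [] ⊩ φ.ev Env.nil) (H : Set Sentence) : Prf H φ :=
  Der.prf (φ.forces_ev.1 h) H

theorem Tm.ev_sub {Γ Δ : Ctx} (s : Sub Γ Δ) (ρ : Env Δ) {σ : Srt} (t : Tm Γ σ) :
    (t.sub s).ev ρ = t.ev fun τ v => (s τ v).ev ρ := by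
  induction t <;> simp_all [Tm.sub, Tm.ev]

theorem Tm.ev_ren {Γ Δ : Ctx} (r : Ren Γ Δ) (ρ : Env Δ) {σ : Srt} (t : Tm Γ σ) :
    (t.ren r).ev ρ = t.ev fun τ v => ρ τ (r τ v) := by
  rw [Tm.ren_eq_sub, Tm.ev_sub]
  rfl

theorem Fm.ev_sub {Γ : Ctx} (φ : Fm Γ) : ∀ {Δ : Ctx} (s : Sub Γ Δ) (ρ : Env Δ),
    (φ.sub s).ev ρ = φ.ev fun τ v => (s τ v).ev ρ := by
  have lift : ∀ {Γ Δ : Ctx} (s : Sub Γ Δ) (ρ : Env Δ) {τ : Srt} (t : PTm τ),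
      (fun σ v => (s.lift τ σ v).ev (t ;; ρ)) = (t ;; fun σ v => (s σ v).ev ρ) := by
    intro Γ Δ s ρ τ t
    funext σ v
    cases v
    · rfl
    · simp only [Sub.lift, Tm.wk, Tm.ev_ren]
      rfl
  induction φ <;> intros <;> simp only [Fm.sub, Fm.ev, Tm.ev_sub, *]

theorem Fm.ev_ren {Γ : Ctx} (φ : Fm Γ) : ∀ {Δ : Ctx} (r : Ren Γ Δ) (ρ : Env Δ),
    (φ.ren r).ev ρ = φ.ev fun τ v => ρ τ (r τ v) := by
  have lift : ∀ {Γ Δ : Ctx} (r : Ren Γ Δ) (ρ : Env Δ) {τ : Srt} (t : PTm τ),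
      (fun σ v => (t ;; ρ) σ (r.lift τ σ v)) = (t ;; fun σ v => ρ σ (r σ v)) := by
    intro Γ Δ s ρ τ t
    funext σ v
    cases v <;> rfl
  induction φ <;> intros <;> simp only [Fm.ren, Fm.ev, Tm.ev_ren, *]

theorem forces_ax {p : World} {Γ : Ctx} {ρ : Env Γ} {φ : Fm Γ}
    (h : ∀ {Δ : Ctx} (s : Sub Γ Δ), Ax (φ.sub s)) : p ⊩ φ.ev ρ :=
  φ.forces_ev.2 (Der.of_ax h)

theorem forces_sentence {p : World} {φ : Sentence} (_ : Ax φ)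
    (h : ∀ {Δ : Ctx} (s : Sub [] Δ), Ax (φ.sub s)) : p ⊩ φ.ev Env.nil :=
  forces_ax h

end Truth

/-! ### Equality -/

section Equality

variable {p : World} {σ τ : Srt}

theorem eq_refl (a : PTm σ) : p ⊩ Om.eq a a :=
  (Fm.forces_ev (Tm.var Var.here ≐ Tm.var Var.here) (ρ := a ;; Env.nil)).2 (Der.eqI _)

theorem eq_subst {Γ : Ctx} (φ : Fm (σ :: Γ)) (ρ : Env Γ) {a b : PTm σ} (h : p ⊩ Om.eq a b)
    (h' : p ⊩ φ.ev (a ;; ρ)) : p ⊩ φ.ev (b ;; ρ) := by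
  have key : ∀ t : PTm σ, (Fm.ren (Ren.lift (fun _ v => Var.there (Var.there v)) σ) φ).ev
      (t ;; a ;; b ;; ρ) = φ.ev (t ;; ρ) := by
    intro t
    rw [Fm.ev_ren]
    congr 1
    funext τ v
    cases v <;> rfl
  rw [← key, Fm.forces_ev] at h' ⊢
  exact Der.eqE (ρ := a ;; b ;; ρ) (a := Tm.var Var.here) (b := Tm.var (Var.there Var.here)) _
    ((Fm.forces_ev (Tm.var Var.here ≐ Tm.var (Var.there Var.here))).1 h) h'

theorem eq_symm {a b : PTm σ} (h : p ⊩ Om.eq a b) : p ⊩ Om.eq b a :=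
  eq_subst (Tm.var Var.here ≐ Tm.var (Var.there Var.here)) (a ;; Env.nil) h (eq_refl a)

theorem eq_trans {a b c : PTm σ} (h : p ⊩ Om.eq a b) (h' : p ⊩ Om.eq b c) : p ⊩ Om.eq a c :=
  eq_subst (Tm.var (Var.there Var.here) ≐ Tm.var Var.here) (a ;; Env.nil) h' h

/-- Equal values of the first variable give equal values of a term. -/
theorem eq_congr {Γ : Ctx} (t : Tm (σ :: Γ) τ) (ρ : Env Γ) {a b : PTm σ} (h : p ⊩ Om.eq a b) :
    p ⊩ Om.eq (t.ev (a ;; ρ)) (t.ev (b ;; ρ)) := by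
  have key : ∀ c : PTm σ, (t.ren (Ren.lift (fun _ v => Var.there v) σ)).ev (c ;; a ;; ρ) =
      t.ev (c ;; ρ) := by
    intro c
    rw [Tm.ev_ren]
    congr 1
    funext τ v
    cases v <;> rfl
  have := eq_subst ((t.ren fun _ v => Var.there v) ≐ t.ren (Ren.lift (fun _ v => Var.there v) σ))
    (a ;; ρ) h
  have key' : ∀ c : PTm σ, (t.ren fun _ v => Var.there v).ev (c ;; a ;; ρ) = t.ev (a ;; ρ) :=
    fun c => Tm.ev_ren _ _ _
  simp only [Fm.ev, key, key'] at this
  exact this (eq_refl _)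

/-- The first variable. -/
abbrev v0 {Γ : Ctx} {σ : Srt} : Tm (σ :: Γ) σ := Tm.var Var.here

/-- The second variable. -/
abbrev v1 {Γ : Ctx} {σ τ : Srt} : Tm (τ :: σ :: Γ) σ := Tm.var (Var.there Var.here)

/-- The third variable. -/
abbrev v2 {Γ : Ctx} {σ τ₁ τ₂ : Srt} : Tm (τ₁ :: τ₂ :: σ :: Γ) σ :=
  Tm.var (Var.there (Var.there Var.here))

/-- The fourth variable. -/
abbrev v3 {Γ : Ctx} {σ τ₁ τ₂ τ₃ : Srt} : Tm (τ₁ :: τ₂ :: τ₃ :: σ :: Γ) σ :=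
  Tm.var (Var.there (Var.there (Var.there Var.here)))

theorem app_congr {f g : PTm (fn σ τ)} {a b : PTm σ} (h : p ⊩ Om.eq f g) (h' : p ⊩ Om.eq a b) :
    p ⊩ Om.eq (f.app a) (g.app b) :=
  eq_trans (eq_congr (app v0 v1) (a ;; Env.nil) h) (eq_congr (app v1 v0) (g ;; Env.nil) h')

theorem pair_congr {a b : PTm σ} {c d : PTm τ} (h : p ⊩ Om.eq a b) (h' : p ⊩ Om.eq c d) :
    p ⊩ Om.eq (a.pair c) (b.pair d) :=
  eq_trans (eq_congr (pair v0 v1) (c ;; Env.nil) h) (eq_congr (pair v1 v0) (b ;; Env.nil) h')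

theorem fst_congr {a b : PTm (prod σ τ)} (h : p ⊩ Om.eq a b) : p ⊩ Om.eq a.fst b.fst :=
  eq_congr (fst v0) Env.nil h

theorem snd_congr {a b : PTm (prod σ τ)} (h : p ⊩ Om.eq a b) : p ⊩ Om.eq a.snd b.snd :=
  eq_congr (snd v0) Env.nil h

theorem mem_congr {a b : PTm σ} {A B : PTm (pow σ)} (h : p ⊩ Om.eq a b) (h' : p ⊩ Om.eq A B)
    (hm : p ⊩ Om.mem a A) : p ⊩ Om.mem b B :=
  eq_subst (v1 ∊ v0) (b ;; Env.nil) h' (eq_subst (v0 ∊ v1) (A ;; Env.nil) h hm)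

theorem fst_pair (a : PTm σ) (b : PTm τ) : p ⊩ Om.eq (a.pair b).fst a :=
  forces_sentence (Ax.fst_pair σ τ) (fun _ => Ax.fst_pair σ τ) a b

theorem snd_pair (a : PTm σ) (b : PTm τ) : p ⊩ Om.eq (a.pair b).snd b :=
  forces_sentence (Ax.snd_pair σ τ) (fun _ => Ax.snd_pair σ τ) a b

theorem pair_eta (a : PTm (prod σ τ)) : p ⊩ Om.eq (a.fst.pair a.snd) a :=
  forces_sentence (Ax.pair_eta σ τ) (fun _ => Ax.pair_eta σ τ) a

theorem fn_ext {f g : PTm (fn σ τ)} (h : ∀ x, p ⊩ Om.eq (f.app x) (g.app x)) : p ⊩ Om.eq f g :=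
  forces_sentence (p := p) (Ax.fn_ext σ τ) (fun _ => Ax.fn_ext σ τ) f g h

theorem pow_ext {A B : PTm (pow σ)} (h : ∀ x, p ⊩ (Om.mem x A).iff (Om.mem x B)) :
    p ⊩ Om.eq A B :=
  forces_sentence (p := p) (Ax.pow_ext σ) (fun _ => Ax.pow_ext σ) A B h

end Equality

/-! ### Comprehension, induction and choice -/

section Choice

variable {p : World} {X : Om} {σ τ : Srt} {Γ : Ctx}

theorem iff_forces {A B : Om} (h : p ⊩ A.iff B) {q : World} [Le q p] : (q ⊩ A) ↔ (q ⊩ B) :=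
  ⟨fun ha => h.1 ha, fun hb => h.2 hb⟩

/-- Terms have no set abstraction, so the set is available only under an existential quantifier, and
the lemma hands it to a continuation in a larger world. Functions obtained from choice are treated
in the same way. -/
theorem compE (φ : Fm (σ :: Γ)) (ρ : Env Γ)
    (k : ∀ (A : PTm (pow σ)) (q : World) [Le q p],
      (∀ (x : PTm σ) {r : World} [Le r q], (r ⊩ Om.mem x A) ↔ (r ⊩ φ.ev (x ;; ρ))) → (q ⊩ X)) :
    p ⊩ X := by
  have h : p ⊩ (Ex (Γ := Γ) (pow σ) fun A => All σ fun x =>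
        (x ∊ A) ⟺ φ.ren (Ren.lift (fun _ v => Var.there v) σ)).ev ρ := by
    refine forces_ax fun s => ?_
    have := Ax.comprehension σ (φ.sub (s.lift σ))
    convert this using 1
    simp only [Ex, All, Fm.sub, Fm.iff, Fm.sub_ren, Fm.ren_sub]
    have h' : (fun τ v => ((s.lift (pow σ)).lift σ) τ
        (Ren.lift (fun _ v => Var.there v) σ τ v)) =
        fun τ v => (s.lift σ τ v).ren (Ren.lift (fun _ v => Var.there v) σ) := by
      funext τ v
      cases v
      · rfl
      · simp [Sub.lift, Ren.lift, Tm.wk, Tm.ren_eq_sub, Tm.sub_sub, Tm.sub]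
    rw [h']
    rfl
  refine exE h fun A q _ hA => k A q fun x r _ => ?_
  have h₁ : (Fm.ren (Ren.lift (fun _ v => Var.there v) σ) φ).ev (x ;; A ;; ρ) = φ.ev (x ;; ρ) := by
    rw [Fm.ev_ren]
    congr 1
    funext τ v
    cases v <;> rfl
  rw [← h₁]
  exact iff_forces (hA x)

theorem induction (φ : Fm (nat :: Γ)) (ρ : Env Γ) (h₀ : p ⊩ φ.ev (PTm.zero ;; ρ))
    (h : ∀ (n : PTm nat) (q : World) [Le q p], (q ⊩ φ.ev (n ;; ρ)) → (q ⊩ φ.ev (n.succ ;; ρ)))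
    (n : PTm nat) : p ⊩ φ.ev (n ;; ρ) := by
  refine compE φ ρ fun A q _ hA => (hA n).1 ?_
  exact forces_sentence (p := q) Ax.induction (fun _ => Ax.induction) A
    ⟨(hA _).2 h₀.up, fun x r _ hx => (hA _).2 (h x r ((hA x).1 hx))⟩ n

/-- The relation defined by a formula in two variables. -/
theorem compE₂ (φ : Fm (τ :: σ :: Γ)) (ρ : Env Γ)
    (k : ∀ (A : PTm (pow (prod σ τ))) (q : World) [Le q p],
      (∀ (x : PTm σ) (y : PTm τ) {r : World} [Le r q],
        (r ⊩ Om.mem (x.pair y) A) ↔ (r ⊩ φ.ev (y ;; x ;; ρ))) → (q ⊩ X)) :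
    p ⊩ X := by
  refine compE (φ.sub (Sub.cons (snd v0) (Sub.cons (fst v0) fun _ v => Tm.var (Var.there v)))) ρ
    fun A q _ hA => k A q fun x y r _ => ?_
  rw [hA, Fm.ev_sub]
  have h : (fun τ' v => (Sub.cons (snd v0) (Sub.cons (fst v0) fun _ v => Tm.var (Var.there v))
      τ' v).ev (x.pair y ;; ρ)) = ((x.pair y).snd ;; (x.pair y).fst ;; ρ) := by
    funext τ' v
    rcases v with _ | v
    · rfl
    · cases v <;> rfl
  rw [h]
  have h₁ : ∀ a b : PTm σ, (r ⊩ Om.eq a b) → (r ⊩ φ.ev (y ;; a ;; ρ)) → (r ⊩ φ.ev (y ;; b ;; ρ)) := by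
    intro a b hab h
    have e : ∀ a, (φ.sub (Sub.cons v1 (Sub.cons v0 fun _ v => Tm.var (Var.there (Var.there v))))).ev
        (a ;; y ;; ρ) = φ.ev (y ;; a ;; ρ) := by
      intro a
      rw [Fm.ev_sub]
      congr 1
      funext τ' v
      rcases v with _ | v
      · rfl
      · cases v <;> rfl
    rw [← e] at h ⊢
    exact eq_subst _ _ hab h
  constructor
  · intro h
    exact h₁ _ _ (fst_pair x y) (eq_subst _ _ (snd_pair x y) h)
  · intro h
    exact eq_subst _ _ (eq_symm (snd_pair x y)) (h₁ _ _ (eq_symm (fst_pair x y)) h)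

theorem countable_choice (φ : Fm (σ :: nat :: Γ)) (ρ : Env Γ)
    (h : ∀ n, p ⊩ Om.ex fun x => φ.ev (x ;; n ;; ρ))
    (k : ∀ (f : PTm (fn nat σ)) (q : World) [Le q p],
      (∀ (n : PTm nat) {r : World} [Le r q], r ⊩ φ.ev (f.app n ;; n ;; ρ)) → (q ⊩ X)) : p ⊩ X := by
  refine compE₂ φ ρ fun A q _ hA => ?_
  refine exE (forces_sentence (p := q) (Ax.countable_choice σ) (fun _ => Ax.countable_choice σ) A
    fun n => exE (h n).up fun x r _ hx => exI x ((hA n x).2 hx)) fun f r _ hf => k f r fun n r' _ => ?_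
  exact (hA n _).1 (hf n).up

theorem unique_choice (φ : Fm (τ :: σ :: Γ)) (ρ : Env Γ)
    (h : ∀ x, p ⊩ Om.ex fun y => φ.ev (y ;; x ;; ρ))
    (h' : ∀ (x : PTm σ) (y z : PTm τ) (q : World) [Le q p], (q ⊩ φ.ev (y ;; x ;; ρ)) →
      (q ⊩ φ.ev (z ;; x ;; ρ)) → (q ⊩ Om.eq y z))
    (k : ∀ (f : PTm (fn σ τ)) (q : World) [Le q p],
      (∀ (x : PTm σ) {r : World} [Le r q], r ⊩ φ.ev (f.app x ;; x ;; ρ)) → (q ⊩ X)) : p ⊩ X := by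
  refine compE₂ φ ρ fun A q _ hA => ?_
  refine exE (forces_sentence (p := q) (Ax.unique_choice σ τ) (fun _ => Ax.unique_choice σ τ) A
    ⟨fun n => exE (h n).up fun x r _ hx => exI x ((hA n x).2 hx),
      fun x y z r _ hr => h' x y z r ((hA x y).1 hr.1) ((hA x z).1 hr.2)⟩)
    fun f r _ hf => k f r fun n r' _ => ?_
  exact (hA n _).1 (hf n).up

/-- The axiom confines the sequence to a subset of the sort; here this subset is the whole sort,
given by `x = x`. -/
theorem dependent_choice (φ : Fm (σ :: σ :: Γ)) (ρ : Env Γ) (a : PTm σ)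
    (h : ∀ x, p ⊩ Om.ex fun y => φ.ev (y ;; x ;; ρ))
    (k : ∀ (f : PTm (fn nat σ)) (q : World) [Le q p], (∀ {r : World} [Le r q],
        r ⊩ Om.eq (f.app PTm.zero) a) →
      (∀ (n : PTm nat) {r : World} [Le r q], r ⊩ φ.ev (f.app n.succ ;; f.app n ;; ρ)) →
      (q ⊩ X)) : p ⊩ X := by
  refine compE₂ φ ρ fun A q _ hA => ?_
  refine compE (σ := σ) (v0 ≐ v0) Env.nil fun B r _ hB => ?_
  have hB' : ∀ (x : PTm σ) {r' : World} [Le r' r], r' ⊩ Om.mem x B :=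
    fun x r' _ => (hB x).2 (eq_refl x)
  refine exE (forces_sentence (p := r) (Ax.dependent_choice σ) (fun _ => Ax.dependent_choice σ) B A a
    ⟨hB' a, fun x r' _ _ => exE (h x).up fun y r _ hy => exI y ⟨hB' y, (hA x y).2 hy⟩⟩)
    fun f r _ hf => k f r hf.1.up fun n r' _ => ?_
  exact (hA _ _).1 (hf.2 n).2.up

end Choice

end BISH

/-! ### Embedding a linearly ordered semiring into an ordered field -/

namespace BISH

/-! ### Ordered semirings in ordered fields -/

section OrderedField

/-- Formal differences of elements of a semiring. -/
@[ext]
structure FormalDiff (N : Type) where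
  /-- The minuend. -/
  pos : N
  /-- The subtrahend. -/
  neg : N

namespace FormalDiff

variable {N : Type} [CommSemiring N]

instance : Zero (FormalDiff N) := ⟨⟨0, 0⟩⟩
instance : One (FormalDiff N) := ⟨⟨1, 0⟩⟩
instance : Add (FormalDiff N) := ⟨fun x y => ⟨x.pos + y.pos, x.neg + y.neg⟩⟩
instance : Mul (FormalDiff N) :=
  ⟨fun x y => ⟨x.pos * y.pos + x.neg * y.neg, x.pos * y.neg + x.neg * y.pos⟩⟩

@[simp] theorem pos_zero : (0 : FormalDiff N).pos = 0 := rfl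
@[simp] theorem neg_zero : (0 : FormalDiff N).neg = 0 := rfl
@[simp] theorem pos_one : (1 : FormalDiff N).pos = 1 := rfl
@[simp] theorem neg_one : (1 : FormalDiff N).neg = 0 := rfl
@[simp] theorem pos_add (x y : FormalDiff N) : (x + y).pos = x.pos + y.pos := rfl
@[simp] theorem neg_add (x y : FormalDiff N) : (x + y).neg = x.neg + y.neg := rfl
@[simp] theorem pos_mul (x y : FormalDiff N) :
    (x * y).pos = x.pos * y.pos + x.neg * y.neg := rfl
@[simp] theorem neg_mul (x y : FormalDiff N) :
    (x * y).neg = x.pos * y.neg + x.neg * y.pos := rfl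

instance : CommSemiring (FormalDiff N) where
  add_assoc _ _ _ := by ext <;> simp [add_assoc]
  zero_add _ := by ext <;> simp
  add_zero _ := by ext <;> simp
  add_comm _ _ := by ext <;> simp [add_comm]
  nsmul := nsmulRec
  left_distrib _ _ _ := by ext <;> simp <;> ring
  right_distrib _ _ _ := by ext <;> simp <;> ring
  zero_mul _ := by ext <;> simp
  mul_zero _ := by ext <;> simp
  mul_assoc _ _ _ := by ext <;> simp <;> ring
  one_mul _ := by ext <;> simp
  mul_one _ := by ext <;> simp
  mul_comm _ _ := by ext <;> simp <;> ring

/-- Two formal differences have the same value. -/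
def con [IsCancelAdd N] : RingCon (FormalDiff N) where
  r x y := x.pos + y.neg = y.pos + x.neg
  iseqv :=
    { refl := fun _ => rfl
      symm := fun h => h.symm
      trans := by
        intro x y z h h'
        have : (x.pos + z.neg) + (y.pos + y.neg) = (z.pos + x.neg) + (y.pos + y.neg) := by
          calc _ = (x.pos + y.neg) + (y.pos + z.neg) := by ring
            _ = (y.pos + x.neg) + (z.pos + y.neg) := by rw [h, h']
            _ = _ := by ring
        exact add_right_cancel this }
  add' := by
    intro w x y z h h'
    calc (w.pos + y.pos) + (x.neg + z.neg) = (w.pos + x.neg) + (y.pos + z.neg) := by ring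
      _ = (x.pos + w.neg) + (z.pos + y.neg) := by rw [h, h']
      _ = _ := by simp only [pos_add, neg_add]; ring
  mul' := by
    intro w x y z h h'
    have h₁ : (w * y).pos + (x * y).neg = (x * y).pos + (w * y).neg := by
      calc _ = (w.pos + x.neg) * y.pos + (x.pos + w.neg) * y.neg := by
            simp only [pos_mul, neg_mul]; ring
        _ = (x.pos + w.neg) * y.pos + (w.pos + x.neg) * y.neg := by rw [h]
        _ = _ := by simp only [pos_mul, neg_mul]; ring
    have h₂ : (x * y).pos + (x * z).neg = (x * z).pos + (x * y).neg := by
      calc _ = x.pos * (y.pos + z.neg) + x.neg * (z.pos + y.neg) := by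
            simp only [pos_mul, neg_mul]; ring
        _ = x.pos * (z.pos + y.neg) + x.neg * (y.pos + z.neg) := by rw [h']
        _ = _ := by simp only [pos_mul, neg_mul]; ring
    have : ((w * y).pos + (x * z).neg) + ((x * y).neg + (x * y).pos) =
        ((x * z).pos + (w * y).neg) + ((x * y).neg + (x * y).pos) := by
      calc _ = ((w * y).pos + (x * y).neg) + ((x * y).pos + (x * z).neg) := by ring
        _ = ((x * y).pos + (w * y).neg) + ((x * z).pos + (x * y).neg) := by rw [h₁, h₂]
        _ = _ := by ring
    exact add_right_cancel this

end FormalDiff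

/-- The Grothendieck construction: formal differences modulo equality of values, where cancellation
makes this relation transitive and the embedding injective. -/
theorem exists_commRing (N : Type) [CommSemiring N] [IsCancelAdd N] :
    ∃ (Z : Type) (_ : CommRing Z) (f : N →+* Z), Function.Injective f ∧
      ∀ z, ∃ a b, z = f a - f b := by
  let Z := (FormalDiff.con (N := N)).Quotient
  let mk : FormalDiff N → Z := fun x => (x : Z)
  have mk_eq : ∀ x y : FormalDiff N, mk x = mk y ↔ x.pos + y.neg = y.pos + x.neg :=
    fun x y => RingCon.eq _
  let _ : Neg Z := ⟨Quotient.map (fun x => ⟨x.neg, x.pos⟩) (by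
    intro x y h
    change x.neg + y.pos = y.neg + x.pos
    have h : x.pos + y.neg = y.pos + x.neg := h
    rw [add_comm, ← h, add_comm])⟩
  let R : CommRing Z :=
    { (inferInstance : CommSemiring Z) with
      neg := Neg.neg
      zsmul := zsmulRec
      neg_add_cancel := by
        intro z
        induction z using Quotient.inductionOn with
        | h x => exact (mk_eq ⟨x.neg + x.pos, x.pos + x.neg⟩ 0).2 (by simp [add_comm]) }
  refine ⟨Z, R,
    { toFun := fun a => mk ⟨a, 0⟩
      map_one' := rfl
      map_zero' := rfl
      map_add' := fun a b => by
        refine (mk_eq ⟨a + b, 0⟩ (⟨a, 0⟩ + ⟨b, 0⟩)).2 (by simp)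
      map_mul' := fun a b => by
        refine (mk_eq ⟨a * b, 0⟩ (⟨a, 0⟩ * ⟨b, 0⟩)).2 (by simp) }, ?_, ?_⟩
  · intro a b h
    simpa using (mk_eq ⟨a, 0⟩ ⟨b, 0⟩).1 h
  · intro z
    obtain ⟨x, rfl⟩ : ∃ x, mk x = z := Quotient.exists_rep z
    have h : mk (x + ⟨x.neg, 0⟩) = mk ⟨x.pos, 0⟩ := (mk_eq _ _).2 (by simp)
    exact ⟨x.pos, x.neg, eq_sub_iff_add_eq.2 h⟩

/-- A ring with a cone of nonnegative elements is linearly ordered. -/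
theorem exists_linearOrder {R : Type} [CommRing R] [IsDomain R] (P : Subsemiring R)
    (hneg : ∀ x ∈ P, -x ∈ P → x = 0) (htotal : ∀ x, x ∈ P ∨ -x ∈ P) :
    ∃ (_ : LinearOrder R), IsStrictOrderedRing R ∧ ∀ x : R, 0 ≤ x ↔ x ∈ P := by
  classical
  let C : RingCone R := { P with eq_zero_of_mem_of_neg_mem' := fun {x} h h' => hneg x h h' }
  have : HasMemOrNegMem C := ⟨htotal⟩
  let L : LinearOrder R := LinearOrder.mkOfAddGroupCone C
  have : IsOrderedRing R := IsOrderedRing.mkOfCone C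
  refine ⟨L, inferInstance, fun x => ?_⟩
  change x - 0 ∈ P ↔ x ∈ P
  rw [sub_zero]

/-- The field of fractions is ordered by the cone of fractions with nonnegative numerator and
positive denominator. For totality, `a / b` is rewritten as `ab / b²`. -/
theorem exists_fraction_field (Z : Type) [CommRing Z] [LinearOrder Z] [IsStrictOrderedRing Z] :
    ∃ (K : Type) (_ : Field K) (_ : LinearOrder K) (_ : IsStrictOrderedRing K) (f : Z →+* K),
      ∀ z, 0 ≤ f z ↔ 0 ≤ z := by
  let K := FractionRing Z
  have : IsDomain Z := inferInstance
  let f := algebraMap Z K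
  have inj : Function.Injective f := IsFractionRing.injective Z K
  have ne : ∀ z : Z, 0 < z → f z ≠ 0 := fun z hz h =>
    hz.ne' (inj (h.trans (map_zero f).symm))
  let P : Subsemiring K :=
    { carrier := {x | ∃ a b : Z, 0 ≤ a ∧ 0 < b ∧ x * f b = f a}
      zero_mem' := ⟨0, 1, le_rfl, one_pos, by simp⟩
      one_mem' := ⟨1, 1, zero_le_one, one_pos, by simp⟩
      add_mem' := by
        rintro x y ⟨a, b, ha, hb, h⟩ ⟨c, d, hc, hd, h'⟩
        refine ⟨a * d + c * b, b * d, by positivity, by positivity, ?_⟩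
        simp only [map_add, map_mul, ← h, ← h']
        ring
      mul_mem' := by
        rintro x y ⟨a, b, ha, hb, h⟩ ⟨c, d, hc, hd, h'⟩
        refine ⟨a * c, b * d, by positivity, by positivity, ?_⟩
        simp only [map_mul, ← h, ← h']
        ring }
  obtain ⟨L, hL, h⟩ := exists_linearOrder P
    (by
      rintro x ⟨a, b, ha, hb, h⟩ ⟨c, d, hc, hd, h'⟩
      have : f (a * d + c * b) = f 0 := by
        simp only [map_add, map_mul, ← h, ← h', map_zero]
        ring
      have := inj this
      have had : a * d = 0 := by nlinarith [mul_nonneg ha hd.le, mul_nonneg hc hb.le]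
      have ha : a = 0 := by
        rcases mul_eq_zero.1 had with h | h
        · exact h
        · exact absurd h hd.ne'
      rw [ha, map_zero] at h
      exact (mul_eq_zero.1 h).resolve_right (ne b hb))
    (by
      intro x
      obtain ⟨a, b, hb, h⟩ := IsFractionRing.div_surjective (A := Z) x
      have hb : b ≠ 0 := nonZeroDivisors.ne_zero hb
      have hfb : f b ≠ 0 := fun h => hb (inj (h.trans (map_zero f).symm))
      have h : x * f b = f a := by rw [← h, div_mul_cancel₀ _ hfb]
      rcases le_total 0 (a * b) with hab | hab
      · refine Or.inl ⟨a * b, b * b, hab, mul_self_pos.2 hb, ?_⟩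
        simp only [map_mul, ← h]
        ring
      · refine Or.inr ⟨-(a * b), b * b, by linarith, mul_self_pos.2 hb, ?_⟩
        simp only [map_mul, map_neg, ← h]
        ring)
  refine ⟨K, inferInstance, L, hL, f, fun z => (h _).trans ⟨?_, fun hz => ⟨z, 1, hz, one_pos, by simp⟩⟩⟩
  rintro ⟨a, b, ha, hb, h⟩
  have : z * b = a := inj (by rw [map_mul, h])
  by_contra hz
  nlinarith

/-- The hypothesis `h_mul` is `0 < (b - a) * (d - c)` written without subtraction. It excludes zero
divisors in the ring of differences and makes the cone of nonnegative differences closed under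
products. -/
theorem exists_ordered_field (N : Type) [CommSemiring N] [LinearOrder N]
    (h_add : ∀ a b c : N, a + c ≤ b + c ↔ a ≤ b)
    (h_mul : ∀ a b c d : N, a < b → c < d → a * d + b * c < a * c + b * d) (h_one : (0 : N) ≠ 1) :
    ∃ (K : Type) (_ : Field K) (_ : LinearOrder K) (_ : IsStrictOrderedRing K) (f : N →+* K),
      ∀ a b, f a ≤ f b ↔ a ≤ b := by
  have : IsCancelAdd N :=
    { add_left_cancel := fun a b c (h : a + b = a + c) => by
        rw [add_comm a b, add_comm a c] at h
        exact le_antisymm ((h_add _ _ a).1 h.le) ((h_add _ _ a).1 h.ge)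
      add_right_cancel := fun a b c (h : b + a = c + a) =>
        le_antisymm ((h_add _ _ a).1 h.le) ((h_add _ _ a).1 h.ge) }
  obtain ⟨Z, _, f, inj, surj⟩ := exists_commRing N
  have h_mul' : ∀ a b c d : N, a ≤ b → c ≤ d → a * d + b * c ≤ a * c + b * d := by
    intro a b c d hab hcd
    rcases hab.eq_or_lt with rfl | hab
    · rw [add_comm]
    rcases hcd.eq_or_lt with rfl | hcd
    · exact le_rfl
    exact (h_mul a b c d hab hcd).le
  have : Nontrivial Z := ⟨f 0, f 1, fun h => h_one (inj h)⟩
  have : NoZeroDivisors Z := by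
    constructor
    intro x y h
    obtain ⟨a, b, rfl⟩ := surj x
    obtain ⟨c, d, rfl⟩ := surj y
    have key : a * c + b * d = a * d + b * c := by
      apply inj
      simp only [map_add, map_mul]
      linear_combination h
    rcases lt_trichotomy a b with hab | rfl | hab
    · rcases lt_trichotomy c d with hcd | rfl | hcd
      · exact absurd key (h_mul a b c d hab hcd).ne'
      · simp
      · exact absurd key (h_mul a b d c hab hcd).ne
    · simp
    · rcases lt_trichotomy c d with hcd | rfl | hcd
      · have := h_mul b a c d hab hcd
        rw [add_comm (b * d), add_comm (b * c)] at this
        exact absurd key this.ne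
      · simp
      · have := h_mul b a d c hab hcd
        rw [add_comm (b * d), add_comm (b * c)] at this
        exact absurd key this.ne'
  have : IsDomain Z := NoZeroDivisors.to_isDomain Z
  let P : Subsemiring Z :=
    { carrier := {x | ∃ a b, b ≤ a ∧ x = f a - f b}
      zero_mem' := ⟨0, 0, le_rfl, by simp⟩
      -- If `1 < 0`, then `h_mul` applied to this inequality twice gives `0 < 1`.
      one_mem' := ⟨1, 0, by
        by_contra h
        have := h_mul 1 0 1 0 (not_le.1 h) (not_le.1 h)
        simp only [mul_zero, add_zero, mul_one] at this
        exact h this.le, by simp⟩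
      add_mem' := by
        rintro x y ⟨a, b, h, rfl⟩ ⟨c, d, h', rfl⟩
        refine ⟨a + c, b + d, ?_, by simp only [map_add]; ring⟩
        refine ((h_add _ _ d).2 h).trans ?_
        rw [add_comm a, add_comm a]
        exact (h_add _ _ a).2 h'
      mul_mem' := by
        rintro x y ⟨a, b, h, rfl⟩ ⟨c, d, h', rfl⟩
        refine ⟨b * d + a * c, b * c + a * d, h_mul' _ _ _ _ h h', ?_⟩
        simp only [map_add, map_mul]
        ring }
  have mem_P : ∀ a b, f a - f b ∈ P ↔ b ≤ a := by
    refine fun a b => ⟨?_, fun h => ⟨a, b, h, rfl⟩⟩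
    rintro ⟨c, d, h, h'⟩
    have : a + d = b + c := inj (by simp only [map_add]; linear_combination h')
    refine (h_add _ _ d).1 ?_
    rw [this, add_comm b, add_comm b]
    exact (h_add _ _ b).2 h
  obtain ⟨L, hL, h⟩ := exists_linearOrder P
    (by
      intro x hx hx'
      obtain ⟨a, b, rfl⟩ := surj x
      rw [neg_sub] at hx'
      rw [le_antisymm ((mem_P _ _).1 hx') ((mem_P _ _).1 hx), sub_self])
    (by
      intro x
      obtain ⟨a, b, rfl⟩ := surj x
      rw [neg_sub, mem_P, mem_P]
      exact le_total b a)
  obtain ⟨K, iK, lK, sK, g, hg⟩ := exists_fraction_field Z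
  refine ⟨K, iK, lK, sK, g.comp f, fun a b => ?_⟩
  rw [← sub_nonneg, RingHom.comp_apply, RingHom.comp_apply, ← map_sub, hg, h, mem_P]

end OrderedField

end BISH

/-! ### Peano arithmetic inside the forcing semantics -/

namespace BISH

open Srt Tm

/-! ### Arithmetic -/

namespace Om

/-- `a ≤ b` for natural numbers. -/
def leN (a b : PTm nat) : Om := ex fun z => eq (a.add z) b

/-- `a < b` for natural numbers. -/
def ltN (a b : PTm nat) : Om := leN a.succ b

end Om

section Arithmetic

variable {p : World} {a b c d : PTm nat}

theorem nat_succ_ne_zero (h : p ⊩ Om.eq a.succ PTm.zero) : p ⊩ Om.bot :=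
  forces_sentence (p := p) Ax.succ_ne_zero (fun _ => Ax.succ_ne_zero) a h

theorem nat_succ_inj (h : p ⊩ Om.eq a.succ b.succ) : p ⊩ Om.eq a b :=
  forces_sentence (p := p) Ax.succ_inj (fun _ => Ax.succ_inj) a b h

theorem nat_add_zero (a : PTm nat) : p ⊩ Om.eq (a.add PTm.zero) a :=
  forces_sentence (p := p) Ax.add_zero (fun _ => Ax.add_zero) a

theorem nat_add_succ (a b : PTm nat) : p ⊩ Om.eq (a.add b.succ) (a.add b).succ :=
  forces_sentence (p := p) Ax.add_succ (fun _ => Ax.add_succ) a b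

theorem nat_mul_zero (a : PTm nat) : p ⊩ Om.eq (a.mul PTm.zero) PTm.zero :=
  forces_sentence (p := p) Ax.mul_zero (fun _ => Ax.mul_zero) a

theorem nat_mul_succ (a b : PTm nat) : p ⊩ Om.eq (a.mul b.succ) ((a.mul b).add a) :=
  forces_sentence (p := p) Ax.mul_succ (fun _ => Ax.mul_succ) a b

theorem succ_congr (h : p ⊩ Om.eq a b) : p ⊩ Om.eq a.succ b.succ :=
  eq_congr (succ v0) Env.nil h

theorem add_congr (h : p ⊩ Om.eq a b) (h' : p ⊩ Om.eq c d) : p ⊩ Om.eq (a.add c) (b.add d) :=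
  eq_trans (eq_congr (add v0 v1) (c ;; Env.nil) h) (eq_congr (add v1 v0) (b ;; Env.nil) h')

theorem mul_congr (h : p ⊩ Om.eq a b) (h' : p ⊩ Om.eq c d) : p ⊩ Om.eq (a.mul c) (b.mul d) :=
  eq_trans (eq_congr (mul v0 v1) (c ;; Env.nil) h) (eq_congr (mul v1 v0) (b ;; Env.nil) h')

theorem nat_zero_add (a : PTm nat) : p ⊩ Om.eq (PTm.zero.add a) a :=
  induction (add zero v0 ≐ v0) Env.nil (nat_add_zero _)
    (fun _ _ _ h => eq_trans (nat_add_succ _ _) (succ_congr h)) a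

theorem nat_succ_add (a b : PTm nat) : p ⊩ Om.eq (a.succ.add b) (a.add b).succ :=
  induction (add (succ v1) v0 ≐ succ (add v1 v0)) (a ;; Env.nil)
    (eq_trans (nat_add_zero _) (succ_congr (eq_symm (nat_add_zero a))))
    (fun _ _ _ h => eq_trans (nat_add_succ _ _)
      (succ_congr (eq_trans h (eq_symm (nat_add_succ _ _))))) b

theorem nat_add_comm (a b : PTm nat) : p ⊩ Om.eq (a.add b) (b.add a) :=
  induction (add v0 v1 ≐ add v1 v0) (b ;; Env.nil)
    (eq_trans (nat_zero_add b) (eq_symm (nat_add_zero b)))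
    (fun _ _ _ h => eq_trans (nat_succ_add _ _)
      (eq_trans (succ_congr h) (eq_symm (nat_add_succ _ _)))) a

theorem nat_add_assoc (a b c : PTm nat) : p ⊩ Om.eq ((a.add b).add c) (a.add (b.add c)) :=
  induction (add (add v1 v2) v0 ≐ add v1 (add v2 v0)) (a ;; b ;; Env.nil)
    (eq_trans (nat_add_zero _) (add_congr (eq_refl a) (eq_symm (nat_add_zero b))))
    (fun _ _ _ h => eq_trans (nat_add_succ _ _) (eq_trans (succ_congr h)
      (eq_trans (eq_symm (nat_add_succ _ _)) (add_congr (eq_refl a) (eq_symm (nat_add_succ _ _))))))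
    c

theorem nat_add_right_comm (a b c : PTm nat) :
    p ⊩ Om.eq ((a.add b).add c) ((a.add c).add b) :=
  eq_trans (nat_add_assoc _ _ _)
    (eq_trans (add_congr (eq_refl a) (nat_add_comm b c)) (eq_symm (nat_add_assoc _ _ _)))

theorem nat_zero_mul (a : PTm nat) : p ⊩ Om.eq (PTm.zero.mul a) PTm.zero :=
  induction (mul zero v0 ≐ zero) Env.nil (nat_mul_zero _)
    (fun _ _ _ h => eq_trans (nat_mul_succ _ _) (eq_trans (nat_add_zero _) h)) a

theorem nat_succ_mul (a b : PTm nat) : p ⊩ Om.eq (a.succ.mul b) ((a.mul b).add b) :=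
  induction (mul (succ v1) v0 ≐ add (mul v1 v0) v0) (a ;; Env.nil)
    (eq_trans (nat_mul_zero _) (eq_symm (eq_trans (nat_add_zero _) (nat_mul_zero _))))
    (fun _ _ _ h => eq_trans (nat_mul_succ _ _) (eq_trans (nat_add_succ _ _)
      (eq_trans (succ_congr (eq_trans (add_congr h (eq_refl a)) (nat_add_right_comm _ _ _)))
        (eq_trans (eq_symm (nat_add_succ _ _))
          (add_congr (eq_symm (nat_mul_succ _ _)) (eq_refl _)))))) b

theorem nat_mul_comm (a b : PTm nat) : p ⊩ Om.eq (a.mul b) (b.mul a) :=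
  induction (mul v0 v1 ≐ mul v1 v0) (b ;; Env.nil)
    (eq_trans (nat_zero_mul b) (eq_symm (nat_mul_zero b)))
    (fun _ _ _ h => eq_trans (nat_succ_mul _ _)
      (eq_trans (add_congr h (eq_refl _)) (eq_symm (nat_mul_succ _ _)))) a

theorem nat_mul_add (a b c : PTm nat) : p ⊩ Om.eq (a.mul (b.add c)) ((a.mul b).add (a.mul c)) :=
  induction (mul v1 (add v2 v0) ≐ add (mul v1 v2) (mul v1 v0)) (a ;; b ;; Env.nil)
    (eq_trans (mul_congr (eq_refl a) (nat_add_zero b))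
      (eq_symm (eq_trans (add_congr (eq_refl _) (nat_mul_zero a)) (nat_add_zero _))))
    (fun _ _ _ h => eq_trans (mul_congr (eq_refl a) (nat_add_succ _ _))
      (eq_trans (nat_mul_succ _ _) (eq_trans (add_congr h (eq_refl a)) (eq_trans
        (nat_add_assoc _ _ _) (add_congr (eq_refl _) (eq_symm (nat_mul_succ _ _))))))) c

theorem nat_mul_assoc (a b c : PTm nat) : p ⊩ Om.eq ((a.mul b).mul c) (a.mul (b.mul c)) :=
  induction (mul (mul v1 v2) v0 ≐ mul v1 (mul v2 v0)) (a ;; b ;; Env.nil)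
    (eq_trans (nat_mul_zero _) (eq_symm (eq_trans (mul_congr (eq_refl a) (nat_mul_zero b))
      (nat_mul_zero a))))
    (fun _ _ _ h => eq_trans (nat_mul_succ _ _) (eq_trans (add_congr h (eq_refl _))
      (eq_trans (eq_symm (nat_mul_add _ _ _)) (mul_congr (eq_refl a) (eq_symm (nat_mul_succ _ _))))))
    c

/-- A congruence on closed numerical terms that contains the true equations. -/
structure NatCon where
  /-- The relation. -/
  r : PTm nat → PTm nat → Prop
  of : ∀ {a b : PTm nat}, (∀ q, q ⊩ Om.eq a b) → r a b
  symm : ∀ {a b : PTm nat}, r a b → r b a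
  trans : ∀ {a b c : PTm nat}, r a b → r b c → r a c
  add : ∀ {a b c d : PTm nat}, r a b → r c d → r (a.add c) (b.add d)
  mul : ∀ {a b c d : PTm nat}, r a b → r c d → r (a.mul c) (b.mul d)

/-- The setoid of a congruence. -/
def NatCon.setoid (R : NatCon) : Setoid (PTm nat) :=
  ⟨R.r, fun _ => R.of fun _ => eq_refl _, R.symm, R.trans⟩

/-- The numbers modulo a congruence. -/
def NatCon.Quo (R : NatCon) : Type := Quotient R.setoid

/-- The class of a number. -/
def NatCon.cls (R : NatCon) (a : PTm nat) : R.Quo := Quotient.mk R.setoid a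

theorem NatCon.cls_eq (R : NatCon) : R.cls a = R.cls b ↔ R.r a b := Quotient.eq (r := R.setoid)

theorem NatCon.cls_eq_of (R : NatCon) (h : ∀ q, q ⊩ Om.eq a b) : R.cls a = R.cls b :=
  R.cls_eq.2 (R.of h)

theorem NatCon.cls_surj (R : NatCon) (x : R.Quo) : ∃ a, R.cls a = x := Quotient.exists_rep x

instance (R : NatCon) : Zero R.Quo := ⟨R.cls PTm.zero⟩
instance (R : NatCon) : One R.Quo := ⟨R.cls PTm.zero.succ⟩
instance (R : NatCon) : Add R.Quo := ⟨Quotient.map₂ PTm.add fun _ _ h _ _ h' => R.add h h'⟩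
instance (R : NatCon) : Mul R.Quo := ⟨Quotient.map₂ PTm.mul fun _ _ h _ _ h' => R.mul h h'⟩

@[simp] theorem NatCon.cls_zero (R : NatCon) : R.cls PTm.zero = 0 := rfl
@[simp] theorem NatCon.cls_add (R : NatCon) : R.cls (a.add b) = R.cls a + R.cls b := rfl
@[simp] theorem NatCon.cls_mul (R : NatCon) : R.cls (a.mul b) = R.cls a * R.cls b := rfl
@[simp] theorem NatCon.cls_succ (R : NatCon) : R.cls a.succ = R.cls a + 1 :=
  R.cls_eq_of (b := a.add PTm.zero.succ)
    fun _ => eq_symm (eq_trans (nat_add_succ _ _) (succ_congr (nat_add_zero _)))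

instance (R : NatCon) : CommSemiring R.Quo where
  add_assoc := by
    intro x y z
    obtain ⟨a, rfl⟩ := R.cls_surj x
    obtain ⟨b, rfl⟩ := R.cls_surj y
    obtain ⟨c, rfl⟩ := R.cls_surj z
    exact R.cls_eq_of fun _ => nat_add_assoc a b c
  zero_add := by
    intro x
    obtain ⟨a, rfl⟩ := R.cls_surj x
    exact R.cls_eq_of fun _ => nat_zero_add a
  add_zero := by
    intro x
    obtain ⟨a, rfl⟩ := R.cls_surj x
    exact R.cls_eq_of fun _ => nat_add_zero a
  add_comm := by
    intro x y
    obtain ⟨a, rfl⟩ := R.cls_surj x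
    obtain ⟨b, rfl⟩ := R.cls_surj y
    exact R.cls_eq_of fun _ => nat_add_comm a b
  nsmul := nsmulRec
  left_distrib := by
    intro x y z
    obtain ⟨a, rfl⟩ := R.cls_surj x
    obtain ⟨b, rfl⟩ := R.cls_surj y
    obtain ⟨c, rfl⟩ := R.cls_surj z
    exact R.cls_eq_of fun _ => nat_mul_add a b c
  right_distrib := by
    intro x y z
    obtain ⟨a, rfl⟩ := R.cls_surj x
    obtain ⟨b, rfl⟩ := R.cls_surj y
    obtain ⟨c, rfl⟩ := R.cls_surj z
    exact R.cls_eq_of fun _ => eq_trans (nat_mul_comm _ _) (eq_trans (nat_mul_add _ _ _)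
      (add_congr (nat_mul_comm _ _) (nat_mul_comm _ _)))
  zero_mul := by
    intro x
    obtain ⟨a, rfl⟩ := R.cls_surj x
    exact R.cls_eq_of fun _ => nat_zero_mul a
  mul_zero := by
    intro x
    obtain ⟨a, rfl⟩ := R.cls_surj x
    exact R.cls_eq_of fun _ => nat_mul_zero a
  mul_assoc := by
    intro x y z
    obtain ⟨a, rfl⟩ := R.cls_surj x
    obtain ⟨b, rfl⟩ := R.cls_surj y
    obtain ⟨c, rfl⟩ := R.cls_surj z
    exact R.cls_eq_of fun _ => nat_mul_assoc a b c
  one_mul := by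
    intro x
    obtain ⟨a, rfl⟩ := R.cls_surj x
    exact R.cls_eq_of fun _ => eq_trans (nat_succ_mul _ _)
      (eq_trans (add_congr (nat_zero_mul a) (eq_refl a)) (nat_zero_add a))
  mul_one := by
    intro x
    obtain ⟨a, rfl⟩ := R.cls_surj x
    exact R.cls_eq_of fun _ => eq_trans (nat_mul_succ _ _)
      (eq_trans (add_congr (nat_mul_zero a) (eq_refl a)) (nat_zero_add a))
  mul_comm := by
    intro x y
    obtain ⟨a, rfl⟩ := R.cls_surj x
    obtain ⟨b, rfl⟩ := R.cls_surj y
    exact R.cls_eq_of fun _ => nat_mul_comm a b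

/-- Equality in the world `p`. -/
def World.natCon (p : World) : NatCon where
  r a b := p ⊩ Om.eq a b
  of h := h p
  symm := eq_symm
  trans := eq_trans
  add := add_congr
  mul := mul_congr

theorem eq_iff_cls : (p ⊩ Om.eq a b) ↔ p.natCon.cls a = p.natCon.cls b := p.natCon.cls_eq.symm

/-! ### Order -/

theorem nat_cases (a : PTm nat) :
    p ⊩ (Om.eq a PTm.zero).or (Om.ex fun b => Om.eq a b.succ) :=
  induction ((v0 ≐ zero) ⩔ Fm.ex nat (v1 ≐ succ v0)) Env.nil (orI₁ (eq_refl _))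
    (fun n _ _ _ => orI₂ (exI n (eq_refl _))) a

theorem nat_add_right_cancel (h : p ⊩ Om.eq (a.add c) (b.add c)) : p ⊩ Om.eq a b := by
  have : p ⊩ (Om.eq (a.add c) (b.add c)).imp (Om.eq a b) := by
    refine induction ((add v1 v0 ≐ add v2 v0) ⇾ (v1 ≐ v2)) (a ;; b ;; Env.nil) ?_ ?_ c
    · intro q _ h
      exact eq_trans (eq_symm (nat_add_zero a)) (eq_trans h (nat_add_zero b))
    · intro n q _ ih r _ h
      exact ih (nat_succ_inj (eq_trans (eq_symm (nat_add_succ _ _))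
        (eq_trans h (nat_add_succ _ _))))
  exact this h

theorem nat_add_left_cancel (h : p ⊩ Om.eq (a.add b) (a.add c)) : p ⊩ Om.eq b c :=
  nat_add_right_cancel (c := a) <| by
    rw [eq_iff_cls] at h ⊢
    simp only [NatCon.cls_add] at h ⊢
    rw [add_comm, h, add_comm]

theorem nat_le_refl (a : PTm nat) : p ⊩ Om.leN a a := exI PTm.zero (nat_add_zero a)

theorem nat_le_of_eq (h : p ⊩ Om.eq a b) : p ⊩ Om.leN a b :=
  exI PTm.zero (eq_trans (nat_add_zero a) h)

theorem nat_le_trans (h : p ⊩ Om.leN a b) (h' : p ⊩ Om.leN b c) : p ⊩ Om.leN a c :=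
  exE h fun x _ _ hx => exE h'.up fun y r _ hy => exI (x.add y) <| by
    have hx := hx.up (q := r)
    rw [eq_iff_cls] at hx hy ⊢
    simp only [NatCon.cls_add] at hx hy ⊢
    rw [← hy, ← hx, add_assoc]

theorem nat_zero_le (a : PTm nat) : p ⊩ Om.leN PTm.zero a := exI a (nat_zero_add a)

theorem nat_not_lt_self (h : p ⊩ Om.ltN a a) : p ⊩ Om.bot :=
  exE h fun x q _ hx => nat_succ_ne_zero (a := x) <| nat_add_left_cancel (a := a) <| by
    rw [eq_iff_cls] at hx ⊢
    simp only [NatCon.cls_add, NatCon.cls_succ, NatCon.cls_zero] at hx ⊢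
    rw [add_zero, ← add_assoc, add_right_comm, hx]

/-- The order of `ℕ` is decidable, by induction on `a`. Case distinctions on numbers in the later
arguments rest on this instead of excluded middle. -/
theorem nat_le_total (a b : PTm nat) : p ⊩ (Om.leN a b).or (Om.ltN b a) := by
  have step : ∀ (n : PTm nat) (q : World) [Le q p], (q ⊩ (Om.leN n b).or (Om.ltN b n)) →
      (q ⊩ (Om.leN n.succ b).or (Om.ltN b n.succ)) := by
    intro n q _ h
    refine orE h (fun r _ h => exE h fun z r _ hz => ?_) fun r _ h => exE h fun z r _ hz => ?_
    · refine orE (nat_cases z) (fun r' _ h => orI₂ (nat_le_of_eq ?_))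
        fun r' _ h => exE h fun w r'' _ hw => orI₁ (exI w ?_)
      · have hz := eq_iff_cls.1 (hz.up (q := r'))
        rw [eq_iff_cls] at h ⊢
        simp only [NatCon.cls_succ, NatCon.cls_add, NatCon.cls_zero] at hz h ⊢
        rw [← hz, h, add_zero]
      · have hz := eq_iff_cls.1 (hz.up (q := r''))
        rw [eq_iff_cls] at hw ⊢
        simp only [NatCon.cls_succ, NatCon.cls_add] at hz hw ⊢
        rw [← hz, hw]
        ring
    · refine orI₂ (exI z.succ ?_)
      rw [eq_iff_cls] at hz ⊢
      simp only [NatCon.cls_succ, NatCon.cls_add] at hz ⊢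
      rw [← hz]
      ring
  exact induction (leN v0 v1 ⩔ ltN v1 v0) (b ;; Env.nil) (orI₁ (nat_zero_le b)) step a

theorem nat_le_antisymm (h : p ⊩ Om.leN a b) (h' : p ⊩ Om.leN b a) : p ⊩ Om.eq a b := by
  refine exE h fun z q _ hz => orE (nat_cases z) (fun r _ hr => ?_) fun r _ hr => ?_
  · exact eq_trans (eq_symm (nat_add_zero a)) (eq_trans (add_congr (eq_refl a) (eq_symm hr)) hz.up)
  · refine exE hr fun w r' _ hw => botE (nat_not_lt_self (a := a)
      (nat_le_trans (exI w ?_) h'.up))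
    have hz := eq_iff_cls.1 (hz.up (q := r'))
    have hw := eq_iff_cls.1 hw
    refine eq_iff_cls.2 (Eq.trans ?_ hz)
    simp only [NatCon.cls_add, hw, NatCon.cls_succ]
    ring

theorem nat_add_le_add_iff : (p ⊩ Om.leN (a.add c) (b.add c)) ↔ (p ⊩ Om.leN a b) := by
  constructor
  · refine fun h => exE h fun z q _ hz => exI z (nat_add_right_cancel (c := c) ?_)
    exact eq_trans (nat_add_right_comm a z c) hz
  · refine fun h => exE h fun z q _ hz => exI z ?_
    exact eq_trans (nat_add_right_comm a c z) (add_congr hz (eq_refl c))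

theorem nat_mul_lt_mul (h : p ⊩ Om.ltN a b) (h' : p ⊩ Om.ltN c d) :
    p ⊩ Om.ltN ((a.mul d).add (b.mul c)) ((a.mul c).add (b.mul d)) := by
  -- With `b = a + 1 + x` and `d = c + 1 + y` the two sides differ by `(x + 1) (y + 1)`, which is
  -- one more than the witness.
  refine exE h fun x q _ hx => exE h'.up fun y r _ hy => exI ((x.mul y).add (x.add y)) ?_
  have hx := eq_iff_cls.1 (hx.up (q := r))
  have hy := eq_iff_cls.1 hy
  refine eq_iff_cls.2 ?_
  simp only [NatCon.cls_add, NatCon.cls_mul, NatCon.cls_succ] at hx hy ⊢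
  rw [← hx, ← hy]
  ring

end Arithmetic

end BISH

/-! ### Classical evaluation of arithmetic at prime ideals -/

namespace BISH

open Srt Tm

/-! ### Prime ideals of truth values -/

instance : DistribLattice Om where
  le A B := ∀ p, (p ⊩ A) → (p ⊩ B)
  le_refl _ _ h := h
  le_trans _ _ _ h h' p hp := h' p (h p hp)
  le_antisymm _ _ h h' := Om.ext fun p => ⟨h p, h' p⟩
  sup := Om.or
  inf := Om.and
  le_sup_left _ _ _ h := orI₁ h
  le_sup_right _ _ _ h := orI₂ h
  sup_le _ _ _ h h' _ hp := orE hp (fun q _ => h q) fun q _ => h' q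
  inf_le_left _ _ _ h := h.1
  inf_le_right _ _ _ h := h.2
  le_inf _ _ _ h h' p hp := ⟨h p hp, h' p hp⟩
  le_sup_inf _ _ _ _ hp := orE hp.1 (fun _ _ h => orI₁ h) fun _ _ h =>
    orE hp.2.up (fun _ _ h' => orI₁ h') fun _ _ h' => orI₂ ⟨h.up, h'⟩

/-- A prime ideal of truth values, none of which is true in the world `p`. -/
structure Prime (p : World) where
  /-- The ideal. -/
  ideal : Order.Ideal Om
  prime : ideal.IsPrime
  notMem : ∀ {A : Om}, (p ⊩ A) → A ∉ ideal

section Prime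

variable {p : World} {A B C : Om}

/-- `A` is true at the prime ideal `Q`. -/
def Prime.Sat (Q : Prime p) (A : Om) : Prop := A ∉ Q.ideal

theorem Prime.sat_of_forces (Q : Prime p) (h : p ⊩ A) : Q.Sat A := Q.notMem h

theorem Prime.sat_or (Q : Prime p) : Q.Sat (A.or B) ↔ Q.Sat A ∨ Q.Sat B := by
  have : A.or B ∈ Q.ideal ↔ A ∈ Q.ideal ∧ B ∈ Q.ideal := Order.Ideal.sup_mem_iff
  unfold Prime.Sat
  tauto

theorem Prime.sat_and (Q : Prime p) : Q.Sat (A.and B) ↔ Q.Sat A ∧ Q.Sat B := by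
  have h₁ : A.and B ∈ Q.ideal → A ∈ Q.ideal ∨ B ∈ Q.ideal := fun h => Q.prime.mem_or_mem h
  have h₂ : A ∈ Q.ideal → A.and B ∈ Q.ideal :=
    fun h => Q.ideal.lower (a := A) (b := A.and B) (fun _ h => h.1) h
  have h₃ : B ∈ Q.ideal → A.and B ∈ Q.ideal :=
    fun h => Q.ideal.lower (a := B) (b := A.and B) (fun _ h => h.2) h
  unfold Prime.Sat
  tauto

theorem Prime.sat_mono (Q : Prime p) (h : ∀ (q : World) [Le q p], (q ⊩ A) → (q ⊩ B))
    (hA : Q.Sat A) : Q.Sat B := by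
  -- Implications are not evaluated at `Q`. One that is forced in `p` lies outside the ideal, and
  -- primeness turns it into modus ponens.
  have h₁ : Q.Sat ((A.imp B).and A) := Q.sat_and.2 ⟨Q.sat_of_forces fun q _ => h q, hA⟩
  exact fun hB => h₁ (Q.ideal.lower (a := B) (fun q hq => hq.1 hq.2) hB)

theorem Prime.sat_mono₂ (Q : Prime p) (h : ∀ (q : World) [Le q p], (q ⊩ A) → (q ⊩ B) → (q ⊩ C))
    (hA : Q.Sat A) (hB : Q.Sat B) : Q.Sat C :=
  Q.sat_mono (A := A.and B) (fun q _ hq => h q hq.1 hq.2) (Q.sat_and.2 ⟨hA, hB⟩)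

theorem Prime.not_sat_bot (Q : Prime p) : ¬Q.Sat Om.bot := by
  obtain ⟨X, hX⟩ := Q.ideal.nonempty
  exact fun h => h (Q.ideal.lower (a := X) (fun _ hq => botE hq) hX)

/-- The prime ideal theorem for distributive lattices: if `A` is not forced in `p`, the filter of
truth values forced in `p` is disjoint from the principal ideal of `A`, and a prime ideal containing
`A` and disjoint from the filter refutes the hypothesis. -/
theorem forces_of_prime (h : ∀ Q : Prime p, Q.Sat A) : p ⊩ A := by
  by_contra hA
  have hF : Order.IsPFilter {B : Om | p ⊩ B} := by
    refine Order.IsPFilter.of_def ⟨Om.bot.imp Om.bot, fun q _ h => h⟩ ?_ ?_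
    · exact fun B hB C hC => ⟨B.and C, ⟨hB, hC⟩, fun _ h => h.1, fun _ h => h.2⟩
    · exact fun hBC hB => hBC p hB
  obtain ⟨J, hJ, hle, hdisj⟩ := DistribLattice.prime_ideal_of_disjoint_filter_ideal
    (F := hF.toPFilter) (I := Order.Ideal.principal A)
    (Set.disjoint_left.2 fun B (hB : p ⊩ B) (hB' : B ≤ A) => hA (hB' p hB))
  refine h ⟨J, hJ, fun {B} hB => Set.disjoint_left.1 hdisj hB⟩ (hle ?_)
  exact le_refl A

end Prime

/-! ### Numbers at a prime ideal -/

section Numbers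

variable {p : World} (Q : Prime p) {a b c d : PTm nat}

/-- Equality at a prime ideal. -/
def Prime.natCon : NatCon where
  r a b := Q.Sat (Om.eq a b)
  of h := Q.sat_of_forces (h p)
  symm := Q.sat_mono fun _ _ => eq_symm
  trans := Q.sat_mono₂ fun _ _ => eq_trans
  add := Q.sat_mono₂ fun _ _ => add_congr
  mul := Q.sat_mono₂ fun _ _ => mul_congr

open Classical in
noncomputable instance : LinearOrder Q.natCon.Quo where
  le := Quotient.lift₂ (fun a b => Q.Sat (Om.leN a b)) (by
    intro a b c d (h : Q.Sat _) (h' : Q.Sat _)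
    refine propext ⟨fun hab => ?_, fun hcd => ?_⟩
    · exact Q.sat_mono₂ (fun q _ h₁ h₂ => nat_le_trans (nat_le_of_eq (eq_symm h₁)) h₂) h
        (Q.sat_mono₂ (fun q _ h₁ h₂ => nat_le_trans h₂ (nat_le_of_eq h₁)) h' hab)
    · exact Q.sat_mono₂ (fun q _ h₁ h₂ => nat_le_trans (nat_le_of_eq h₁) h₂) h
        (Q.sat_mono₂ (fun q _ h₁ h₂ => nat_le_trans h₂ (nat_le_of_eq (eq_symm h₁))) h' hcd))
  le_refl x := by
    obtain ⟨a, rfl⟩ := Q.natCon.cls_surj x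
    exact Q.sat_of_forces (nat_le_refl a)
  le_trans x y z := by
    obtain ⟨a, rfl⟩ := Q.natCon.cls_surj x
    obtain ⟨b, rfl⟩ := Q.natCon.cls_surj y
    obtain ⟨c, rfl⟩ := Q.natCon.cls_surj z
    exact Q.sat_mono₂ fun q _ => nat_le_trans
  le_antisymm x y := by
    obtain ⟨a, rfl⟩ := Q.natCon.cls_surj x
    obtain ⟨b, rfl⟩ := Q.natCon.cls_surj y
    exact fun h h' => Q.natCon.cls_eq.2 (Q.sat_mono₂ (fun q _ => nat_le_antisymm) h h')
  le_total x y := by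
    obtain ⟨a, rfl⟩ := Q.natCon.cls_surj x
    obtain ⟨b, rfl⟩ := Q.natCon.cls_surj y
    refine (Q.sat_or.1 (Q.sat_of_forces (nat_le_total a b))).imp id fun h => ?_
    exact Q.sat_mono (fun q _ h => nat_le_trans (exI PTm.zero.succ
      (eq_trans (nat_add_succ _ _) (succ_congr (nat_add_zero b)))) h) h
  toDecidableLE := Classical.decRel _

theorem Prime.cls_le : Q.natCon.cls a ≤ Q.natCon.cls b ↔ Q.Sat (Om.leN a b) := Iff.rfl

theorem Prime.cls_lt : Q.natCon.cls a < Q.natCon.cls b ↔ Q.Sat (Om.ltN a b) := by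
  rw [← not_le, Prime.cls_le]
  constructor
  · intro h
    exact (Q.sat_or.1 (Q.sat_of_forces (nat_le_total b a))).resolve_left h
  · intro h h'
    exact Q.not_sat_bot (Q.sat_mono₂ (fun q _ h h' => nat_not_lt_self (nat_le_trans h h')) h h')

/-- A model of arithmetic in an ordered field, in which everything that is true in the world `p`
holds. -/
structure Model (p : World) where
  /-- The prime ideal of the truth values that fail. -/
  Q : Prime p
  /-- The field. -/
  K : Type
  [field : Field K]
  [linearOrder : LinearOrder K]
  [ordered : IsStrictOrderedRing K]
  /-- The value of a number. -/
  ν : PTm nat → K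
  ν_zero : ν PTm.zero = 0
  ν_succ : ∀ a, ν a.succ = ν a + 1
  ν_add : ∀ a b, ν (a.add b) = ν a + ν b
  ν_mul : ∀ a b, ν (a.mul b) = ν a * ν b
  sat_le : ∀ {a b}, Q.Sat (Om.leN a b) ↔ ν a ≤ ν b
  sat_eq : ∀ {a b}, Q.Sat (Om.eq a b) ↔ ν a = ν b

attribute [instance] Model.field Model.linearOrder Model.ordered
attribute [simp] Model.ν_zero Model.ν_succ Model.ν_add Model.ν_mul

/-- At a prime ideal the decidable order of `ℕ` becomes a linear order, so the numbers modulo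
equality form a linearly ordered semiring to which `exists_ordered_field` applies. -/
theorem exists_model : ∃ M : Model p, M.Q = Q := by
  obtain ⟨K, _, _, _, f, hf⟩ := exists_ordered_field Q.natCon.Quo
    (by
      intro x y z
      obtain ⟨a, rfl⟩ := Q.natCon.cls_surj x
      obtain ⟨b, rfl⟩ := Q.natCon.cls_surj y
      obtain ⟨c, rfl⟩ := Q.natCon.cls_surj z
      exact ⟨Q.sat_mono fun q _ => nat_add_le_add_iff.1, Q.sat_mono fun q _ => nat_add_le_add_iff.2⟩)
    (by
      intro x y z w
      obtain ⟨a, rfl⟩ := Q.natCon.cls_surj x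
      obtain ⟨b, rfl⟩ := Q.natCon.cls_surj y
      obtain ⟨c, rfl⟩ := Q.natCon.cls_surj z
      obtain ⟨d, rfl⟩ := Q.natCon.cls_surj w
      simp only [← NatCon.cls_mul, ← NatCon.cls_add, Prime.cls_lt]
      exact Q.sat_mono₂ fun q _ => nat_mul_lt_mul)
    (fun h => Q.not_sat_bot (Q.sat_mono (fun q _ h => nat_succ_ne_zero (eq_symm h))
      (Q.natCon.cls_eq.1 h)))
  refine ⟨⟨Q, K, fun a => f (Q.natCon.cls a), by simp, by simp, by simp, by simp, ?_, ?_⟩, rfl⟩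
  · intro a b
    rw [hf, Prime.cls_le]
  · intro a b
    constructor
    · intro h
      rw [Q.natCon.cls_eq.2 h]
    · intro h
      exact Q.natCon.cls_eq.1 (le_antisymm ((hf _ _).1 h.le) ((hf _ _).1 h.ge))

theorem forces_of_model {A : Om} (h : ∀ M : Model p, M.Q.Sat A) : p ⊩ A :=
  forces_of_prime fun Q => by
    obtain ⟨M, rfl⟩ := exists_model Q
    exact h M

namespace Model

variable (M : Model p)

theorem le (h : p ⊩ Om.leN a b) : M.ν a ≤ M.ν b := M.sat_le.1 (M.Q.sat_of_forces h)

theorem eq (h : p ⊩ Om.eq a b) : M.ν a = M.ν b := M.sat_eq.1 (M.Q.sat_of_forces h)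

theorem sat_lt : M.Q.Sat (Om.ltN a b) ↔ M.ν a + 1 ≤ M.ν b := by
  rw [Om.ltN, M.sat_le, M.ν_succ]

theorem lt (h : p ⊩ Om.ltN a b) : M.ν a + 1 ≤ M.ν b := M.sat_lt.1 (M.Q.sat_of_forces h)

/-- Discreteness is not a property of the field `K`. It holds for values of numbers because it is
derivable in arithmetic. -/
theorem add_one_le (h : M.ν a < M.ν b) : M.ν a + 1 ≤ M.ν b := by
  rcases M.Q.sat_or.1 (M.Q.sat_of_forces (nat_le_total b a)) with h' | h'
  · exact absurd (M.sat_le.1 h') (not_le.2 h)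
  · exact M.sat_lt.1 h'

theorem le_or_lt (a b : PTm nat) : M.ν a ≤ M.ν b ∨ M.ν b + 1 ≤ M.ν a := by
  rcases le_or_gt (M.ν a) (M.ν b) with h | h
  · exact Or.inl h
  · exact Or.inr (M.add_one_le h)

theorem nonneg (a : PTm nat) : 0 ≤ M.ν a := by
  have := M.le (nat_zero_le a)
  rwa [M.ν_zero] at this

end Model

theorem le_of_model (h : ∀ M : Model p, M.ν a ≤ M.ν b) : p ⊩ Om.leN a b :=
  forces_of_model fun M => M.sat_le.2 (h M)

theorem lt_of_model (h : ∀ M : Model p, M.ν a < M.ν b) : p ⊩ Om.ltN a b :=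
  forces_of_model fun M => M.sat_lt.2 (M.add_one_le (h M))

theorem eq_of_model (h : ∀ M : Model p, M.ν a = M.ν b) : p ⊩ Om.eq a b :=
  forces_of_model fun M => M.sat_eq.2 (h M)

theorem bot_of_model (h : ∀ _ : Model p, False) : p ⊩ Om.bot :=
  forces_of_model fun M => (h M).elim

theorem nat_eq_or_lt_or_gt (a b : PTm nat) :
    p ⊩ (Om.eq a b).or ((Om.ltN a b).or (Om.ltN b a)) :=
  forces_of_model fun M => by
    rw [M.Q.sat_or, M.Q.sat_or, M.sat_eq, M.sat_lt, M.sat_lt]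
    rcases lt_trichotomy (M.ν a) (M.ν b) with h | h | h
    · exact Or.inr (Or.inl (M.add_one_le h))
    · exact Or.inl h
    · exact Or.inr (Or.inr (M.add_one_le h))

end Numbers

/-! ### Rational numbers -/

namespace Om

/-- `p < q` for rationals. -/
def ltQ (p q : PTm rat) : Om :=
  ltN
    (((p.fst.fst.mul q.snd.succ)).add (q.fst.snd.mul p.snd.succ))
    (((q.fst.fst.mul p.snd.succ)).add (p.fst.snd.mul q.snd.succ))

end Om

namespace PTm

/-- The rational `0`. -/
def zeroQ : PTm rat := ((PTm.zero.pair PTm.zero).pair PTm.zero)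

/-- The sum of two rationals. -/
def addQ (p q : PTm rat) : PTm rat :=
  PTm.pair
    (PTm.pair
      ((p.fst.fst.mul q.snd.succ).add (q.fst.fst.mul p.snd.succ))
      ((p.fst.snd.mul q.snd.succ).add (q.fst.snd.mul p.snd.succ)))
    ((p.snd.mul q.snd).add (p.snd.add q.snd))

/-- The rational `a / (n + 1)`. -/
def frac (a n : PTm nat) : PTm rat := (a.pair PTm.zero).pair n

/-- The rational `1 / (n + 1)`. -/
def unit (n : PTm nat) : PTm rat := frac PTm.zero.succ n

end PTm

section Rationals

variable {p : World} (M : Model p) {r s : PTm rat} {n m : PTm nat}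

namespace Model

/-- The value of a rational. -/
def κ (r : PTm rat) : M.K := (M.ν r.fst.fst - M.ν r.fst.snd) / (M.ν r.snd + 1)

theorem ν_pos (n : PTm nat) : 0 < M.ν n + 1 := by linarith [M.nonneg n]

theorem sat_ltQ : M.Q.Sat (Om.ltQ r s) ↔ M.κ r < M.κ s := by
  rw [Om.ltQ, M.sat_lt, κ, κ, div_lt_div_iff₀ (M.ν_pos _) (M.ν_pos _)]
  constructor
  · intro h
    simp only [ν_add, ν_mul, ν_succ] at h
    linarith
  · intro h
    apply M.add_one_le
    simp only [ν_add, ν_mul, ν_succ]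
    linarith

theorem ltQ (h : p ⊩ Om.ltQ r s) : M.κ r < M.κ s := M.sat_ltQ.1 (M.Q.sat_of_forces h)

theorem κ_frac (a n : PTm nat) : M.κ (PTm.frac a n) = M.ν a / (M.ν n + 1) := by
  have h₁ : M.ν (PTm.frac a n).fst.fst = M.ν a :=
    M.eq (eq_trans (fst_congr (fst_pair _ _)) (fst_pair _ _))
  have h₂ : M.ν (PTm.frac a n).fst.snd = M.ν PTm.zero :=
    M.eq (eq_trans (snd_congr (fst_pair _ _)) (snd_pair _ _))
  have h₃ : M.ν (PTm.frac a n).snd = M.ν n := M.eq (snd_pair _ _)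
  rw [κ, h₁, h₂, h₃, ν_zero, sub_zero]

@[simp]
theorem κ_unit (n : PTm nat) : M.κ (PTm.unit n) = 1 / (M.ν n + 1) := by
  rw [PTm.unit, κ_frac, ν_succ, ν_zero, zero_add]

@[simp]
theorem κ_zeroQ : M.κ PTm.zeroQ = 0 := by
  have := M.κ_frac PTm.zero PTm.zero
  rwa [ν_zero, zero_div] at this

@[simp]
theorem κ_addQ (r s : PTm rat) : M.κ (r.addQ s) = M.κ r + M.κ s := by
  have h₁ : M.ν (r.addQ s).fst.fst = M.ν _ :=
    M.eq (eq_trans (fst_congr (fst_pair _ _)) (fst_pair _ _))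
  have h₂ : M.ν (r.addQ s).fst.snd = M.ν _ :=
    M.eq (eq_trans (snd_congr (fst_pair _ _)) (snd_pair _ _))
  have h₃ : M.ν (r.addQ s).snd = M.ν _ := M.eq (snd_pair _ _)
  have hr := (M.ν_pos r.snd).ne'
  have hs := (M.ν_pos s.snd).ne'
  have hrs : M.ν r.snd * M.ν s.snd + (M.ν r.snd + M.ν s.snd) + 1 =
      (M.ν r.snd + 1) * (M.ν s.snd + 1) := by ring
  rw [κ, h₁, h₂, h₃]
  simp only [κ, ν_add, ν_mul, ν_succ, hrs]
  field_simp
  ring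

end Model

theorem ltQ_of_model (h : ∀ M : Model p, M.κ r < M.κ s) : p ⊩ Om.ltQ r s :=
  forces_of_model fun M => M.sat_ltQ.2 (h M)

theorem unit_pos (n : PTm nat) : p ⊩ Om.ltQ PTm.zeroQ (PTm.unit n) :=
  ltQ_of_model fun M => by
    simp only [M.κ_zeroQ, M.κ_unit]
    exact one_div_pos.2 (M.ν_pos n)

theorem Model.unit_lt (h : M.ν n < M.ν m) : M.κ (PTm.unit m) < M.κ (PTm.unit n) := by
  simp only [M.κ_unit]
  exact one_div_lt_one_div_of_lt (M.ν_pos n) (by linarith)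

theorem Model.unit_le (h : M.ν n ≤ M.ν m) : M.κ (PTm.unit m) ≤ M.κ (PTm.unit n) := by
  simp only [M.κ_unit]
  exact one_div_le_one_div_of_le (M.ν_pos n) (by linarith)

/-- The Archimedean property: between two rationals `r < s` fits some `1 / (n + 1)`. -/
theorem exists_unit_lt (h : p ⊩ Om.ltQ r s) : ∀ M : Model p, ∀ m : PTm nat,
    M.ν ((r.snd.succ).mul (s.snd.succ)) ≤ M.ν m → M.κ r + M.κ (PTm.unit m) < M.κ s := by
  intro M m hm
  have h := M.lt h
  simp only [Model.ν_add, Model.ν_mul, Model.ν_succ] at h hm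
  have h₁ := M.ν_pos r.snd
  have h₂ := M.ν_pos s.snd
  have h₃ : 0 < (M.ν r.snd + 1) * (M.ν s.snd + 1) := mul_pos h₁ h₂
  have h₄ : 1 / (M.ν m + 1) < 1 / ((M.ν r.snd + 1) * (M.ν s.snd + 1)) :=
    one_div_lt_one_div_of_lt h₃ (by linarith)
  have h₅ : M.κ s - M.κ r = ((M.ν s.fst.fst - M.ν s.fst.snd) * (M.ν r.snd + 1) -
      (M.ν r.fst.fst - M.ν r.fst.snd) * (M.ν s.snd + 1)) /
      ((M.ν r.snd + 1) * (M.ν s.snd + 1)) := by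
    simp only [Model.κ]
    field_simp
  -- The numerator of the difference is at least `1`, since a strict inequality of numbers leaves a
  -- gap of at least one.
  have h₆ : 1 / ((M.ν r.snd + 1) * (M.ν s.snd + 1)) ≤ M.κ s - M.κ r := by
    rw [h₅]
    apply div_le_div_of_nonneg_right _ h₃.le
    linarith
  rw [M.κ_unit]
  linarith

end Rationals

end BISH

/-! ### Local boundedness implies BD-N -/

namespace BISH

open Srt Tm

/-- The fifth variable. -/
abbrev v4 {Γ : Ctx} {σ τ₁ τ₂ τ₃ τ₄ : Srt} : Tm (τ₁ :: τ₂ :: τ₃ :: τ₄ :: σ :: Γ) σ :=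
  Tm.var (Var.there (Var.there (Var.there (Var.there Var.here))))

/-- The sixth variable. -/
abbrev v5 {Γ : Ctx} {σ τ₁ τ₂ τ₃ τ₄ τ₅ : Srt} : Tm (τ₁ :: τ₂ :: τ₃ :: τ₄ :: τ₅ :: σ :: Γ) σ :=
  Tm.var (Var.there (Var.there (Var.there (Var.there (Var.there Var.here)))))

/-- The seventh variable. -/
abbrev v6 {Γ : Ctx} {σ τ₁ τ₂ τ₃ τ₄ τ₅ τ₆ : Srt} :
    Tm (τ₁ :: τ₂ :: τ₃ :: τ₄ :: τ₅ :: τ₆ :: σ :: Γ) σ :=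
  Tm.var (Var.there (Var.there (Var.there (Var.there (Var.there (Var.there Var.here))))))

/-! ### BD-N from local boundedness -/

namespace Om

/-- `b (α n) < n` for all `n ≥ N`. -/
def small (b α : PTm baire) (N : PTm nat) : Om :=
  all fun n => (leN N n).imp (ltN (b.app (α.app n)) n)

/-- `N` is the least number with `small b α N`. -/
def leastSmall (b α : PTm baire) (N : PTm nat) : Om :=
  (small b α N).and (all fun M => (small b α M).imp (leN N M))

/-- `α` and `β` agree on their first `k` terms. -/
def agree (k : PTm nat) (α β : PTm baire) : Om :=
  all fun i => (ltN i k).imp (eq (α.app i) (β.app i))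

/-- The sequence `a` converges to `α` in Baire space. -/
def baireConv (a : PTm (fn nat baire)) (α : PTm baire) : Om :=
  all fun k => ex fun N => all fun n => (leN N n).imp (agree k (a.app n) α)

/-- `A` is pseudobounded. -/
def pseudobounded (A : PTm (pow nat)) : Om :=
  all fun s : PTm baire => (all fun n => mem (s.app n) A).imp
    (all fun k => ex fun N => all fun n => (leN N n).imp (ltN (k.succ.mul (s.app n)) n))

end Om

section LocBdd

variable {p : World} {A : PTm (pow nat)} {b : PTm baire} {f : PTm (fn baire nat)} {X : Om}

theorem small_of_succ {α : PTm baire} {N : PTm nat} (h : p ⊩ Om.small b α N.succ)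
    (h' : p ⊩ Om.ltN (b.app (α.app N)) N) : p ⊩ Om.small b α N := by
  intro n q _ hn
  refine orE (nat_le_total N.succ n) (fun r _ hr => h n hr) fun r _ hr => ?_
  have e : r ⊩ Om.eq N n := eq_of_model fun M => by
    have h₁ := M.le hn.up
    have h₂ := M.lt hr
    simp only [M.ν_succ] at h₂
    linarith
  exact eq_subst (ltN (app v1 (app v2 v0)) v0) (b ;; α ;; Env.nil) e h'.up

/-- Smallness is a universal statement and need not be decidable. But once it holds from `n + 1` on,
whether it holds from `n` on depends only on the decidable condition `b (α n) < n`, so one can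
descend from a known bound. -/
theorem exists_leastSmall {α : PTm baire} {N : PTm nat} (h : p ⊩ Om.small b α N) :
    p ⊩ Om.ex fun N => Om.leastSmall b α N := by
  have step : ∀ (n : PTm nat) (q : World) [Le q p],
      (q ⊩ (Om.small b α n).imp (Om.ex fun N => Om.leastSmall b α N)) →
      (q ⊩ (Om.small b α n.succ).imp (Om.ex fun N => Om.leastSmall b α N)) := by
    intro n q _ ih r _ h
    refine orE (nat_le_total n (b.app (α.app n))) (fun r' _ h' => exI n.succ ⟨h.up, ?_⟩)
      fun r' _ h' => ih (small_of_succ h.up h')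
    intro m r'' _ hm
    refine orE (nat_le_total n.succ m) (fun _ _ h => h) fun r₁ _ h₁ => botE ?_
    have h₂ : r₁ ⊩ Om.leN m n := le_of_model fun M => by
      have := M.lt h₁
      simp only [M.ν_succ] at this
      linarith
    have h₃ := hm n h₂
    exact bot_of_model fun M => by linarith [M.lt h₃, M.le h'.up]
  exact induction (Fm.all nat (leN v1 v0 ⇾ ltN (app v3 (app v2 v0)) v0) ⇾
    Fm.ex nat ((Fm.all nat (leN v1 v0 ⇾ ltN (app v4 (app v3 v0)) v0)) ⩓
      (Fm.all nat ((Fm.all nat (leN v1 v0 ⇾ ltN (app v5 (app v4 v0)) v0)) ⇾ leN v1 v0))))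
    (α ;; b ;; Env.nil)
    (fun q _ h => exI PTm.zero ⟨h, fun m r _ _ => nat_zero_le m⟩) step N h

theorem exists_small (hP : p ⊩ Om.pseudobounded A) (hb : p ⊩ Om.all fun n => Om.mem (b.app n) A)
    (α : PTm baire) : p ⊩ Om.ex fun N => Om.small b α N := by
  refine countable_choice (v0 ≐ app v2 (app v3 v1)) (b ;; α ;; Env.nil)
    (fun n => exI (b.app (α.app n)) (eq_refl (b.app (α.app n)))) fun s q _
      (hs : ∀ n {r : World} [Le r q], r ⊩ Om.eq (s.app n) (b.app (α.app n))) => ?_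
  -- The sequence `s` is `n ↦ b (α n)`. Pseudoboundedness with `k = 0` says that eventually `s n <
  -- n`.
  refine exE (hP s (fun n => mem_congr (eq_symm (hs n)) (eq_refl A) (hb (α.app n)).up) PTm.zero)
    fun N r _ hN => exI N fun n r' _ hn => ?_
  have h := hN n hn
  exact lt_of_model fun M => by
    have h₁ := M.lt h
    have h₂ := M.eq (hs n)
    simp only [M.ν_mul, M.ν_succ, M.ν_zero] at h₁
    linarith

theorem leastSmall_unique {α : PTm baire} {N N' : PTm nat} (h : p ⊩ Om.leastSmall b α N)
    (h' : p ⊩ Om.leastSmall b α N') : p ⊩ Om.eq N N' :=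
  nat_le_antisymm (h.2 N' h'.1) (h'.2 N h.1)

/-- The function that maps `α` to the least number with `small b α`. -/
theorem leastSmallE (hP : p ⊩ Om.pseudobounded A) (hb : p ⊩ Om.all fun n => Om.mem (b.app n) A)
    (k : ∀ (f : PTm (fn baire nat)) (q : World) [Le q p],
      (q ⊩ Om.all fun α => Om.leastSmall b α (f.app α)) → (q ⊩ X)) : p ⊩ X :=
  unique_choice ((Fm.all nat (leN v1 v0 ⇾ ltN (app v3 (app v2 v0)) v0)) ⩓
      (Fm.all nat ((Fm.all nat (leN v1 v0 ⇾ ltN (app v4 (app v3 v0)) v0)) ⇾ leN v1 v0)))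
    (b ;; Env.nil)
    (fun α => exE (exists_small hP hb α) fun _ _ _ h => exists_leastSmall h)
    (fun _ _ _ _ _ h h' => leastSmall_unique (α := _) h h') fun f q _ hf => k f q fun α => hf α

/-- Otherwise `b (α n) < n`, and then `n` would already satisfy the condition of which `n + 1` is
the least solution. -/
theorem le_of_leastSmall_succ {α : PTm baire} {N n : PTm nat} (h : p ⊩ Om.leastSmall b α N)
    (hn : p ⊩ Om.eq N n.succ) : p ⊩ Om.leN n (b.app (α.app n)) := by
  refine orE (nat_le_total n (b.app (α.app n))) (fun _ _ h => h) fun q _ hq => botE ?_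
  have h₁ : q ⊩ Om.small b α n.succ :=
    eq_subst (Fm.all nat (leN v1 v0 ⇾ ltN (app v3 (app v2 v0)) v0)) (α ;; b ;; Env.nil) hn.up h.1.up
  have h₂ := h.2 n (small_of_succ h₁ hq)
  exact bot_of_model fun M => by
    have h₃ := M.le h₂
    have h₄ := M.eq hn.up
    simp only [M.ν_succ] at h₄
    linarith

/-- If the values of `f` along a sequence exceed `f α`, then there are elements of `A` that are as
large as the sequence is close to `α`. -/
theorem exists_large_or_le (hb : p ⊩ Om.all fun n => Om.mem (b.app n) A)
    (hf : p ⊩ Om.all fun α => Om.leastSmall b α (f.app α))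
    {α β : PTm baire} {m : PTm nat} (h : p ⊩ Om.agree m β α) :
    p ⊩ (Om.ex fun v => (Om.mem v A).and (Om.leN m v)).or (Om.leN (f.app β) (f.app α)) := by
  refine orE (nat_le_total (f.app β) (f.app α)) (fun q _ h => orI₂ h) fun q _ hq => orI₁ ?_
  refine orE (nat_cases (f.app β)) (fun r _ hr => botE (bot_of_model fun M => ?_)) fun r _ hr => ?_
  · have h₁ := M.lt hq.up
    have h₂ := M.eq hr
    have h₃ := M.nonneg (f.app α)
    rw [M.ν_zero] at h₂
    linarith
  refine exE hr fun n r _ hn => exI (b.app (β.app n)) ⟨(hb _).up, ?_⟩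
  -- Here `f β = n + 1`, so `n ≤ b (β n)`. If `n < m`, then `β n = α n`, while `f α ≤ n` gives `b (α
  -- n) < n`, a contradiction. Hence `m ≤ n`, and `b (β n)` is the large element.
  have h₁ := le_of_leastSmall_succ (hf β).up hn
  refine orE (nat_le_total m n) (fun r' _ hr' => nat_le_trans hr' h₁.up) fun r' _ hr' => botE ?_
  have h₂ : r' ⊩ Om.leN (f.app α) n := le_of_model fun M => by
    have h₂ := M.lt hq.up
    have h₃ := M.eq hn.up
    rw [M.ν_succ] at h₃
    linarith
  have h₃ := (hf α).1 n h₂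
  have h₄ := app_congr (eq_refl b) (h n hr')
  exact bot_of_model fun M => by linarith [M.lt h₃, M.eq h₄, M.le h₁.up]

/-- For `n` below `f α` the terms of the two sequences coincide, and from `f α` on the condition
holds for `α` by definition. So every solution for `β` that is at most `f α` is also a solution for
`α`. -/
theorem eq_of_agree_of_le
    (hf : p ⊩ Om.all fun α => Om.leastSmall b α (f.app α))
    {α β : PTm baire} (h : p ⊩ Om.agree (f.app α) β α) (h' : p ⊩ Om.leN (f.app β) (f.app α)) :
    p ⊩ Om.eq (f.app β) (f.app α) := by
  refine nat_le_antisymm h' ((hf α).2 _ fun n q _ hn => ?_)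
  refine orE (nat_le_total (f.app α) n) (fun r _ hr => (hf α).1 n hr) fun r _ hr => ?_
  have h₁ := (hf β).1 n (hn.up (q := r))
  have h₂ := app_congr (eq_refl b) (h n hr)
  exact lt_of_model fun M => by linarith [M.lt h₁, M.eq h₂]

/-- A sequence of numbers that is at least the identity leaves no gaps. -/
theorem exists_interval {J : PTm baire} {m j : PTm nat} (hJ : p ⊩ Om.all fun m => Om.leN m (J.app m))
    (hj : p ⊩ Om.leN (J.app m) j) :
    p ⊩ Om.ex fun i => (Om.leN m i).and
      ((Om.leN (J.app i) j).and (Om.ltN j (J.app i.succ))) := by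
  have step : ∀ (n : PTm nat) (q : World) [Le q p],
      (q ⊩ (Om.ex fun i => (Om.leN m i).and ((Om.leN (J.app i) j).and (Om.ltN j (J.app i.succ)))).or
        (Om.leN (J.app (m.add n)) j)) →
      (q ⊩ (Om.ex fun i => (Om.leN m i).and ((Om.leN (J.app i) j).and (Om.ltN j (J.app i.succ)))).or
        (Om.leN (J.app (m.add n.succ)) j)) := by
    intro n q _ h
    refine orE h (fun r _ hr => orI₁ hr) fun r _ hr => ?_
    have e := app_congr (p := r) (eq_refl J) (nat_add_succ m n)
    refine orE (nat_le_total (J.app (m.add n.succ)) j) (fun r _ hr => orI₂ hr) fun r' _ hr' =>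
      orI₁ (exI (m.add n) ⟨exI n (eq_refl _), hr.up, ?_⟩)
    exact lt_of_model fun M => by linarith [M.lt hr', M.eq e.up]
  have e := app_congr (p := p) (eq_refl J) (nat_add_zero m)
  have h := induction ((Fm.ex nat (leN v2 v0 ⩓ leN (app v4 v0) v3 ⩓ ltN v3 (app v4 (succ v0)))) ⩔
    leN (app v3 (add v1 v0)) v2) (m ;; j ;; J ;; Env.nil)
    (orI₂ (le_of_model fun M => by linarith [M.le hj, M.eq e] :
      p ⊩ Om.leN (J.app (m.add PTm.zero)) j)) step j.succ
  -- The search ends within `j + 1` steps because `J (m + j + 1) ≥ m + j + 1 > j`.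
  refine orE h (fun _ _ h => h) fun q _ (h : q ⊩ Om.leN (J.app (m.add j.succ)) j) => botE ?_
  exact bot_of_model fun M => by
    have h₁ := M.le (hJ (m.add j.succ)).up
    have h₂ := M.le h
    simp only [M.ν_add, M.ν_succ] at h₁
    linarith [M.nonneg m]

/-- The indices are cut into blocks `J m ≤ j < J (m + 1)`, where `J` is a modulus of convergence. On
each block either all values are at most `f α`, or `A` has an element `≥ m`. One element of `A` per
block records which case occurs, and pseudoboundedness of this sequence excludes the second case for
late blocks. -/
theorem baireSeqCont_of_leastSmall (hP : p ⊩ Om.pseudobounded A)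
    (hb : p ⊩ Om.all fun n => Om.mem (b.app n) A)
    (hf : p ⊩ Om.all fun α => Om.leastSmall b α (f.app α))
    {a : PTm (fn nat baire)} {α : PTm baire} (h : p ⊩ Om.baireConv a α) :
    p ⊩ Om.ex fun N => Om.all fun n => (Om.leN N n).imp
      (Om.eq (f.app (a.app n)) (f.app α)) := by
  -- The modulus is enlarged by `m` so that `J m ≥ m`, which is needed for the blocks to cover all
  -- later indices.
  refine countable_choice (leN v1 v0 ⩓ Fm.all nat (leN v1 v0 ⇾
    Fm.all nat (ltN v0 v3 ⇾ (app (app v4 v1) v0 ≐ app v5 v0)))) (a ;; α ;; Env.nil)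
    (fun m => exE (h m) fun N q _ hN => exI (N.add m) (⟨exI N (nat_add_comm _ _), fun n r _ hn =>
      hN n (le_of_model fun M => ?_)⟩ : q ⊩ (Om.leN m (N.add m)).and (Om.all fun n =>
        (Om.leN (N.add m) n).imp (Om.agree m (a.app n) α))))
    fun J q _ (hJ : ∀ m {r : World} [Le r q], r ⊩ (Om.leN m (J.app m)).and (Om.all fun n =>
        (Om.leN (J.app m) n).imp (Om.agree m (a.app n) α))) => ?_
  · have := M.le hn
    simp only [M.ν_add] at this
    linarith [M.nonneg m]
  have search : ∀ m, q ⊩ Om.ex fun v => (Om.mem v A).and ((Om.leN m v).or (Om.all fun j =>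
      (Om.leN (J.app m) j).imp ((Om.ltN j (J.app m.succ)).imp
        (Om.leN (f.app (a.app j)) (f.app α))))) := by
    intro m
    -- The block is finite, so the alternative is decided by a bounded search, one index `j` at a
    -- time; the upper end of the range is the induction variable.
    have step : ∀ (n : PTm nat) (q' : World) [Le q' q],
        (q' ⊩ (Om.ex fun v => (Om.mem v A).and (Om.leN m v)).or (Om.all fun j =>
          (Om.leN (J.app m) j).imp ((Om.ltN j n).imp (Om.leN (f.app (a.app j)) (f.app α))))) →
        (q' ⊩ (Om.ex fun v => (Om.mem v A).and (Om.leN m v)).or (Om.all fun j =>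
          (Om.leN (J.app m) j).imp ((Om.ltN j n.succ).imp
            (Om.leN (f.app (a.app j)) (f.app α))))) := by
      intro n q' _ ih
      refine orE ih (fun r _ hr => orI₁ hr) fun r _ hr => ?_
      have key : ∀ (r' : World) [Le r' r], (r' ⊩ (Om.leN (J.app m) n).imp
          (Om.leN (f.app (a.app n)) (f.app α))) → (r' ⊩ Om.all fun j =>
          (Om.leN (J.app m) j).imp ((Om.ltN j n.succ).imp
            (Om.leN (f.app (a.app j)) (f.app α)))) := by
        intro r' _ h' j r₁ _ h₁ r₂ _ h₂
        refine orE (nat_le_total n j) (fun r₃ _ h₃ => ?_) fun r₃ _ h₃ => hr j (h₁.up (q := r₃)) h₃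
        have e : r₃ ⊩ Om.eq n j := eq_of_model fun M => by
          have h₄ := M.lt h₂.up
          simp only [M.ν_succ] at h₄
          linarith [M.le h₃]
        have h₄ := h' (le_of_model fun M => by linarith [M.le h₁.up, M.eq e] :
          r₃ ⊩ Om.leN (J.app m) n)
        have e' := app_congr (eq_refl f) (app_congr (eq_refl a) e)
        exact le_of_model fun M => by linarith [M.le h₄, M.eq e']
      refine orE (nat_le_total (J.app m) n) (fun r' _ hr' => ?_) fun r' _ hr' => ?_
      · refine orE (exists_large_or_le hb.up hf.up ((hJ m (r := q)).2 n hr')) (fun r₁ _ h₁ => orI₁ h₁)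
          fun r₁ _ h₁ => orI₂ (key r₁ fun r₂ _ _ => h₁.up)
      · exact orI₂ (key r' fun r₁ _ h₁ => botE (bot_of_model fun M => by
          linarith [M.le h₁, M.lt hr'.up]))
    have h₀ := induction ((Fm.ex nat ((v0 ∊ v3) ⩓ leN v2 v0)) ⩔ (Fm.all nat
      (leN (app v4 v2) v0 ⇾ ltN v0 v1 ⇾ leN (app v5 (app v6 v0))
        (app v5 (Tm.var (Var.there (Var.there (Var.there (Var.there (Var.there (Var.there
          (Var.there Var.here))))))))))))
      (m ;; A ;; J ;; f ;; a ;; α ;; Env.nil)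
      (orI₂ fun j r _ _ r' _ (h : r' ⊩ Om.ltN j PTm.zero) => botE (bot_of_model fun M => by
        have := M.lt h
        rw [M.ν_zero] at this
        linarith [M.nonneg j])) step (J.app m.succ)
    refine orE h₀ (fun r _ (hr : r ⊩ Om.ex fun v => (Om.mem v A).and (Om.leN m v)) =>
      exE hr fun v r' _ hv => exI v ⟨hv.1, orI₁ hv.2⟩)
      -- When no large element has been found, any element of `A` will do.
      fun r _ hr => exI (b.app PTm.zero) ⟨(hb _).up, orI₂ hr⟩
  refine countable_choice ((v0 ∊ v2) ⩓ (leN v1 v0 ⩔ Fm.all nat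
      (leN (app v4 v2) v0 ⇾ ltN v0 (app v4 (succ v2)) ⇾ leN (app v5 (app v6 v0))
        (app v5 (Tm.var (Var.there (Var.there (Var.there (Var.there (Var.there (Var.there
          (Var.there Var.here)))))))))))) (A ;; J ;; f ;; a ;; α ;; Env.nil) search
    fun s r _ (hs : ∀ m {r' : World} [Le r' r], r' ⊩ (Om.mem (s.app m) A).and
      ((Om.leN m (s.app m)).or (Om.all fun j => (Om.leN (J.app m) j).imp
        ((Om.ltN j (J.app m.succ)).imp (Om.leN (f.app (a.app j)) (f.app α)))))) => ?_
  refine exE (hP s (fun n => (hs n).1) PTm.zero) fun N r' _ hN => ?_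
  -- Beyond `J N` the value is at most `f α`; beyond `J (f α)` the sequences agree on `f α` terms.
  -- Together these give equality by `eq_of_agree_of_le`.
  refine exI ((J.app N).add (J.app (f.app α))) fun j r₁ _ hj => ?_
  have hj₁ : r₁ ⊩ Om.leN (J.app N) j := le_of_model fun M => by
    have := M.le hj
    rw [M.ν_add] at this
    linarith [M.nonneg (J.app (f.app α))]
  have hj₂ : r₁ ⊩ Om.leN (J.app (f.app α)) j := le_of_model fun M => by
    have := M.le hj
    rw [M.ν_add] at this
    linarith [M.nonneg (J.app N)]
  refine eq_of_agree_of_le hf.up ((hJ (f.app α) (r := q)).2 j hj₂) ?_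
  refine exE (exists_interval (fun m => (hJ m).1) hj₁) fun i r₂ _ hi => ?_
  refine orE (hs i).2 (fun r₃ _ h₃ => botE ?_) fun r₃ _ h₃ => h₃ j (hi.2.1.up (q := r₃)) hi.2.2.up
  have h₄ := hN i hi.1.up (q := r₃)
  exact bot_of_model fun M => by
    have h₅ := M.lt h₄
    simp only [M.ν_mul, M.ν_succ, M.ν_zero] at h₅
    linarith [M.le h₃]

/-- An inhabited countable set of numbers is enumerated by a sequence. -/
theorem enumE {e a : PTm baire} {x : PTm nat} (hx : p ⊩ Om.mem x A)
    (hA : p ⊩ Om.all fun x => (Om.mem x A).iff (Om.ex fun n =>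
      (Om.eq (e.app n) PTm.zero).and (Om.eq (a.app n) x)))
    (k : ∀ (b : PTm baire) (q : World) [Le q p], (q ⊩ Om.all fun n => Om.mem (b.app n) A) →
      (q ⊩ Om.all fun x => (Om.mem x A).imp (Om.ex fun n => Om.eq (b.app n) x)) → (q ⊩ X)) :
    p ⊩ X := by
  refine countable_choice (((app v2 v1 ≐ zero) ⩓ (v0 ≐ app v3 v1)) ⩔
      (ltN zero (app v2 v1) ⩓ (v0 ≐ v4))) (e ;; a ;; x ;; Env.nil) (fun n => ?_)
    fun b q _ (hb : ∀ n {r : World} [Le r q],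
      r ⊩ ((Om.eq (e.app n) PTm.zero).and (Om.eq (b.app n) (a.app n))).or
        ((Om.ltN PTm.zero (e.app n)).and (Om.eq (b.app n) x))) => k b q (fun n => ?_) ?_
  · refine orE (nat_le_total (e.app n) PTm.zero) (fun q _ h => exI (a.app n) (orI₁ ⟨?_, eq_refl _⟩))
      fun q _ h => exI x (orI₂ ⟨h, eq_refl _⟩)
    exact nat_le_antisymm h (nat_zero_le _)
  · refine orE (hb n) (fun r _ h => (hA _).2 (exI n ⟨h.1, eq_symm h.2⟩)) fun r _ h => ?_
    exact mem_congr (eq_symm h.2) (eq_refl A) hx.up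
  · intro y r _ hy
    refine exE ((hA y).1 hy) fun n r' _ hn => exI n ?_
    refine orE (hb n) (fun r₁ _ h => eq_trans h.2 hn.2.up) fun r₁ _ h => botE ?_
    exact bot_of_model fun M => by linarith [M.lt h.1, M.eq hn.1.up]

/-- Local boundedness is used at a single point; `b` itself serves, being a sequence at hand. A
bound on a neighbourhood controls all sequences that become constant after the first `k` terms, and
the constant can be an index of an arbitrary element of `A`. -/
theorem bounded_of_locBdd (hP : p ⊩ Om.pseudobounded A)
    (hb : p ⊩ Om.all fun n => Om.mem (b.app n) A)
    (hb' : p ⊩ Om.all fun x => (Om.mem x A).imp (Om.ex fun n => Om.eq (b.app n) x))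
    (h : p ⊩ SeqContLocBdd.ev Env.nil) :
    p ⊩ Om.ex fun N => Om.all fun m => (Om.mem m A).imp (Om.leN m N) := by
  refine leastSmallE hP hb fun f q _ hf => ?_
  have hl : q ⊩ Om.ex fun k => Om.ex fun K => Om.all fun β => (Om.agree k b β).imp
      (Om.leN (f.app β) K) :=
    h f (fun a α r _ (hr : r ⊩ Om.baireConv a α) => baireSeqCont_of_leastSmall hP.up hb.up hf.up hr) b
  refine exE hl fun k r _ hk => exE hk fun K r _ hK => exI (k.add K) fun x r' _ hx => ?_
  refine exE (hb' x hx) fun m r₁ _ hm => ?_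
  -- The sequence `β` copies `b` below `k` and is constantly `m` from `k` on.
  refine countable_choice ((ltN v1 v2 ⩓ (v0 ≐ app v3 v1)) ⩔ (leN v2 v1 ⩓ (v0 ≐ v4)))
    (k ;; b ;; m ;; Env.nil)
    (fun n => orE (nat_le_total k n) (fun q _ h => exI m (orI₂ ⟨h, eq_refl _⟩))
      fun q _ h => exI (b.app n) (orI₁ ⟨h, eq_refl _⟩))
    fun β r₂ _ (hβ : ∀ n {r : World} [Le r r₂],
      r ⊩ ((Om.ltN n k).and (Om.eq (β.app n) (b.app n))).or
        ((Om.leN k n).and (Om.eq (β.app n) m))) => ?_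
  have h₁ : r₂ ⊩ Om.agree k b β := by
    intro i r _ hi
    refine orE (hβ i) (fun r _ h => eq_symm h.2) fun r _ h => botE ?_
    exact bot_of_model fun M => by linarith [M.lt hi.up, M.le h.1]
  have h₂ := hK β h₁
  refine orE (nat_le_total x (k.add K)) (fun _ _ h => h) fun r₃ _ h₃ => botE ?_
  -- The place `k + K` is past both `f β`, so that `b (β (k + K)) < k + K`, and `k`, so that the
  -- left side is `b m = x`.
  have h₄ := (hf β).1 (k.add K) (le_of_model fun M => by
    rw [M.ν_add]
    linarith [M.le h₂.up, M.nonneg k] : r₃ ⊩ Om.leN (f.app β) (k.add K))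
  refine orE (hβ (k.add K)) (fun r₄ _ h => ?_) fun r₄ _ h => ?_
  · exact bot_of_model fun M => by
      have := M.lt h.1
      rw [M.ν_add] at this
      linarith [M.nonneg K]
  · have h₅ := app_congr (eq_refl b) h.2
    exact bot_of_model fun M => by
      linarith [M.lt h₄.up, M.lt h₃.up, M.eq h₅, M.eq hm.up]

theorem bdn_of_locBdd (h : p ⊩ SeqContLocBdd.ev Env.nil) : p ⊩ BDN.ev Env.nil := by
  intro A q _ hA
  refine exE hA.1 fun x r _ hx => exE hA.2.1.up fun e r _ he => exE he fun a r _ ha => ?_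
  exact enumE hx.up ha fun b r _ hb hb' => bounded_of_locBdd (Forces.up hA.2.2) hb hb' h.up

end LocBdd

end BISH

/-! ### Pairing of numbers, and the metric notions as truth values -/

namespace BISH

open Srt Tm

/-- The eighth variable. -/
abbrev v7 {Γ : Ctx} {σ τ₁ τ₂ τ₃ τ₄ τ₅ τ₆ τ₇ : Srt} :
    Tm (τ₁ :: τ₂ :: τ₃ :: τ₄ :: τ₅ :: τ₆ :: τ₇ :: σ :: Γ) σ := Tm.wk τ₁ v6

/-- The ninth variable. -/
abbrev v8 {Γ : Ctx} {σ τ₁ τ₂ τ₃ τ₄ τ₅ τ₆ τ₇ τ₈ : Srt} :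
    Tm (τ₁ :: τ₂ :: τ₃ :: τ₄ :: τ₅ :: τ₆ :: τ₇ :: τ₈ :: σ :: Γ) σ := Tm.wk τ₁ v7

/-- The tenth variable. -/
abbrev v9 {Γ : Ctx} {σ τ₁ τ₂ τ₃ τ₄ τ₅ τ₆ τ₇ τ₈ τ₉ : Srt} :
    Tm (τ₁ :: τ₂ :: τ₃ :: τ₄ :: τ₅ :: τ₆ :: τ₇ :: τ₈ :: τ₉ :: σ :: Γ) σ := Tm.wk τ₁ v8

/-- The eleventh variable. -/
abbrev v10 {Γ : Ctx} {σ τ₁ τ₂ τ₃ τ₄ τ₅ τ₆ τ₇ τ₈ τ₉ τ₁₀ : Srt} :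
    Tm (τ₁ :: τ₂ :: τ₃ :: τ₄ :: τ₅ :: τ₆ :: τ₇ :: τ₈ :: τ₉ :: τ₁₀ :: σ :: Γ) σ := Tm.wk τ₁ v9

/-- The term `1 / (t + 1)`. -/
def unitTm {Γ : Ctx} (t : Tm Γ nat) : Tm Γ rat := pair (pair (succ zero) zero) t

/-! ### Pairing -/

section Pairing

variable {p : World} {X : Om}

theorem exists_sqrt (k : PTm nat) : p ⊩ Om.ex fun s => Om.ex fun r =>
    (Om.eq k ((s.mul s).add r)).and (Om.leN r (s.add s)) := by
  have step : ∀ (k : PTm nat) (q : World) [Le q p],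
      (q ⊩ Om.ex fun s => Om.ex fun r => (Om.eq k ((s.mul s).add r)).and (Om.leN r (s.add s))) →
      (q ⊩ Om.ex fun s => Om.ex fun r =>
        (Om.eq k.succ ((s.mul s).add r)).and (Om.leN r (s.add s))) := by
    intro k q _ h
    refine exE h fun s q _ h => exE h fun r q _ h => ?_
    refine orE (nat_le_total (s.add s) r) (fun q' _ h' => exI s.succ (exI PTm.zero ⟨?_, nat_zero_le _⟩))
      fun q' _ h' => exI s (exI r.succ ⟨?_, h'⟩)
    · refine eq_of_model fun M => ?_
      have h₁ := M.eq h.1.up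
      have h₂ := M.le h.2.up
      have h₃ := M.le h'
      simp only [M.ν_add, M.ν_mul, M.ν_succ, M.ν_zero] at h₁ h₂ h₃ ⊢
      linarith
    · refine eq_of_model fun M => ?_
      have h₁ := M.eq h.1.up
      simp only [M.ν_add, M.ν_mul, M.ν_succ] at h₁ ⊢
      linarith
  have base : p ⊩ Om.ex fun s => Om.ex fun r =>
      (Om.eq PTm.zero ((s.mul s).add r)).and (Om.leN r (s.add s)) :=
    exI PTm.zero (exI PTm.zero ⟨eq_of_model fun M => by simp, nat_zero_le _⟩)
  exact induction (Fm.ex nat (Fm.ex nat ((v2 ≐ add (mul v1 v1) v0) ⩓ leN v0 (add v1 v1))))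
    Env.nil base step k

/-- The pair `(n, m)` is coded by `(n + m)² + m`. Since `m ≤ 2 (n + m)`, the integer square root of
the code is `n + m` and the remainder is `m`. -/
theorem exists_unpair (k : PTm nat) : p ⊩ Om.ex fun n => Om.ex fun m => Om.all fun n' =>
    Om.all fun m' => (Om.eq k (((n'.add m').mul (n'.add m')).add m')).imp
      ((Om.eq n n').and (Om.eq m m')) := by
  refine exE (exists_sqrt k) fun s q _ h => exE h fun r q _ h => ?_
  have key : ∀ (n' m' : PTm nat) (q' : World) [Le q' q],
      (q' ⊩ Om.eq k (((n'.add m').mul (n'.add m')).add m')) →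
      ∀ M : Model q', M.ν s = M.ν n' + M.ν m' ∧ M.ν r = M.ν m' := by
    intro n' m' q' _ h' M
    have h₁ := M.eq h.1.up
    have h₂ := M.le h.2.up
    have h₃ := M.eq h'
    have h₄ := M.nonneg n'
    have h₅ := M.nonneg m'
    have h₆ := M.nonneg r
    have h₇ := M.nonneg s
    have h₈ := M.le_or_lt s (n'.add m')
    have h₉ := M.le_or_lt (n'.add m') s
    simp only [M.ν_add, M.ν_mul] at h₁ h₂ h₃ h₈ h₉
    have e : M.ν s = M.ν n' + M.ν m' := by
      rcases h₈ with h₈ | h₈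
      · rcases h₉ with h₉ | h₉
        · exact le_antisymm h₈ h₉
        · nlinarith
      · nlinarith
    exact ⟨e, by rw [e] at h₁; linarith⟩
  refine orE (nat_le_total r s) (fun q' _ h' => ?_) fun q' _ h' => ?_
  · refine exE h' fun n q₁ _ hn => exI n (exI r fun n' m' q₂ _ h₂ => ?_)
    constructor
    · refine eq_of_model fun M => ?_
      have h₃ := key n' m' q₂ h₂ M
      have h₄ := M.eq hn.up
      rw [M.ν_add] at h₄
      linarith
    · exact eq_of_model fun M => (key n' m' q₂ h₂ M).2
  -- A remainder greater than the root shows that `k` is not a code, and `(0, 0)` is a default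
  -- value.
  · refine exI PTm.zero (exI PTm.zero fun n' m' q₂ _ h₂ => botE (bot_of_model fun M => ?_))
    have h₃ := key n' m' q₂ h₂ M
    linarith [M.nonneg n', M.lt h'.up]

/-- The components of a surjection of the natural numbers onto the pairs. -/
theorem unpairE (k : ∀ (f g : PTm baire) (q : World) [Le q p],
    (q ⊩ Om.all fun n => Om.all fun m => Om.ex fun k =>
      (Om.eq (f.app k) n).and (Om.eq (g.app k) m)) → (q ⊩ X)) : p ⊩ X := by
  refine countable_choice (Fm.ex nat (Fm.all nat (Fm.all nat
      ((v4 ≐ add (mul (add v1 v0) (add v1 v0)) v0) ⇾ ((v3 ≐ v1) ⩓ (v2 ≐ v0)))))) Env.nil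
    exists_unpair fun f q _ (hf : ∀ k {r : World} [Le r q], r ⊩ Om.ex fun m => Om.all fun n' =>
      Om.all fun m' => (Om.eq k (((n'.add m').mul (n'.add m')).add m')).imp
      ((Om.eq (f.app k) n').and (Om.eq m m'))) => ?_
  refine countable_choice (Fm.all nat (Fm.all nat ((v3 ≐ add (mul (add v1 v0) (add v1 v0)) v0) ⇾
      ((app v4 v3 ≐ v1) ⩓ (v2 ≐ v0))))) (f ;; Env.nil)
    (fun k => hf k) fun g r _ (hg : ∀ k {r' : World} [Le r' r], r' ⊩ Om.all fun n' =>
      Om.all fun m' => (Om.eq k (((n'.add m').mul (n'.add m')).add m')).imp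
      ((Om.eq (f.app k) n').and (Om.eq (g.app k) m'))) => ?_
  exact k f g r fun n m => exI (((n.add m).mul (n.add m)).add m)
    (hg (((n.add m).mul (n.add m)).add m) (r' := r) n m (eq_refl _))

end Pairing

/-! ### Real numbers and metric spaces -/

namespace Om

/-- `q < r` for a rational `q` and a real `r`. -/
def below (q : PTm rat) (r : PTm cut) : Om := mem q r.fst

/-- `r < q` for a rational `q` and a real `r`. -/
def above (r : PTm cut) (q : PTm rat) : Om := mem q r.snd

/-- `r` is a Dedekind real. -/
def isReal (r : PTm cut) : Om :=
  (ex fun q => below q r).and <| (ex fun q => above r q).and <|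
  (all fun p => (below p r).iff (ex fun q => (ltQ p q).and (below q r))).and <|
  (all fun q => (above r q).iff (ex fun p => (ltQ p q).and (above r p))).and <|
  (all fun q => neg ((below q r).and (above r q))).and
  (all fun p => all fun q => (ltQ p q).imp ((below p r).or (above r q)))

/-- `0 ≤ r`. -/
def nonnegR (r : PTm cut) : Om := all fun q => (ltQ q PTm.zeroQ).imp (below q r)

/-- `r = 0`. -/
def isZeroR (r : PTm cut) : Om :=
  all fun q => ((below q r).iff (ltQ q PTm.zeroQ)).and ((above r q).iff (ltQ PTm.zeroQ q))

/-- `t ≤ r + s`. -/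
def leAddR (t r s : PTm cut) : Om :=
  all fun p => all fun q => ((above r p).and (above s q)).imp (above t (p.addQ q))

/-- `(X, d)` is a metric space. -/
def isMetric {σ : Srt} (X : PTm (pow σ)) (d : PTm (metric σ)) : Om :=
  (all fun x => all fun y => ((mem x X).and (mem y X)).imp
    ((isReal ((d.app x).app y)).and <| (nonnegR ((d.app x).app y)).and <|
      ((isZeroR ((d.app x).app y)).iff (eq x y)).and (eq ((d.app x).app y) ((d.app y).app x)))).and
  (all fun x => all fun y => all fun z => ((mem x X).and ((mem y X).and (mem z X))).imp
    (leAddR ((d.app x).app z) ((d.app x).app y) ((d.app y).app z)))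

/-- The sequence `s` converges to `x` with respect to `d`. -/
def conv {σ : Srt} (d : PTm (metric σ)) (s : PTm (fn nat σ)) (x : PTm σ) : Om :=
  all fun ε => (ltQ PTm.zeroQ ε).imp (ex fun N => all fun n => (leN N n).imp
    (above ((d.app (s.app n)).app x) ε))

/-- `F` is a function from `X` to `Y`. -/
def isMap {σ τ : Srt} (X : PTm (pow σ)) (Y : PTm (pow τ)) (F : PTm (pow (prod σ τ))) : Om :=
  (all fun x => all fun y => (mem (x.pair y) F).imp ((mem x X).and (mem y Y))).and <|
  (all fun x => (mem x X).imp (ex fun y => mem (x.pair y) F)).and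
  (all fun x => all fun y => all fun z => ((mem (x.pair y) F).and (mem (x.pair z) F)).imp (eq y z))

/-- The map `F` is sequentially continuous. -/
def seqCont {σ τ : Srt} (d : PTm (metric σ)) (ρ : PTm (metric τ)) (F : PTm (pow (prod σ τ))) : Om :=
  all fun s : PTm (fn nat σ) => all fun x => all fun t : PTm (fn nat τ) => all fun y =>
    ((all fun n => mem ((s.app n).pair (t.app n)) F).and
      ((mem (x.pair y) F).and (conv d s x))).imp (conv ρ t y)

/-- `A` is countable. -/
def countbl {σ : Srt} (A : PTm (pow σ)) : Om :=
  ex fun e : PTm baire => ex fun a : PTm (fn nat σ) => all fun x => (mem x A).iff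
    (ex fun n => (eq (e.app n) PTm.zero).and (eq (a.app n) x))

/-- `(X, d)` is separable. -/
def separable {σ : Srt} (X : PTm (pow σ)) (d : PTm (metric σ)) : Om :=
  ex fun D => (countbl D).and <| (all fun x => (mem x D).imp (mem x X)).and
    (all fun x => (mem x X).imp (all fun ε => (ltQ PTm.zeroQ ε).imp
      (ex fun y => (mem y D).and (above ((d.app x).app y) ε))))

/-- The map `F` is pointwise continuous. -/
def ptCont {σ τ : Srt} (d : PTm (metric σ)) (ρ : PTm (metric τ)) (F : PTm (pow (prod σ τ))) : Om :=
  all fun x => all fun y => (mem (x.pair y) F).imp (all fun ε => (ltQ PTm.zeroQ ε).imp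
    (ex fun δ => (ltQ PTm.zeroQ δ).and (all fun x' => all fun y' =>
      ((mem (x'.pair y') F).and (above ((d.app x).app x') δ)).imp (above ((ρ.app y).app y') ε))))

end Om

section Metric

variable {p : World} {σ τ : Srt} {X : PTm (pow σ)} {d : PTm (metric σ)} {x y z : PTm σ}
  {r s : PTm cut} {q q' t : PTm rat}

theorem below_congr (hq : p ⊩ Om.eq q q') (hr : p ⊩ Om.eq r s) (h : p ⊩ Om.below q r) :
    p ⊩ Om.below q' s :=
  mem_congr hq (fst_congr hr) h

theorem above_congr (hr : p ⊩ Om.eq r s) (hq : p ⊩ Om.eq q q') (h : p ⊩ Om.above r q) :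
    p ⊩ Om.above s q' :=
  mem_congr hq (snd_congr hr) h

theorem unit_congr {m n : PTm nat} (h : p ⊩ Om.eq m n) :
    p ⊩ Om.eq (PTm.unit m) (PTm.unit n) :=
  eq_congr (unitTm v0) Env.nil h

/-- Rationals are unreduced fractions, so different terms may have the same value. Roundedness of
the cut makes membership depend on the value alone, and therefore a weak inequality of values
suffices. -/
theorem above_mono (hr : p ⊩ Om.isReal r) (h : p ⊩ Om.above r q)
    (hq : ∀ (p' : World) [Le p' p] (M : Model p'), M.κ q ≤ M.κ q') : p ⊩ Om.above r q' :=
  exE ((hr.2.2.2.1 q).1 h) fun t p' _ ht => (hr.2.2.2.1 q').2 <| exI t ⟨ltQ_of_model fun M =>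
    (M.ltQ ht.1).trans_le (hq p' M), ht.2⟩

theorem Om.isMetric.isReal (h : p ⊩ Om.isMetric X d) (hx : p ⊩ Om.mem x X) (hy : p ⊩ Om.mem y X) :
    p ⊩ Om.isReal ((d.app x).app y) :=
  (h.1 x y ⟨hx, hy⟩).1

theorem Om.isMetric.above_comm (h : p ⊩ Om.isMetric X d) (hx : p ⊩ Om.mem x X)
    (hy : p ⊩ Om.mem y X) (hq : p ⊩ Om.above ((d.app x).app y) q) :
    p ⊩ Om.above ((d.app y).app x) q :=
  above_congr (h.1 x y ⟨hx, hy⟩).2.2.2 (eq_refl q) hq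

theorem Om.isMetric.above_self (h : p ⊩ Om.isMetric X d) (hx : p ⊩ Om.mem x X)
    (hq : p ⊩ Om.ltQ PTm.zeroQ q) : p ⊩ Om.above ((d.app x).app x) q :=
  have h₁ : p ⊩ Om.isZeroR ((d.app x).app x) := (h.1 x x ⟨hx, hx⟩).2.2.1.2 (eq_refl x)
  (h₁ q).2.2 hq

theorem Om.isMetric.triangle (h : p ⊩ Om.isMetric X d) (hx : p ⊩ Om.mem x X)
    (hy : p ⊩ Om.mem y X) (hz : p ⊩ Om.mem z X) (hq : p ⊩ Om.above ((d.app x).app y) q)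
    (hq' : p ⊩ Om.above ((d.app y).app z) q')
    (ht : ∀ (p' : World) [Le p' p] (M : Model p'), M.κ q + M.κ q' ≤ M.κ t) :
    p ⊩ Om.above ((d.app x).app z) t :=
  above_mono (Om.isMetric.isReal h hx hz) (h.2 x y z ⟨hx, hy, hz⟩ q q' ⟨hq, hq'⟩)
    fun p' _ M => by rw [M.κ_addQ]; exact ht p' M

theorem below_above (hr : p ⊩ Om.isReal r) (h : p ⊩ Om.below q r) (h' : p ⊩ Om.above r q) :
    p ⊩ Om.bot :=
  hr.2.2.2.2.1 q ⟨h, h'⟩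

end Metric

end BISH

/-! ### Pseudoboundedness from sequential continuity -/

namespace BISH

open Srt Tm

/-! ### Sequentially continuous maps on separable spaces -/

section SeqCont

variable {p : World} {σ τ : Srt} {X : PTm (pow σ)} {d : PTm (metric σ)} {Y : PTm (pow τ)}
  {ρ : PTm (metric τ)} {F : PTm (pow (prod σ τ))} {x : PTm σ} {y : PTm τ}

/-- At the places where `i ≤ (K + 1) * s i`, a witness for `s i` is chosen, elsewhere `x` itself.
The resulting sequence converges to `x`, so its images are eventually within `θ` of `y`. Witnesses
have images farther away than that, hence they are eventually not used. -/
theorem pseudobounded_of_seqCont (hX : p ⊩ Om.isMetric X d) (hY : p ⊩ Om.isMetric Y ρ)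
    (hF : p ⊩ Om.isMap X Y F) (hS : p ⊩ Om.seqCont d ρ F) (hxy : p ⊩ Om.mem (x.pair y) F)
    {θ : PTm rat} (hθ : p ⊩ Om.ltQ PTm.zeroQ θ) {s : PTm baire}
    (hs : p ⊩ Om.all fun i => (Om.eq (s.app i) PTm.zero).or (Om.ex fun z => Om.ex fun w =>
      (Om.mem (z.pair w) F).and ((Om.above ((d.app x).app z) (PTm.unit (s.app i))).and
        (Om.below θ ((ρ.app y).app w))))) (K : PTm nat) :
    p ⊩ Om.ex fun N => Om.all fun n => (Om.leN N n).imp (Om.ltN (K.succ.mul (s.app n)) n) := by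
  -- If `s i = 0` no witness is available, but then `i ≤ (K + 1) * s i` can hold only for `i = 0`;
  -- this place is admitted as an exception.
  have key : ∀ i : PTm nat, p ⊩ Om.ex fun z => Om.ex fun w => (Om.mem (z.pair w) F).and
      ((((Om.ltN (K.succ.mul (s.app i)) i).or (Om.eq i PTm.zero)).and
        ((Om.eq z x).and (Om.eq w y))).or ((Om.leN i (K.succ.mul (s.app i))).and
          ((Om.above ((d.app x).app z) (PTm.unit (s.app i))).and
            (Om.below θ ((ρ.app y).app w))))) := by
    intro i
    refine orE (nat_le_total i (K.succ.mul (s.app i))) (fun q _ hq => ?_) fun q _ hq =>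
      exI x (exI y ⟨hxy.up, orI₁ ⟨orI₁ hq, eq_refl _, eq_refl _⟩⟩)
    refine orE (hs i).up (fun r _ hr => exI x (exI y
      ⟨hxy.up, orI₁ ⟨orI₂ (eq_of_model fun M => ?_), eq_refl _, eq_refl _⟩⟩)) fun r _ hr =>
      exE hr fun z r _ hr => exE hr fun w r _ hr => exI z (exI w ⟨hr.1, orI₂ ⟨hq.up, hr.2⟩⟩)
    have h₁ := M.le hq.up
    have h₂ := M.eq hr
    rw [M.ν_mul, h₂, M.ν_zero, mul_zero] at h₁
    rw [M.ν_zero]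
    exact le_antisymm h₁ (M.nonneg i)
  refine countable_choice (Fm.ex τ ((pair v1 v0 ∊ v3) ⩓
      (((ltN (mul v4 (app v5 v2)) v2 ⩔ (v2 ≐ zero)) ⩓ (v1 ≐ v6) ⩓ (v0 ≐ v7)) ⩔
        (leN v2 (mul v4 (app v5 v2)) ⩓ above (app v8 v1) (unitTm (app v5 v2)) ⩓
          below v10 (app v9 v0)))))
    (F ;; K.succ ;; s ;; x ;; y ;; d.app x ;; ρ.app y ;; θ ;; Env.nil) key
    fun z q _ (hz : ∀ i {r : World} [Le r q], r ⊩ Om.ex fun w => (Om.mem ((z.app i).pair w) F).and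
      ((((Om.ltN (K.succ.mul (s.app i)) i).or (Om.eq i PTm.zero)).and
        ((Om.eq (z.app i) x).and (Om.eq w y))).or ((Om.leN i (K.succ.mul (s.app i))).and
          ((Om.above ((d.app x).app (z.app i)) (PTm.unit (s.app i))).and
            (Om.below θ ((ρ.app y).app w)))))) => ?_
  refine countable_choice ((pair (app v2 v1) v0 ∊ v3) ⩓
      (((ltN (mul v4 (app v5 v1)) v1 ⩔ (v1 ≐ zero)) ⩓ (app v2 v1 ≐ v6) ⩓ (v0 ≐ v7)) ⩔
        (leN v1 (mul v4 (app v5 v1)) ⩓ above (app v8 (app v2 v1)) (unitTm (app v5 v1)) ⩓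
          below v10 (app v9 v0))))
    (z ;; F ;; K.succ ;; s ;; x ;; y ;; d.app x ;; ρ.app y ;; θ ;; Env.nil) (fun i => hz i)
    fun w q' _ (hw : ∀ i {r : World} [Le r q'], r ⊩ (Om.mem ((z.app i).pair (w.app i)) F).and
      ((((Om.ltN (K.succ.mul (s.app i)) i).or (Om.eq i PTm.zero)).and
        ((Om.eq (z.app i) x).and (Om.eq (w.app i) y))).or ((Om.leN i (K.succ.mul (s.app i))).and
          ((Om.above ((d.app x).app (z.app i)) (PTm.unit (s.app i))).and
            (Om.below θ ((ρ.app y).app (w.app i))))))) => ?_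
  have hxX := hF.1 x y hxy
  have hwX : ∀ i, q' ⊩ (Om.mem (z.app i) X).and (Om.mem (w.app i) Y) :=
    fun i => hF.1 (z.app i) (w.app i) (hw i).1
  have hconv : q' ⊩ Om.conv d z x := by
    intro ε r _ hε
    -- If `(K + 1) (c + 1) ≤ n ≤ (K + 1) * s n`, then `s n ≥ c + 1`; with this choice of `c` the
    -- distance bound `1 / (s n + 1)` is below `ε`.
    refine exI (K.succ.mul ((PTm.zeroQ.snd.succ).mul ε.snd.succ).succ) fun n r' _ hn => ?_
    refine orE (hw n).2 (fun r₁ _ h₁ => ?_) fun r₁ _ h₁ => ?_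
    · exact above_congr (app_congr (app_congr (eq_refl d) (eq_symm h₁.2.1)) (eq_refl x)) (eq_refl ε)
        (Om.isMetric.above_self hX.up hxX.1.up hε.up)
    · refine above_mono (Om.isMetric.isReal hX.up (hwX n).1.up hxX.1.up)
        (Om.isMetric.above_comm hX.up hxX.1.up (hwX n).1.up h₁.2.1) fun p' _ M => ?_
      have h₂ := exists_unit_lt (hε.up (q := p')) M (s.app n) (by
        have h₃ := M.le (hn.up (q := p'))
        have h₄ := M.le (h₁.1.up (q := p'))
        rw [M.ν_mul] at h₃ h₄
        have h₅ := le_of_mul_le_mul_left (h₃.trans h₄) (by rw [M.ν_succ]; exact M.ν_pos K)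
        rw [M.ν_succ] at h₅
        linarith)
      rw [M.κ_zeroQ] at h₂
      linarith
  -- The successor of `N` is taken to exclude the exceptional place `0`.
  refine exE (hS z x w y ⟨fun n => (hw n).1, hxy.up, hconv⟩ θ hθ.up) fun N r _ hN =>
    exI N.succ fun n r' _ hn => ?_
  refine orE (hw n).2 (fun r₁ _ h₁ => ?_) fun r₁ _ h₁ => botE ?_
  · refine orE h₁.1 (fun _ _ h => h) fun r₂ _ h₂ => botE (bot_of_model fun M => ?_)
    have h₃ := M.le hn.up
    have h₄ := M.eq h₂
    simp only [M.ν_succ, M.ν_zero] at h₃ h₄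
    linarith [M.nonneg N]
  · have h₂ : r₁ ⊩ Om.leN N n := le_of_model fun M => by
      have h₃ := M.le hn.up
      rw [M.ν_succ] at h₃
      linarith
    have h₃ : r₁ ⊩ Om.above ((ρ.app (w.app n)).app y) θ := hN n h₂
    exact below_above (Om.isMetric.isReal hY.up hxX.2.up (hwX n).2.up) h₁.2.2
      (Om.isMetric.above_comm hY.up (hwX n).2.up hxX.2.up h₃)

end SeqCont

end BISH

/-! ### BD-N implies pointwise continuity on separable spaces -/

namespace BISH

open Srt Tm

section SeqCont

variable {p : World} {σ τ : Srt} {X : PTm (pow σ)} {d : PTm (metric σ)} {Y : PTm (pow τ)}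
  {ρ : PTm (metric τ)} {F : PTm (pow (prod σ τ))} {x : PTm σ} {y : PTm τ} {Z : Om}

/-- The composition of two functions. -/
theorem compositionE (g : PTm (fn σ τ)) (f : PTm (fn nat σ))
    (k : ∀ (h : PTm (fn nat τ)) (q : World) [Le q p],
      (q ⊩ Om.all fun n => Om.eq (h.app n) (g.app (f.app n))) → (q ⊩ Z)) : p ⊩ Z :=
  countable_choice (v0 ≐ app v2 (app v3 v1)) (g ;; f ;; Env.nil)
    (fun n => exI (g.app (f.app n)) (eq_refl (g.app (f.app n)))) fun h q _ hh =>
      k h q fun n => hh n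

/-- The constant function with value zero. -/
theorem zeroE (k : ∀ (h : PTm baire) (q : World) [Le q p],
    (q ⊩ Om.all fun n => Om.eq (h.app n) PTm.zero) → (q ⊩ Z)) : p ⊩ Z :=
  countable_choice (v0 ≐ zero) Env.nil
    (fun _ => exI PTm.zero (eq_refl PTm.zero)) fun h q _ hh => k h q fun n => hh n

theorem Om.isReal.located {r : PTm cut} (h : p ⊩ Om.isReal r) (n : PTm nat) :
    p ⊩ (Om.below (PTm.unit n.succ) r).or (Om.above r (PTm.unit n)) :=
  h.2.2.2.2.2 (PTm.unit n.succ) (PTm.unit n)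
    (ltQ_of_model fun M => M.unit_lt (by rw [M.ν_succ]; linarith))

/-- By **BD-N** a sequentially continuous map is continuous as far as a sequence in its domain is
concerned. -/
theorem exists_modulus (hB : p ⊩ BDN.ev Env.nil) (hX : p ⊩ Om.isMetric X d)
    (hY : p ⊩ Om.isMetric Y ρ) (hF : p ⊩ Om.isMap X Y F) (hS : p ⊩ Om.seqCont d ρ F)
    (hxy : p ⊩ Om.mem (x.pair y) F) {e : PTm baire} {a : PTm (fn nat σ)} {b : PTm (fn nat τ)}
    (hb : p ⊩ Om.all fun n => (Om.eq (e.app n) PTm.zero).imp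
      (Om.mem ((a.app n).pair (b.app n)) F)) (η : PTm nat) :
    p ⊩ Om.ex fun N => Om.all fun n => (Om.eq (e.app n) PTm.zero).imp
      ((Om.above ((d.app x).app (a.app n)) (PTm.unit N)).imp
        (Om.above ((ρ.app y).app (b.app n)) (PTm.unit η))) := by
  refine unpairE fun f g p₁ _ hfg => ?_
  have hxX := hF.1 x y hxy
  have hbX : ∀ (n : PTm nat) (q : World) [Le q p], (q ⊩ Om.eq (e.app n) PTm.zero) →
      (q ⊩ (Om.isReal ((d.app x).app (a.app n))).and (Om.isReal ((ρ.app y).app (b.app n)))) := by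
    intro n q _ hq
    have h₁ : q ⊩ (Om.mem (a.app n) X).and (Om.mem (b.app n) Y) := hF.1 _ _ (hb n hq)
    exact ⟨Om.isMetric.isReal hX.up hxX.1.up h₁.1, Om.isMetric.isReal hY.up hxX.2.up h₁.2⟩
  -- The index `k` codes the point `n = f k` and the number `g k`. Locatedness of both distances,
  -- applied between consecutive unit fractions, allows a choice: `g k` is recorded if `a n` is
  -- close to `x` and its image is far from `y`, and `0` if one of these fails in the weaker sense.
  have key : ∀ k : PTm nat, p₁ ⊩ Om.ex fun v =>
      ((Om.eq v PTm.zero).and ((Om.eq (e.app (f.app k)) PTm.zero).imp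
        ((Om.below (PTm.unit (g.app k).succ) ((d.app x).app (a.app (f.app k)))).or
          (Om.above ((ρ.app y).app (b.app (f.app k))) (PTm.unit η))))).or
      ((Om.eq v (g.app k)).and ((Om.eq (e.app (f.app k)) PTm.zero).and
        ((Om.above ((d.app x).app (a.app (f.app k))) (PTm.unit (g.app k))).and
          (Om.below (PTm.unit η.succ) ((ρ.app y).app (b.app (f.app k))))))) := by
    intro k
    refine orE (nat_le_total (e.app (f.app k)) PTm.zero) (fun q _ hq => ?_) fun q _ hq =>
      exI PTm.zero (orI₁ ⟨eq_refl _, fun r _ hr => botE (bot_of_model fun M => ?_)⟩)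
    · have h₀ : q ⊩ Om.eq (e.app (f.app k)) PTm.zero := nat_le_antisymm hq (nat_zero_le _)
      have h₁ := hbX (f.app k) q h₀
      refine orE (Om.isReal.located h₁.1 (g.app k)) (fun r _ hr => exI PTm.zero
        (orI₁ ⟨eq_refl _, fun _ _ _ => orI₁ hr.up⟩)) fun r _ hr => ?_
      refine orE (Om.isReal.located h₁.2.up η) (fun r' _ hr' => exI (g.app k)
        (orI₂ ⟨eq_refl _, h₀.up, hr.up, hr'⟩)) fun r' _ hr' => exI PTm.zero
          (orI₁ ⟨eq_refl _, fun _ _ _ => orI₂ hr'.up⟩)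
    · linarith [M.lt hq.up, M.eq hr]
  refine countable_choice
      (((v0 ≐ zero) ⩓ ((app v4 (app v2 v1) ≐ zero) ⇾
        (below (unitTm (succ (app v3 v1))) (app v5 (app v7 (app v2 v1))) ⩔
          above (app v6 (app v8 (app v2 v1))) (unitTm v9)))) ⩔
      ((v0 ≐ app v3 v1) ⩓ (app v4 (app v2 v1) ≐ zero) ⩓
        above (app v5 (app v7 (app v2 v1))) (unitTm (app v3 v1)) ⩓
        below (unitTm (succ v9)) (app v6 (app v8 (app v2 v1)))))
    (f ;; g ;; e ;; d.app x ;; ρ.app y ;; a ;; b ;; η ;; Env.nil) key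
    fun v p₂ _ (hv : ∀ k {r : World} [Le r p₂], r ⊩
      ((Om.eq (v.app k) PTm.zero).and ((Om.eq (e.app (f.app k)) PTm.zero).imp
        ((Om.below (PTm.unit (g.app k).succ) ((d.app x).app (a.app (f.app k)))).or
          (Om.above ((ρ.app y).app (b.app (f.app k))) (PTm.unit η))))).or
      ((Om.eq (v.app k) (g.app k)).and ((Om.eq (e.app (f.app k)) PTm.zero).and
        ((Om.above ((d.app x).app (a.app (f.app k))) (PTm.unit (g.app k))).and
          (Om.below (PTm.unit η.succ) ((ρ.app y).app (b.app (f.app k)))))))) => ?_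
  -- `A` is the range of `v`, hence inhabited and countable. By construction each of its elements is
  -- `0` or has a witness, as `pseudobounded_of_seqCont` requires.
  refine compE (Fm.ex nat (app v2 v0 ≐ v1)) (v ;; Env.nil) fun A p₃ _
    (hA : ∀ m {r : World} [Le r p₃], (r ⊩ Om.mem m A) ↔
      (r ⊩ Om.ex fun k => Om.eq (v.app k) m)) => ?_
  refine zeroE fun e' p₄ _ he' => ?_
  have hI : p₄ ⊩ Om.ex fun m => Om.mem m A :=
    exI (v.app PTm.zero) ((hA _).2 (exI PTm.zero (eq_refl _)))
  have hC : p₄ ⊩ Om.countbl A := exI e' <| exI v fun m =>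
    ⟨fun q _ hq => exE ((hA m).1 hq) fun k r _ hk => exI k ⟨(he' k).up, hk⟩,
      fun q _ hq => (hA m).2 (exE hq fun k r _ hk => exI k hk.2)⟩
  have hP : p₄ ⊩ Om.pseudobounded A := by
    intro s q _ hs K
    refine pseudobounded_of_seqCont hX.up hY.up hF.up hS.up hxy.up (unit_pos η.succ) (fun i => ?_) K
    refine exE ((hA _).1 (hs i)) fun k r _ hk => ?_
    refine orE (hv k) (fun r' _ h => orI₁ (eq_trans (eq_symm hk.up) h.1)) fun r' _ h =>
      orI₂ (exI (a.app (f.app k)) (exI (b.app (f.app k)) ⟨hb (f.app k) h.2.1, ?_, h.2.2.2⟩))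
    exact above_congr (eq_refl _) (unit_congr (eq_trans (eq_symm h.1) hk.up)) h.2.2.1
  have hN : p₄ ⊩ Om.ex fun N => Om.all fun m => (Om.mem m A).imp (Om.leN m N) :=
    hB A ⟨hI, hC, hP⟩
  -- The bound `N` is tested with the pair `(n, N + 1)`. Since `N + 1` is not in `A`, the entry is
  -- of the first kind: the distance of `a n` from `x` exceeds `1 / (N + 3)`, or the image is close
  -- to `y`. The radius `1 / (N + 3)`, written with `N + 2`, excludes the former.
  refine exE hN fun N q _ hN => exI N.succ.succ fun n q' _ hn r _ hr => ?_
  refine exE (hfg n N.succ).up fun k r' _ hk => ?_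
  refine orE (hv k) (fun r₁ _ h₁ => ?_) fun r₁ _ h₁ => botE ?_
  · have h₂ : r₁ ⊩ Om.eq (e.app (f.app k)) PTm.zero :=
      eq_trans (app_congr (eq_refl e) hk.1.up) hn.up
    refine orE (h₁.2 h₂) (fun r₂ _ h₃ => botE ?_) fun r₂ _ h₃ => ?_
    · refine below_above (hbX n r₂ hn.up).1 (below_congr ?_ ?_ h₃) hr.up
      · exact unit_congr (succ_congr hk.2.up)
      · exact app_congr (eq_refl _) (app_congr (eq_refl a) hk.1.up)
    · exact above_congr (app_congr (eq_refl _) (app_congr (eq_refl b) hk.1.up)) (eq_refl _) h₃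
  · have h₂ : r₁ ⊩ Om.leN (v.app k) N := hN (v.app k) ((hA _).2 (exI k (eq_refl _)))
    exact bot_of_model fun M => by
      have h₃ := M.le h₂
      have h₄ := M.eq h₁.1
      have h₅ := M.eq hk.2.up
      rw [M.ν_succ] at h₅
      linarith

/-- The modulus from `exists_modulus` concerns only the dense points. For arbitrary `x'`, sequential
continuity is used once more, at `x'`: a dense point close enough to `x'` lies within the modulus of
`x` and has its image near `y'`. -/
theorem ptCont_of_bdn (hB : p ⊩ BDN.ev Env.nil) (hX : p ⊩ Om.isMetric X d)
    (hD : p ⊩ Om.separable X d) (hY : p ⊩ Om.isMetric Y ρ) (hF : p ⊩ Om.isMap X Y F)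
    (hS : p ⊩ Om.seqCont d ρ F) : p ⊩ Om.ptCont d ρ F := by
  refine exE hD fun D p₁ _ hD => exE hD.1 fun e p₂ _ he => exE he fun a p₃ _ ha => ?_
  have haX : ∀ (n : PTm nat) (q : World) [Le q p₃], (q ⊩ Om.eq (e.app n) PTm.zero) →
      (q ⊩ Om.mem (a.app n) X) :=
    fun n q _ hq => hD.2.1 (a.app n) ((ha (a.app n)).2 (exI n ⟨hq, eq_refl _⟩))
  intro x y p₄ _ hxy ε p₅ _ hε
  have hxX := hF.1 x y hxy
  refine countable_choice ((app v2 v1 ≐ zero) ⇾ (pair (app v3 v1) v0 ∊ v4))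
    (e ;; a ;; F ;; Env.nil) (fun n => ?_) fun b q _ (hb : ∀ n {r : World} [Le r q],
      r ⊩ (Om.eq (e.app n) PTm.zero).imp (Om.mem ((a.app n).pair (b.app n)) F)) => ?_
  · show p₅ ⊩ Om.ex fun w => (Om.eq (e.app n) PTm.zero).imp (Om.mem ((a.app n).pair w) F)
    refine orE (nat_le_total (e.app n) PTm.zero) (fun q _ hq => ?_) fun q _ hq =>
      exI y fun r _ hr => botE (bot_of_model fun M => by linarith [M.lt hq.up, M.eq hr])
    exact exE (hF.2.1 (a.app n) (haX n q (nat_le_antisymm hq (nat_zero_le _))))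
      fun w r _ hw => exI w fun _ _ _ => hw.up
  obtain ⟨m, hm⟩ : ∃ m, m = (PTm.zeroQ.snd.succ).mul ε.snd.succ := ⟨_, rfl⟩
  -- With `η = 2 m + 1`, twice `1 / (η + 1)` is `1 / (m + 1)`, and `m` was chosen so that this is
  -- less than `ε`.
  obtain ⟨η, hη⟩ : ∃ η, η = (m.add m).succ := ⟨_, rfl⟩
  have hη : ∀ (r : World) [Le r p₅] (M : Model r),
      M.κ (PTm.unit η) + M.κ (PTm.unit η) ≤ M.κ ε := by
    intro r _ M
    have h₁ := exists_unit_lt (hε.up (q := r)) M m (by rw [hm])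
    rw [M.κ_zeroQ, M.κ_unit, zero_add] at h₁
    have h₂ := M.ν_pos m
    have h₃ : 1 / (M.ν m + M.ν m + 1 + 1) + 1 / (M.ν m + M.ν m + 1 + 1) = 1 / (M.ν m + 1) := by
      have : M.ν m + M.ν m + 1 + 1 = 2 * (M.ν m + 1) := by ring
      rw [this]
      field_simp
      norm_num
    simp only [M.κ_unit, hη, M.ν_succ, M.ν_add]
    rw [h₃]
    exact h₁.le
  refine exE (exists_modulus hB.up hX.up hY.up hF.up hS.up hxy.up (fun n => hb n) η)
    fun N q₁ _ hN => exI (PTm.unit N) ⟨unit_pos N, fun x' y' q₂ _ h' => ?_⟩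
  have hx'X : q₂ ⊩ (Om.mem x' X).and (Om.mem y' Y) := hF.1 x' y' h'.1
  -- Roundedness supplies a rational `t < 1 / (N + 1)` that still bounds the distance of `x` and
  -- `x'`. The gap leaves room for the approximation of `x'`.
  refine exE (((Om.isMetric.isReal hX.up hxX.1.up hx'X.1).2.2.2.1 (PTm.unit N)).1 h'.2)
    fun t q₃ _ ht => ?_
  refine countable_choice ((app v2 v0 ≐ zero) ⩓ above (app v3 (app v4 v0)) (unitTm v1))
    (e ;; d.app x' ;; a ;; Env.nil) (fun i => ?_) fun j q₄ _ (hj : ∀ i {r : World} [Le r q₄],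
      r ⊩ (Om.eq (e.app (j.app i)) PTm.zero).and
        (Om.above ((d.app x').app (a.app (j.app i))) (PTm.unit i))) => ?_
  · show q₃ ⊩ Om.ex fun n => (Om.eq (e.app n) PTm.zero).and
      (Om.above ((d.app x').app (a.app n)) (PTm.unit i))
    refine exE (hD.2.2 x' hx'X.1 (PTm.unit i) (unit_pos i) : q₃ ⊩ _) fun z r _ hz => ?_
    refine exE ((ha z).1 hz.1) fun n r' _ hn => exI n ⟨hn.1, ?_⟩
    exact above_congr (app_congr (eq_refl _) (eq_symm hn.2)) (eq_refl _) hz.2.up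
  refine compositionE a j fun z q₅ _ hz => compositionE b j fun w q₆ _ hw => ?_
  have hzw : ∀ i, q₆ ⊩ Om.mem ((z.app i).pair (w.app i)) F := fun i =>
    mem_congr (pair_congr (eq_symm (hz i).up) (eq_symm (hw i))) (eq_refl F)
      (hb (j.app i) (r := q₆) (hj i).1)
  have hzX : ∀ i, q₆ ⊩ (Om.mem (z.app i) X).and (Om.mem (w.app i) Y) := fun i => hF.1 _ _ (hzw i)
  have hxz : ∀ i, q₆ ⊩ Om.above ((d.app x').app (z.app i)) (PTm.unit i) := fun i =>
    above_congr (app_congr (eq_refl _) (eq_symm (hz i).up)) (eq_refl _) (hj i).2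
  have hconv : q₆ ⊩ Om.conv d z x' := by
    intro ε' r _ hε'
    refine exI ((PTm.zeroQ.snd.succ).mul ε'.snd.succ) fun n r' _ hn => ?_
    refine above_mono (Om.isMetric.isReal hX.up (hzX n).1.up hx'X.1.up)
      (Om.isMetric.above_comm hX.up hx'X.1.up (hzX n).1.up (hxz n).up) fun p' _ M => ?_
    have h₁ := exists_unit_lt (hε'.up (q := p')) M n (M.le hn.up)
    rw [M.κ_zeroQ] at h₁
    linarith
  refine exE (hS z x' w y' ⟨hzw, h'.1.up, hconv⟩ (PTm.unit η) (unit_pos η)) fun N' r _ hN' => ?_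
  -- The index is past `N'`, for the images, and so large that `t + 1 / (i + 1) < 1 / (N + 1)`.
  obtain ⟨i, hi⟩ : ∃ i, i = N'.add ((t.snd.succ).mul (PTm.unit N).snd.succ) := ⟨_, rfl⟩
  have h₁ : r ⊩ Om.leN N' i := le_of_model fun M => by
    rw [hi, M.ν_add]
    linarith [M.nonneg ((t.snd.succ).mul (PTm.unit N).snd.succ)]
  have h₂ : r ⊩ Om.above ((ρ.app (w.app i)).app y') (PTm.unit η) := hN' i h₁
  have h₃ : r ⊩ Om.above ((d.app x).app (z.app i)) (PTm.unit N) := by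
    refine Om.isMetric.triangle hX.up hxX.1.up hx'X.1.up (hzX i).1.up ht.2.up (hxz i).up
      fun p' _ M => (exists_unit_lt (ht.1.up (q := p')) M i ?_).le
    rw [hi, M.ν_add]
    linarith [M.nonneg N']
  have h₄ : r ⊩ Om.above ((ρ.app y).app (b.app (j.app i))) (PTm.unit η) :=
    hN (j.app i) (hj i (r := r)).1
      (above_congr (app_congr (eq_refl _) (hz i).up) (eq_refl _) h₃)
  refine Om.isMetric.triangle hY.up hxX.2.up (hzX i).2.up hx'X.2.up
    (above_congr (app_congr (eq_refl _) (eq_symm (hw i).up)) (eq_refl _) h₄) h₂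
    fun p' _ M => hη p' M

theorem seqContMetric_of_bdn (hB : p ⊩ BDN.ev Env.nil) :
    p ⊩ (SeqContMetric σ τ).ev Env.nil :=
  fun X d Y ρ F _ _ h => ptCont_of_bdn (X := X) (d := d) (Y := Y) (ρ := ρ) (F := F)
    hB.up h.1 h.2.1 h.2.2.1 h.2.2.2.1 h.2.2.2.2

end SeqCont

end BISH

/-! ### Baire space as a metric space, and metrics pulled back from it -/

namespace BISH

open Srt Tm

/-! ### The metric of Baire space -/

/-- `r` is the distance of `α` and `β`, which is `1 / (m + 1)` if `m` is the length of the longest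
common initial segment. -/
def IsDist {Γ : Ctx} (r : Tm Γ cut) (α β : Tm Γ baire) : Fm Γ :=
  (All rat fun q => below q ↟r ⟺ (ltQ q zeroQ ⩔ Ex nat fun m =>
    Fm.neg (Agree (succ m) ↟α ↟β) ⩓ ltQ q (unitTm m))) ⩓
  (All rat fun q => above ↟r q ⟺ Ex nat fun m => Agree m ↟α ↟β ⩓ ltQ (unitTm m) q)

/-- `r` is the distance of `α` and `β`. -/
def Om.isDist (r : PTm cut) (α β : PTm baire) : Om :=
  (all fun q => (below q r).iff ((ltQ q PTm.zeroQ).or (ex fun m =>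
    (neg (agree m.succ α β)).and (ltQ q (PTm.unit m))))).and
  (all fun q => (above r q).iff (ex fun m => (agree m α β).and (ltQ (PTm.unit m) q)))

section Agree

variable {p : World} {α β γ : PTm baire} {m n : PTm nat}

theorem agree_symm (h : p ⊩ Om.agree m α β) : p ⊩ Om.agree m β α :=
  fun i _ _ hi => eq_symm (h i hi)

theorem agree_trans (h : p ⊩ Om.agree m α β) (h' : p ⊩ Om.agree m β γ) : p ⊩ Om.agree m α γ :=
  fun i _ _ hi => eq_trans (h i hi) (h' i hi)

theorem agree_mono (hm : p ⊩ Om.leN n m) (h : p ⊩ Om.agree m α β) : p ⊩ Om.agree n α β :=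
  fun i _ _ hi => h i (nat_le_trans hi hm.up)

theorem agree_of_eq (h : p ⊩ Om.eq α β) : p ⊩ Om.agree m α β :=
  fun i _ _ _ => app_congr h.up (eq_refl i)

theorem agree_zero (α β : PTm baire) : p ⊩ Om.agree PTm.zero α β :=
  fun i _ _ hi => botE (bot_of_model fun M => by
    have := M.lt hi
    rw [M.ν_zero] at this
    linarith [M.nonneg i])

theorem agree_succ (h : p ⊩ Om.agree m α β) (h' : p ⊩ Om.eq (α.app m) (β.app m)) :
    p ⊩ Om.agree m.succ α β := by
  intro i q _ hi
  refine orE (nat_le_total m i) (fun r _ hr => ?_) fun r _ hr => h i hr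
  have e : r ⊩ Om.eq i m := eq_of_model fun M => by
    have h₁ := M.lt hi.up
    rw [M.ν_succ] at h₁
    linarith [M.le hr]
  exact eq_trans (app_congr (eq_refl α) e) (eq_trans h'.up (app_congr (eq_refl β) (eq_symm e)))

/-- Two sequences agree on their first `m` terms, or there is a first place where they differ. -/
theorem agree_or (α β : PTm baire) (m : PTm nat) : p ⊩ (Om.agree m α β).or
    (Om.ex fun i => (Om.agree i α β).and (Om.neg (Om.agree i.succ α β))) := by
  have step : ∀ (m : PTm nat) (q : World) [Le q p], (q ⊩ (Om.agree m α β).or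
      (Om.ex fun i => (Om.agree i α β).and (Om.neg (Om.agree i.succ α β)))) →
      (q ⊩ (Om.agree m.succ α β).or
      (Om.ex fun i => (Om.agree i α β).and (Om.neg (Om.agree i.succ α β)))) := by
    intro m q _ h
    refine orE h (fun r _ hr => ?_) fun r _ hr => orI₂ hr
    have hlt : r ⊩ Om.ltN m m.succ := lt_of_model fun M => by rw [M.ν_succ]; linarith
    refine orE (nat_eq_or_lt_or_gt (α.app m) (β.app m)) (fun r' _ h' => orI₁ (agree_succ hr.up h'))
      fun r' _ h' => orI₂ (exI m ⟨hr.up, fun r₁ _ h₁ => ?_⟩)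
    have h₂ : r₁ ⊩ Om.eq (α.app m) (β.app m) := h₁ m hlt.up
    exact orE h'.up (fun r₂ _ h₃ => bot_of_model fun M => by linarith [M.lt h₃, M.eq h₂.up])
      fun r₂ _ h₃ => bot_of_model fun M => by linarith [M.lt h₃, M.eq h₂.up]
  exact induction (Agree v0 v1 v2 ⩔ Fm.ex nat (Agree v0 v2 v3 ⩓ Fm.neg (Agree (succ v0) v2 v3)))
    (α ;; β ;; Env.nil) (orI₁ (agree_zero α β)) step m

end Agree

section Rationals

variable {p : World} {q r s : PTm rat} {m n : PTm nat}

theorem ltQ_trans (h : p ⊩ Om.ltQ q r) (h' : p ⊩ Om.ltQ r s) : p ⊩ Om.ltQ q s :=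
  ltQ_of_model fun M => (M.ltQ h).trans (M.ltQ h')

theorem ltQ_or (h : p ⊩ Om.ltQ q r) (s : PTm rat) : p ⊩ (Om.ltQ q s).or (Om.ltQ s r) :=
  forces_of_model fun M => by
    rw [M.Q.sat_or, M.sat_ltQ, M.sat_ltQ]
    exact (lt_or_ge _ _).imp_right fun h' => h'.trans_lt (M.ltQ h)

theorem exists_ltQ_ltQ (h : p ⊩ Om.ltQ q r) : p ⊩ Om.ex fun s => (Om.ltQ q s).and (Om.ltQ s r) := by
  refine exI (q.addQ (PTm.unit ((q.snd.succ).mul r.snd.succ)))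
    ⟨ltQ_of_model fun M => ?_, ltQ_of_model fun M => ?_⟩
  · have := M.ltQ (unit_pos ((q.snd.succ).mul r.snd.succ))
    rw [M.κ_zeroQ] at this
    rw [M.κ_addQ]
    linarith
  · rw [M.κ_addQ]
    exact exists_unit_lt h M _ le_rfl

theorem exists_unit_ltQ (h : p ⊩ Om.ltQ PTm.zeroQ q) : p ⊩ Om.ex fun m => Om.ltQ (PTm.unit m) q :=
  exI ((PTm.zeroQ.snd.succ).mul q.snd.succ) <| ltQ_of_model fun M => by
    have := exists_unit_lt h M _ le_rfl
    rwa [M.κ_zeroQ, zero_add] at this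

theorem lt_of_unit_ltQ (h : p ⊩ Om.ltQ (PTm.unit m) (PTm.unit n)) : p ⊩ Om.ltN n m :=
  lt_of_model fun M => by
    by_contra hmn
    exact absurd (M.ltQ h) (not_lt.2 (M.unit_le (not_lt.1 hmn)))

theorem exists_ltQ_zero : p ⊩ Om.ex fun q => Om.ltQ q PTm.zeroQ := by
  refine exI ((PTm.zero.pair PTm.zero.succ).pair PTm.zero) (ltQ_of_model fun M => ?_)
  have h₁ : M.ν ((PTm.zero.pair PTm.zero.succ).pair PTm.zero).fst.fst = M.ν PTm.zero :=
    M.eq (eq_trans (fst_congr (fst_pair _ _)) (fst_pair _ _))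
  have h₂ : M.ν ((PTm.zero.pair PTm.zero.succ).pair PTm.zero).fst.snd = M.ν PTm.zero.succ :=
    M.eq (eq_trans (snd_congr (fst_pair _ _)) (snd_pair _ _))
  rw [M.κ_zeroQ, Model.κ, h₁, h₂, M.ν_succ, M.ν_zero]
  exact div_neg_of_neg_of_pos (by linarith) (M.ν_pos _)

end Rationals

section Dist

variable {p : World} {α β γ : PTm baire} {r s t : PTm cut}

theorem Om.isDist.isReal (h : p ⊩ Om.isDist r α β) : p ⊩ Om.isReal r := by
  refine ⟨?_, ?_, fun q => ⟨fun p' _ hq => ?_, fun p' _ hq => ?_⟩,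
    fun q => ⟨fun p' _ hq => ?_, fun p' _ hq => ?_⟩, fun q p' _ hq => ?_, fun q q' p' _ hq => ?_⟩
  · exact exE exists_ltQ_zero fun q p' _ hq => exI q ((h.1 q).2 (orI₁ hq))
  · refine exI (PTm.frac PTm.zero.succ.succ PTm.zero) ((h.2 _).2 (exI PTm.zero
      ⟨agree_zero α β, ltQ_of_model fun M => ?_⟩))
    rw [M.κ_unit, M.κ_frac, M.ν_succ, M.ν_succ, M.ν_zero]
    norm_num
  · refine orE ((h.1 q).1 hq) (fun p₁ _ h₁ => ?_) fun p₁ _ h₁ => exE h₁ fun m p₂ _ h₂ => ?_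
    · exact exE (exists_ltQ_ltQ h₁) fun t p₂ _ h₂ => exI t ⟨h₂.1, (h.1 t).2 (orI₁ h₂.2)⟩
    · exact exE (exists_ltQ_ltQ h₂.2) fun t p₃ _ h₃ =>
        exI t ⟨h₃.1, (h.1 t).2 (orI₂ (exI m ⟨h₂.1.up, h₃.2⟩))⟩
  · refine exE hq fun t p₁ _ ht => (h.1 q).2 (orE ((h.1 t).1 ht.2)
      (fun p₂ _ h₂ => orI₁ (ltQ_trans ht.1.up h₂)) fun p₂ _ h₂ => orI₂ (exE h₂ fun m p₃ _ h₃ =>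
        exI m ⟨h₃.1, ltQ_trans ht.1.up h₃.2⟩))
  · exact exE ((h.2 q).1 hq) fun m p₁ _ h₁ => exE (exists_ltQ_ltQ h₁.2) fun t p₂ _ h₂ =>
      exI t ⟨h₂.2, (h.2 t).2 (exI m ⟨h₁.1.up, h₂.1⟩)⟩
  · exact exE hq fun t p₁ _ ht => (h.2 q).2 (exE ((h.2 t).1 ht.2) fun m p₂ _ h₂ =>
      exI m ⟨h₂.1, ltQ_trans h₂.2 ht.1.up⟩)
  · refine exE ((h.2 q).1 hq.2) fun m p₁ _ h₁ => orE ((h.1 q).1 hq.1.up)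
      (fun p₂ _ h₂ => bot_of_model fun M => ?_) fun p₂ _ h₂ => exE h₂ fun i p₃ _ h₃ => ?_
    · exact lt_irrefl _ (((M.ltQ h₁.2.up).trans (M.ltQ h₂)).trans (M.ltQ (unit_pos m)))
    · exact h₃.1 (agree_mono (lt_of_unit_ltQ (ltQ_trans h₁.2.up h₃.2)) h₁.1.up)
  -- Locatedness: unless `q < 0`, some `1 / (m + 1)` lies below `q'`. Comparing `m` terms either
  -- shows that the distance is below `q'` or finds the first difference, which determines the
  -- distance.
  · refine orE (ltQ_or hq PTm.zeroQ) (fun p₁ _ h₁ => orI₁ ((h.1 q).2 (orI₁ h₁))) fun p₁ _ h₁ => ?_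
    refine exE (exists_unit_ltQ h₁) fun m p₂ _ hm => orE (agree_or α β m)
      (fun p₃ _ h₃ => orI₂ ((h.2 q').2 (exI m ⟨h₃, hm.up⟩))) fun p₃ _ h₃ => exE h₃ fun i p₄ _ h₄ => ?_
    exact orE (ltQ_or hq.up (PTm.unit i)) (fun p₅ _ h₅ => orI₁ ((h.1 q).2 (orI₂ (exI i
      ⟨h₄.2.up, h₅⟩)))) fun p₅ _ h₅ => orI₂ ((h.2 q').2 (exI i ⟨h₄.1.up, h₅⟩))

theorem Om.isDist.isZero_iff (h : p ⊩ Om.isDist r α β) :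
    p ⊩ (Om.isZeroR r).iff (Om.eq α β) := by
  refine ⟨fun q _ hq => fn_ext fun i => ?_, fun q _ hq t =>
    ⟨⟨fun q' _ h' => ?_, fun q' _ h' => (h.1 t).2 (orI₁ h')⟩,
      ⟨fun q' _ h' => ?_, fun q' _ h' => ?_⟩⟩⟩
  · refine exE ((h.2 (PTm.unit i)).1 ((hq (PTm.unit i)).2.2 (unit_pos i))) fun m q' _ hm =>
      hm.1 i (lt_of_unit_ltQ hm.2)
  · exact orE ((h.1 t).1 h') (fun _ _ h => h) fun p₁ _ h₁ => exE h₁ fun m p₂ _ h₂ =>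
      botE (h₂.1 (agree_of_eq hq.up))
  · exact exE ((h.2 t).1 h') fun m p₁ _ h₁ => ltQ_trans (unit_pos m) h₁.2
  · exact (h.2 t).2 (exE (exists_unit_ltQ h') fun m p₁ _ h₁ => exI m ⟨agree_of_eq hq.up, h₁⟩)

theorem Om.isDist.symm (h : p ⊩ Om.isDist r α β) : p ⊩ Om.isDist r β α := by
  refine ⟨fun q => ⟨fun p' _ hq => ?_, fun p' _ hq => (h.1 q).2 ?_⟩,
    fun q => ⟨fun p' _ hq => ?_, fun p' _ hq => (h.2 q).2 ?_⟩⟩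
  · exact orE ((h.1 q).1 hq) (fun _ _ h => orI₁ h) fun _ _ h₁ => orI₂ (exE h₁ fun m _ _ h₂ =>
      exI m ⟨fun _ _ h₃ => h₂.1 (agree_symm h₃), h₂.2⟩)
  · exact orE hq (fun _ _ h => orI₁ h) fun _ _ h₁ => orI₂ (exE h₁ fun m _ _ h₂ =>
      exI m ⟨fun _ _ h₃ => h₂.1 (agree_symm h₃), h₂.2⟩)
  · exact exE ((h.2 q).1 hq) fun m _ _ h₁ => exI m ⟨agree_symm h₁.1, h₁.2⟩
  · exact exE hq fun m _ _ h₁ => exI m ⟨agree_symm h₁.1, h₁.2⟩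

theorem Om.isDist.unique (h : p ⊩ Om.isDist r α β) (h' : p ⊩ Om.isDist s α β) : p ⊩ Om.eq r s := by
  refine eq_trans (eq_symm (pair_eta r)) (eq_trans (pair_congr ?_ ?_) (pair_eta s))
  · exact pow_ext fun q => ⟨fun _ _ hq => (h'.1 q).2 ((h.1 q).1 hq),
      fun _ _ hq => (h.1 q).2 ((h'.1 q).1 hq)⟩
  · exact pow_ext fun q => ⟨fun _ _ hq => (h'.2 q).2 ((h.2 q).1 hq),
      fun _ _ hq => (h.2 q).2 ((h'.2 q).1 hq)⟩

/-- The distance is even an ultrametric: `α` and `γ` agree on as many terms as the shorter of the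
two agreements, and the remaining summand is positive. -/
theorem Om.isDist.triangle (hr : p ⊩ Om.isDist r α β) (hs : p ⊩ Om.isDist s β γ)
    (ht : p ⊩ Om.isDist t α γ) : p ⊩ Om.leAddR t r s := by
  intro q q' p' _ h
  refine (ht.2 _).2 (exE ((hr.2 q).1 h.1) fun m p₁ _ hm => exE ((hs.2 q').1 h.2.up)
    fun m' p₂ _ hm' => orE (nat_le_total m m') (fun p₃ _ h₃ => exI m
      ⟨agree_trans hm.1.up (agree_mono h₃ hm'.1.up), ltQ_of_model fun M => ?_⟩)
      fun p₃ _ h₃ => exI m' ⟨agree_trans (agree_mono ?_ hm.1.up) hm'.1.up,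
        ltQ_of_model fun M => ?_⟩)
  · have h₄ := M.ltQ (unit_pos m')
    rw [M.κ_zeroQ] at h₄
    rw [M.κ_addQ]
    linarith [M.ltQ hm.2.up, M.ltQ hm'.2.up]
  · exact le_of_model fun M => by linarith [M.lt h₃]
  · have h₄ := M.ltQ (unit_pos m)
    rw [M.κ_zeroQ] at h₄
    rw [M.κ_addQ]
    linarith [M.ltQ hm.2.up, M.ltQ hm'.2.up]

theorem exists_isDist (α β : PTm baire) : p ⊩ Om.ex fun r => Om.isDist r α β := by
  refine compE (ltQ v0 zeroQ ⩔ Fm.ex nat (Fm.neg (Agree (succ v0) v2 v3) ⩓ ltQ v1 (unitTm v0)))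
    (α ;; β ;; Env.nil) fun L q _ (hL : ∀ t {r : World} [Le r q], (r ⊩ Om.mem t L) ↔
      (r ⊩ (Om.ltQ t PTm.zeroQ).or (Om.ex fun m =>
        (Om.neg (Om.agree m.succ α β)).and (Om.ltQ t (PTm.unit m))))) => ?_
  refine compE (Fm.ex nat (Agree v0 v2 v3 ⩓ ltQ (unitTm v0) v1))
    (α ;; β ;; Env.nil) fun U q' _ (hU : ∀ t {r : World} [Le r q'], (r ⊩ Om.mem t U) ↔
      (r ⊩ Om.ex fun m => (Om.agree m α β).and (Om.ltQ (PTm.unit m) t))) => ?_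
  refine exI (L.pair U) ⟨fun t => ⟨fun r _ h => (hL t).1 ?_, fun r _ h => ?_⟩,
    fun t => ⟨fun r _ h => (hU t).1 ?_, fun r _ h => ?_⟩⟩
  · exact mem_congr (eq_refl t) (fst_pair L U) h
  · exact mem_congr (eq_refl t) (eq_symm (fst_pair L U)) ((hL t).2 h)
  · exact mem_congr (eq_refl t) (snd_pair L U) h
  · exact mem_congr (eq_refl t) (eq_symm (snd_pair L U)) ((hU t).2 h)

end Dist

section Pullback

variable {p : World} {σ : Srt} {ι : PTm (fn σ baire)} {d : PTm (metric σ)} {U : PTm (pow σ)}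
  {X : Om}

/-- The distance on the sort `σ` that is induced by a map to Baire space. -/
theorem distE (ι : PTm (fn σ baire)) (k : ∀ (d : PTm (metric σ)) (q : World) [Le q p],
    (q ⊩ Om.all fun x => Om.all fun y => Om.isDist ((d.app x).app y) (ι.app x) (ι.app y)) →
      (q ⊩ X)) : p ⊩ X := by
  have key : ∀ x : PTm σ, p ⊩ Om.ex fun h : PTm (fn σ cut) => Om.all fun y =>
      Om.isDist (h.app y) (ι.app x) (ι.app y) := fun x =>
    unique_choice (IsDist v0 (app v3 v2) (app v3 v1)) (x ;; ι ;; Env.nil)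
      (fun y => exists_isDist (ι.app x) (ι.app y))
      (fun y _ _ _ _ h h' => Om.isDist.unique (α := ι.app x) (β := ι.app y) h h')
      fun h q _ hh => exI h fun y => hh y
  exact unique_choice (Fm.all σ (IsDist (app v1 v0) (app v3 v2) (app v3 v0))) (ι ;; Env.nil) key
    (fun x _ _ _ _ h h' => fn_ext fun y =>
      Om.isDist.unique (α := ι.app x) (β := ι.app y) (h y) (h' y))
    fun d q _ hd => k d q fun x y => hd x y

/-- Injectivity of `ι` is needed only for points at distance zero to be equal. The lemma serves
Baire space, with the identity, and `ℕ`, with the constant sequences, where it yields the discrete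
metric. -/
theorem isMetric_of_isDist (hι : ∀ (x y : PTm σ) (q : World) [Le q p],
      (q ⊩ Om.eq (ι.app x) (ι.app y)) → (q ⊩ Om.eq x y))
    (hd : p ⊩ Om.all fun x => Om.all fun y => Om.isDist ((d.app x).app y) (ι.app x) (ι.app y)) :
    p ⊩ Om.isMetric U d := by
  refine ⟨fun x y q _ _ => ⟨(Om.isDist.isReal (hd x y)).up, fun t r _ ht =>
    ((hd x y).1 t).2 (orI₁ ht), ⟨fun r _ hr => ?_, fun r _ hr => ?_⟩,
    (Om.isDist.unique (hd x y) (Om.isDist.symm (hd y x))).up⟩, fun x y z q _ _ => ?_⟩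
  · exact hι x y r ((Om.isDist.isZero_iff (hd x y)).1 hr)
  · exact (Om.isDist.isZero_iff (hd x y)).2 (app_congr (eq_refl ι) hr)
  · exact (Om.isDist.triangle (hd x y) (hd y z) (hd x z)).up

theorem conv_of_agree (hd : p ⊩ Om.all fun x => Om.all fun y =>
      Om.isDist ((d.app x).app y) (ι.app x) (ι.app y)) {s : PTm (fn nat σ)} {x : PTm σ}
    (h : p ⊩ Om.all fun k => Om.ex fun N => Om.all fun n => (Om.leN N n).imp
      (Om.agree k (ι.app (s.app n)) (ι.app x))) : p ⊩ Om.conv d s x :=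
  fun ε _ _ hε => exE (exists_unit_ltQ hε) fun m _ _ hm => exE (h m).up fun N _ _ hN =>
    exI N fun n _ _ hn => ((hd (s.app n) x).2 ε).2 (exI m ⟨hN n hn, hm.up⟩)

theorem agree_of_above (hd : p ⊩ Om.all fun x => Om.all fun y =>
      Om.isDist ((d.app x).app y) (ι.app x) (ι.app y)) {x y : PTm σ} {k : PTm nat}
    (h : p ⊩ Om.above ((d.app x).app y) (PTm.unit k)) :
    p ⊩ Om.agree k.succ (ι.app x) (ι.app y) :=
  exE (((hd x y).2 (PTm.unit k)).1 h) fun _ _ _ hm => agree_mono (lt_of_unit_ltQ hm.2) hm.1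

end Pullback

end BISH

/-! ### Separability of Baire space and the remaining implications -/

namespace BISH

open Srt Tm

/-! ### Baire space is separable -/

section Dense

variable {p : World} {X : Om}

/-- The sequence with first term `n` and remaining terms `α`. -/
theorem exists_cons (n : PTm nat) (α : PTm baire) : p ⊩ Om.ex fun β =>
    (Om.eq (β.app PTm.zero) n).and (Om.all fun j => Om.eq (β.app j.succ) (α.app j)) := by
  refine countable_choice (((v1 ≐ zero) ⩓ (v0 ≐ v2)) ⩔ (Fm.ex nat ((v2 ≐ succ v0) ⩓
      (v1 ≐ app v4 v0)))) (n ;; α ;; Env.nil) (fun i => ?_)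
    fun β q _ (hβ : ∀ i {r : World} [Le r q], r ⊩ ((Om.eq i PTm.zero).and (Om.eq (β.app i) n)).or
      (Om.ex fun j => (Om.eq i j.succ).and (Om.eq (β.app i) (α.app j)))) => exI β ⟨?_, fun j => ?_⟩
  · refine orE (nat_cases i) (fun q _ hq => exI n (orI₁ ⟨hq, eq_refl n⟩)) fun q _ hq =>
      exE hq fun j r _ hj => exI (α.app j) (orI₂ (exI j ⟨hj, eq_refl (α.app j)⟩))
  · exact orE (hβ PTm.zero) (fun _ _ h => h.2) fun r _ h => exE h fun j r' _ h' =>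
      botE (nat_succ_ne_zero (eq_symm h'.1))
  · exact orE (hβ j.succ) (fun _ _ h => botE (nat_succ_ne_zero h.1)) fun r _ h =>
      exE h fun j' r' _ h' => eq_trans h'.2 (app_congr (eq_refl α) (eq_symm (nat_succ_inj h'.1)))

theorem exists_tail (α : PTm baire) : p ⊩ Om.ex fun β =>
    Om.all fun j => Om.eq (β.app j) (α.app j.succ) :=
  countable_choice (v0 ≐ app v2 (succ v1)) (α ;; Env.nil)
    (fun j => exI (α.app j.succ) (eq_refl (α.app j.succ))) fun β _ _ hβ => exI β fun j => hβ j

/-- A dense sequence in Baire space. -/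
theorem denseE (k : ∀ (a : PTm (fn nat baire)) (q : World) [Le q p],
    (q ⊩ Om.all fun m => Om.all fun α => Om.ex fun n => Om.agree m (a.app n) α) → (q ⊩ X)) :
    p ⊩ X := by
  refine unpairE fun f g p₁ _ hfg => ?_
  have key : ∀ G : PTm (fn nat baire), p₁ ⊩ Om.ex fun G' : PTm (fn nat baire) => Om.all fun n =>
      (Om.eq ((G'.app n).app PTm.zero) (f.app n)).and (Om.all fun j =>
        Om.eq ((G'.app n).app j.succ) ((G.app (g.app n)).app j)) := fun G =>
    countable_choice ((app v0 zero ≐ app v2 v1) ⩓ Fm.all nat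
      (app v1 (succ v0) ≐ app (app v5 (app v4 v2)) v0)) (f ;; g ;; G ;; Env.nil)
      (fun n => exists_cons (f.app n) (G.app (g.app n))) fun G' _ _ hG' => exI G' fun n => hG' n
  refine zeroE fun z p₂ _ _ => ?_
  refine countable_choice (v0 ≐ v2) (z ;; Env.nil) (fun _ => exI z (eq_refl z)) fun G₀ p₃ _ _ => ?_
  -- The sequence `G (i + 1)` at `n` is `f n` followed by `G i (g n)`. By induction the terms of `G
  -- m` realize all initial segments of length `m`; the starting value `G₀` is irrelevant.
  refine dependent_choice (Fm.all nat ((app (app v1 v0) zero ≐ app v3 v0) ⩓ Fm.all nat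
      (app (app v2 v1) (succ v0) ≐ app (app v3 (app v5 v1)) v0))) (f ;; g ;; Env.nil) G₀
    (fun G => (key G).up) fun G p₄ _ _
      (hG : ∀ (i : PTm nat) {r : World} [Le r p₄], r ⊩ Om.all fun n =>
        (Om.eq (((G.app i.succ).app n).app PTm.zero) (f.app n)).and (Om.all fun j =>
          Om.eq (((G.app i.succ).app n).app j.succ) (((G.app i).app (g.app n)).app j))) => ?_
  have step : ∀ (m : PTm nat) (q : World) [Le q p₄],
      (q ⊩ Om.all fun α => Om.ex fun n => Om.agree m ((G.app m).app n) α) →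
      (q ⊩ Om.all fun α => Om.ex fun n => Om.agree m.succ ((G.app m.succ).app n) α) := by
    intro m q _ ih α
    refine exE (exists_tail α) fun β q₁ _ hβ => exE (ih β).up fun n' q₂ _ hn' =>
      exE (hfg (α.app PTm.zero) n').up fun n q₃ _ hn => exI n fun i q₄ _ hi => ?_
    refine orE (nat_cases i) (fun r _ hr => ?_) fun r _ hr => exE hr fun j r' _ hj => ?_
    · refine eq_trans (app_congr (eq_refl _) hr) (eq_trans (hG m n).1 (eq_trans hn.1.up ?_))
      exact app_congr (eq_refl α) (eq_symm hr)
    · have h₁ : r' ⊩ Om.ltN j m := lt_of_model fun M => by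
        have h₂ := M.lt hi.up
        have h₃ := M.eq hj
        rw [M.ν_succ] at h₂ h₃
        linarith
      refine eq_trans (app_congr (eq_refl _) hj) (eq_trans ((hG m n).2 j) (eq_trans ?_
        (eq_trans (hn' j h₁) (eq_trans (hβ j).up (app_congr (eq_refl α) (eq_symm hj))))))
      exact app_congr (app_congr (eq_refl _) hn.2.up) (eq_refl j)
  have hG' : ∀ m, p₄ ⊩ Om.all fun α => Om.ex fun n => Om.agree m ((G.app m).app n) α :=
    induction (Fm.all baire (Fm.ex nat (Agree v2 (app (app v3 v2) v0) v1))) (G ;; Env.nil)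
      (fun α => exI PTm.zero (agree_zero ((G.app PTm.zero).app PTm.zero) α)) step
  -- The double sequence `G m n` is arranged as a single one by means of the surjection onto pairs.
  refine countable_choice (v0 ≐ app (app v2 (app v3 v1)) (app v4 v1)) (G ;; f ;; g ;; Env.nil)
    (fun n => exI ((G.app (f.app n)).app (g.app n)) (eq_refl ((G.app (f.app n)).app (g.app n))))
    fun a q _ (ha : ∀ n {r : World} [Le r q],
      r ⊩ Om.eq (a.app n) ((G.app (f.app n)).app (g.app n))) => k a q fun m α => ?_
  refine exE (hG' m α).up fun n r _ hn => exE (hfg m n).up fun l r' _ hl => exI l ?_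
  refine agree_trans (agree_of_eq (eq_trans (ha l) ?_)) hn.up
  exact app_congr (app_congr (eq_refl G) hl.1) hl.2

end Dense

/-! ### Continuity on Baire space from continuity on metric spaces -/

section Baire

variable {p : World} {X : Om}

/-- The set of all objects of a sort. -/
theorem univE (σ : Srt) (k : ∀ (U : PTm (pow σ)) (q : World) [Le q p],
    (q ⊩ Om.all fun x => Om.mem x U) → (q ⊩ X)) : p ⊩ X :=
  compE (σ := σ) (v0 ≐ v0) Env.nil fun U q _ hU => k U q fun x => (hU x).2 (eq_refl x)

theorem separable_baire {ι : PTm (fn baire baire)} {d : PTm (metric baire)} {U : PTm (pow baire)}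
    (hι : p ⊩ Om.all fun α => Om.eq (ι.app α) α)
    (hd : p ⊩ Om.all fun x => Om.all fun y => Om.isDist ((d.app x).app y) (ι.app x) (ι.app y))
    (hU : p ⊩ Om.all fun x => Om.mem x U) : p ⊩ Om.separable U d := by
  refine denseE fun a p₁ _ ha => zeroE fun e p₂ _ he => compE (Fm.ex nat (app v2 v0 ≐ v1))
    (a ;; Env.nil) fun D p₃ _ (hD : ∀ x {r : World} [Le r p₃], (r ⊩ Om.mem x D) ↔
      (r ⊩ Om.ex fun n => Om.eq (a.app n) x)) => ?_
  refine exI D ⟨exI e (exI a fun x => ⟨fun q _ hq => ?_, fun q _ hq => ?_⟩), fun x _ _ _ => (hU x).up,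
    fun x q _ _ ε r _ hε => ?_⟩
  · exact exE ((hD x).1 hq) fun n _ _ hn => exI n ⟨(he n).up, hn⟩
  · exact (hD x).2 (exE hq fun n _ _ hn => exI n hn.2)
  · refine exE (exists_unit_ltQ hε) fun m r₁ _ hm => exE (ha m x).up fun n r₂ _ hn =>
      exI (a.app n) ⟨(hD _).2 (exI n (eq_refl _)), ((hd x (a.app n)).2 ε).2 (exI m ⟨?_, hm.up⟩)⟩
    exact agree_trans (agree_of_eq (hι x).up) (agree_trans (agree_symm hn)
      (agree_of_eq (eq_symm (hι _).up)))

/-- The embedding of the natural numbers into Baire space by constant sequences. -/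
theorem constE (k : ∀ (c : PTm (fn nat baire)) (q : World) [Le q p],
    (q ⊩ Om.all fun n => Om.all fun i => Om.eq ((c.app n).app i) n) → (q ⊩ X)) : p ⊩ X := by
  have key : ∀ n : PTm nat, p ⊩ Om.ex fun β : PTm baire => Om.all fun i => Om.eq (β.app i) n :=
    fun n => countable_choice (v0 ≐ v2) (n ;; Env.nil) (fun _ => exI n (eq_refl n))
      fun β _ _ hβ => exI β fun i => hβ i
  exact countable_choice (Fm.all nat (app v1 v0 ≐ v2)) Env.nil key fun c q _ hc => k c q fun n => hc n

/-- The identity of Baire space. -/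
theorem idE (k : ∀ (ι : PTm (fn baire baire)) (q : World) [Le q p],
    (q ⊩ Om.all fun α => Om.eq (ι.app α) α) → (q ⊩ X)) : p ⊩ X :=
  unique_choice (σ := baire) (τ := baire) (v0 ≐ v1) Env.nil (fun α => exI α (eq_refl α))
    (fun α y z q _ (h : q ⊩ Om.eq y α) (h' : q ⊩ Om.eq z α) => eq_trans h (eq_symm h'))
    fun ι q _ hι => k ι q fun α => hι α

/-- Convergence in the two metrics means agreement on initial segments and eventual equality, so the
notions of continuity for `f` and for its graph correspond. Only the instance for the sorts `baire`
and `nat` is required. -/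
theorem seqContBaire_of_metric (h : p ⊩ (SeqContMetric baire nat).ev Env.nil) :
    p ⊩ SeqContBaire.ev Env.nil := by
  intro f p₀ _ hf
  have hf : p₀ ⊩ Om.all fun a : PTm (fn nat baire) => Om.all fun α => (Om.baireConv a α).imp
    (Om.ex fun N => Om.all fun n => (Om.leN N n).imp (Om.eq (f.app (a.app n)) (f.app α))) := hf
  refine idE fun ι p₁ _ hι => constE fun c p₂ _ hc => distE ι fun d p₃ _ hd => distE c
    fun ρ p₄ _ hρ => univE baire fun U p₅ _ hU => univE nat fun V p₆ _ hV => ?_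
  refine compE₂ (v0 ≐ app v2 v1) (f ;; Env.nil) fun F p₇ _ (hF : ∀ x y {r : World} [Le r p₇],
    (r ⊩ Om.mem (x.pair y) F) ↔ (r ⊩ Om.eq y (f.app x))) => ?_
  have hX : p₇ ⊩ Om.isMetric U d := isMetric_of_isDist (fun x y q _ hq =>
    eq_trans (eq_symm (hι x).up) (eq_trans hq (hι y).up)) hd.up
  have hY : p₇ ⊩ Om.isMetric V ρ := isMetric_of_isDist (fun x y q _ hq =>
    eq_trans (eq_symm (hc x PTm.zero).up) (eq_trans (app_congr hq (eq_refl _)) (hc y PTm.zero).up))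
    hρ.up
  have hM : p₇ ⊩ Om.isMap U V F :=
    ⟨fun x y q _ _ => ⟨(hU x).up, (hV y).up⟩, fun x q _ _ => exI (f.app x) ((hF _ _).2 (eq_refl _)),
      fun x y z q _ hq => eq_trans ((hF _ _).1 hq.1) (eq_symm ((hF _ _).1 hq.2))⟩
  have hS : p₇ ⊩ Om.seqCont d ρ F := by
    intro s x t y q _ hq
    have h₁ : q ⊩ Om.baireConv s x := fun k =>
      exE (hq.2.2 (PTm.unit k) (unit_pos k)) fun N r _ hN => exI N fun n r' _ hn => by
        have h₂ : r' ⊩ Om.above ((d.app (s.app n)).app x) (PTm.unit k) := hN n hn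
        have h₃ := agree_of_above hd.up h₂
        refine agree_mono (le_of_model fun M => ?_) (agree_trans (agree_of_eq
          (eq_symm (hι (s.app n)).up)) (agree_trans h₃ (agree_of_eq (hι x).up)))
        rw [M.ν_succ]
        linarith
    refine conv_of_agree hρ.up fun k => exE (hf s x h₁) fun N r _ hN => exI N fun n r' _ hn =>
      agree_of_eq (app_congr (eq_refl c) ?_)
    have h₂ : r' ⊩ Om.eq (t.app n) (f.app (s.app n)) := (hF _ _).1 (Forces.up (hq.1 n))
    have h₃ : r' ⊩ Om.eq y (f.app x) := (hF _ _).1 (Forces.up hq.2.1)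
    exact eq_trans h₂ (eq_trans (hN n hn) (eq_symm h₃))
  have hC : p₇ ⊩ Om.ptCont d ρ F :=
    h U d V ρ F ⟨hX, separable_baire hι.up hd.up hU.up, hY, hM, hS⟩
  intro α
  -- For `ε = 1` a distance less than `ε` forces constant sequences to agree at place `0`, that is,
  -- the numbers are equal.
  refine exE (hC α (f.app α) ((hF α (f.app α) (r := p₇)).2 (eq_refl _)) (PTm.unit PTm.zero) (unit_pos _))
    fun δ q _ hδ => exE (exists_unit_ltQ hδ.1) fun m r _ hm => exI m fun β r' _
      (hβ : r' ⊩ Om.agree m α β) => ?_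
  have h₁ : r' ⊩ Om.above ((d.app α).app β) δ := ((hd α β).2 δ).2 (exI m
    ⟨agree_trans (agree_of_eq (hι α).up) (agree_trans hβ (agree_of_eq (eq_symm (hι β).up))), hm.up⟩)
  have h₂ : r' ⊩ Om.above ((ρ.app (f.app α)).app (f.app β)) (PTm.unit PTm.zero) :=
    hδ.2 β (f.app β) ⟨(hF _ _).2 (eq_refl _), h₁⟩
  have h₃ : r' ⊩ Om.eq ((c.app (f.app α)).app PTm.zero) ((c.app (f.app β)).app PTm.zero) :=
    agree_of_above hρ.up h₂ PTm.zero (nat_le_refl _)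
  exact eq_trans (eq_symm (hc (f.app β) PTm.zero).up) (eq_trans (eq_symm h₃)
    (hc (f.app α) PTm.zero).up)

theorem locBdd_of_seqContBaire (h : p ⊩ SeqContBaire.ev Env.nil) :
    p ⊩ SeqContLocBdd.ev Env.nil := by
  intro f q _ hf α
  refine exE (h f hf α) fun k r _ hk => exI k (exI (f.app α) fun β r' _ hβ => ?_)
  exact nat_le_of_eq (a := f.app β) (b := f.app α) (hk β hβ)

end Baire

end BISH

/-- Over intuitionistic higher-order arithmetic with countable and dependent choice, BD-N is
equivalent to each of: every sequentially continuous map on a separable metric space is pointwise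
continuous (for spaces of all sorts); every sequentially continuous map from Baire space to the
natural numbers is pointwise continuous; every such map is locally bounded. -/
theorem proposition4p1p1 :
    ((∀ σ τ : BISH.Srt, BISH.Provable (BISH.BDN ⇾ BISH.SeqContMetric σ τ)) ∧
      BISH.Prf {φ : BISH.Sentence | ∃ σ τ : BISH.Srt, φ = BISH.SeqContMetric σ τ} BISH.BDN) ∧
    BISH.Provable (BISH.BDN ⟺ BISH.SeqContBaire) ∧
    BISH.Provable (BISH.BDN ⟺ BISH.SeqContLocBdd) := by
  refine ⟨⟨fun σ τ => ?_, ?_⟩, ?_, ?_⟩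
  · exact BISH.Prf.of_forces (φ := BISH.BDN ⇾ BISH.SeqContMetric σ τ)
      (fun _ _ h => BISH.seqContMetric_of_bdn h) ∅
  · exact BISH.Prf.impE (BISH.Prf.of_forces (φ := BISH.SeqContMetric BISH.baire BISH.Srt.nat ⇾
      BISH.BDN) (fun _ _ h => BISH.bdn_of_locBdd (BISH.locBdd_of_seqContBaire
        (BISH.seqContBaire_of_metric h))) _) (BISH.Prf.hyp ⟨_, _, rfl⟩)
  · exact BISH.Prf.of_forces (φ := BISH.BDN ⟺ BISH.SeqContBaire)
      ⟨fun _ _ h => BISH.seqContBaire_of_metric (BISH.seqContMetric_of_bdn h),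
        fun _ _ h => BISH.bdn_of_locBdd (BISH.locBdd_of_seqContBaire h)⟩ ∅
  · exact BISH.Prf.of_forces (φ := BISH.BDN ⟺ BISH.SeqContLocBdd)
      ⟨fun _ _ h => BISH.locBdd_of_seqContBaire
          (BISH.seqContBaire_of_metric (BISH.seqContMetric_of_bdn h)),
        fun _ _ h => BISH.bdn_of_locBdd h⟩ ∅
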